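/- **Theorem 3.1.** *The system.* Let $0<k_3<k_1$, $0<w_M<w_m$, and consider for $u=(v,w)$, $w>-1$, the system $$\partial_t w-\partial_x v=0,\qquad \partial_t v-\partial_x\sigma(w)=0,$$ where $\sigma(w)=k_1w$ for $w\le w_M$, $\sigma(w)=k_3w$ for $w\ge w_m$, and $\sigma$ is affine and continuous on $[w_M,w_m]$. Put $c_i=\sqrt{k_i}$, $\mathcal H_1=\{-1<w\le w_M\}$ (phase 1), $\mathcal H_3=\{w\ge w_m\}$ (phase 3), $\mathcal H=\mathcal H_1\cup\mathcal H_3$. For two states $u_L,u_R\in\mathcal H$, with $c(w)=c_1$ in phase 1 and $c(w)=c_3$ in phase 3, let $$h_{LR}=\frac{c(w_L)w_L+c(w_R)w_R+v_R-v_L}{c(w_L)+c(w_R)} .$$ *The entropy dissipation function.* Let $\phi:(-c_3,c_3]\to\mathbb R$ be strictly increasing and of class $C^2$ on $(-c_3,0)\cup(0,c_3]$, such that $\phi(0\pm)$, $\phi'(0\pm)$ and the third left derivative of $\phi$ at $c_3$ exist, $\phi(V)\to-\infty$ as $V\to-c_3+$, $\phi(V)\to\overline\psi(c_3)$ as $V\to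 c_3-$, $\underline\psi\le\phi\le0$ on $(-c_3,0]$ and $0\le\phi\le\overline\psi$ on $[0,c_3]$, where $$\underline\psi(V)=\tfrac{k_1-k_3}2w_M\Big(w_m-\tfrac{k_1-V^2}{k_3-V^2}w_M\Big),\qquad \overline\psi(V)=\tfrac{k_1-k_3}2w_m\Big(w_M-\tfrac{k_3-V^2}{k_1-V^2}w_m\Big).$$ The kinetic relation for a discontinuity of speed $V$ between a phase 1 state $u_-$ on the left and a phase 3 state $u_+$ on the right is $$\int_{w_-}^{w_+}\Big(\sigma(y)-\tfrac12(\sigma(w_-)+\sigma(w_+))\Big)dy=\phi(V),$$ where for $V=0$ the equality means that the left side lies in $[\phi(0-),\phi(0+)]$. The kinetic relation for phase 3 on the left and phase 1 on the right is the one obtained by the reflection $(x,v,V)\mapsto(-x,-v,-V)$. *The Riemann solver.* All discontinuities below satisfy the Rankine–Hugoniot relations. For $u_L\in\mathcal H_1$, $u_R\in\mathcal H_3$ the Riemann solution consists, if $h_{LR}>0$, of a contact discontinuity of speed $-c_1$ in phase 1, a phase boundary of speed $V\in(-c_3,c_3)$ satisfying the kinetic relation, and a contact discontinuity of speed $c_3$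 in phase 3; if $h_{LR}\le0$, of a contact discontinuity of speed $-c_1$ in phase 1 and a phase boundary of speed $V\in[c_3,c_1)$. For $u_L\in\mathcal H_3$, $u_R\in\mathcal H_1$ it is obtained by reflection. For $u_L,u_R\in\mathcal H_i$ with $h_{LR}$ a strain of phase $i$, it consists of two contact discontinuities of speeds $\mp c_i$ with an intermediate state in $\mathcal H_i$. For $u_L,u_R\in\mathcal H_1$ with $h_{LR}>w_M$, or $u_L,u_R\in\mathcal H_3$ with $h_{LR}<w_m$, a state of the other phase is created between two phase boundaries of speeds in $(-c_3,0)$ and $(0,c_3)$, both satisfying the kinetic relation, in addition to the two contact discontinuities. *The unperturbed front.* Let $u_L^*\in\mathcal H_1$ with $w_L^*<w_M$ and $u_R^*\in\mathcal H_3$ with $w_R^*>w_m$ be such that the Riemann solution with data $u_L^*,u_R^*$ is a single phase boundary of speed $V^*$. If $V^*=c_3$, suppose moreover that $w_L^*=0$ and $w_R^*=\sqrt{\phi'(c_3)/c_3}$. *The data and the scheme.* Write $\|f\|_{BV}=\|f\|_{L^1}+TV(f)$. Fix $\lambda>c_1$. For $h>0$ let $\tau=h/\lambda$, and let $(a_n)_{n\ge1}$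 be any sequence in $(-1,1)$ (in particular an equidistributed one). Given $u_0:\mathbb R\to\mathcal H$, with restrictions $u_L^0$ to $x<0$ and $u_R^0$ to $x>0$, Glimm's scheme defines $u^h$ as follows. For $m$ even, $u^h(0,x)=\frac1{2h}\int_{mh}^{(m+2)h}u_0$ for $x\in[mh,(m+2)h)$. For $n\tau\le t<(n+1)\tau$, $u^h$ is given by the Riemann solutions issued from the points $(n\tau,mh)$, $m+n$ even. For $n\ge1$ and $m+n$ even, $u^h(n\tau,x)=u^h(n\tau-0,(m+1+a_n)h-0)$ for $x\in[mh,(m+2)h)$. *Conclusion.* There are constants $\varepsilon>0$ and $C$, depending only on the material, on $\phi$, on $u_L^*,u_R^*,V^*$ and on $\lambda$, such that the following holds for all $h>0$, all sequences $(a_n)$ and all data with $\|u_L^0-u_L^*\|_{BV(\mathbb R_-)}+\|u_R^0-u_R^*\|_{BV(\mathbb R_+)}<\varepsilon$. The scheme is well defined for all times. For every $t\ge0$ there is a single point $\chi^h(t)$ such that $u^h(t,x)\in\mathcal H_1$ for $x<\chi^h(t)$ and $u^h(t,x)\in\mathcal H_3$ for $x>\chi^h(t)$. With $\tilde u^h(t,x)=u_L^*$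 for $x<\chi^h(t)$, $\tilde u^h(t,x)=u_R^*$ for $x>\chi^h(t)$, $$N_2=\|u_L^0-u_L^*\|_{L^\infty(\mathbb R_-)}+\|u_R^0-u_R^*\|_{L^\infty(\mathbb R_+)},\qquad N_1=TV_{-\infty}^0(u_L^0)+TV_0^\infty(u_R^0)+\begin{cases}0&V^*\ne c_3,\\N_2&V^*=c_3,\end{cases}$$ one has for all $t,t'\ge0$ $$TV_{-\infty}^{+\infty}\big((u^h-\tilde u^h)(t)\big)\le C\,N_1,\qquad \|u^h(t)-\tilde u^h(t)\|_{L^\infty(\mathbb R)}\le C\,(N_1+N_2),$$ $$\|(u^h-\tilde u^h)(t)-(u^h-\tilde u^h)(t')\|_{L^1(\mathbb R)}\le C\,N_1\,(|t-t'|+h),\qquad \|u^h(t)-u^h(t')\|_{L^1(\mathbb R)}\le C\,(|t-t'|+h).$$ -/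

import Mathlib

open MeasureTheory Set Filter Topology
open scoped ENNReal NNReal

namespace PhaseDyn

noncomputable section

/-! ### The material and the system `∂ₜ w - ∂ₓ v = 0`, `∂ₜ v - ∂ₓ σ(w) = 0` -/

/-- The constants of the piecewise linear stress-strain law. -/
structure Material where
  k₁ : ℝ
  k₃ : ℝ
  wM : ℝ
  wm : ℝ
  k₃_pos : 0 < k₃
  k₃_lt : k₃ < k₁
  wM_pos : 0 < wM
  wM_lt : wM < wm

/-- A state `u = (v, w)`: velocity `v = u.1` and strain `w = u.2`. -/
abbrev State := ℝ × ℝ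

namespace Material

variable (p : Material)

/-- The stress `σ(w)`. -/
def stress (w : ℝ) : ℝ :=
  if w ≤ p.wM then p.k₁ * w
  else if w ≤ p.wm then
    p.k₃ * p.wm + (p.k₁ * p.wM - p.k₃ * p.wm) * (w - p.wm) / (p.wM - p.wm)
  else p.k₃ * w

/-- Sound speed of phase 1. -/
def c₁ : ℝ := Real.sqrt p.k₁

/-- Sound speed of phase 3. -/
def c₃ : ℝ := Real.sqrt p.k₃

/-- The phase 1 states. -/
def H₁ : Set State := {u | -1 < u.2 ∧ u.2 ≤ p.wM}

/-- The phase 3 states. -/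
def H₃ : Set State := {u | p.wm ≤ u.2}

/-- Sound speed at a strain `w` of phase 1 or 3. -/
def c (w : ℝ) : ℝ := if w ≤ p.wM then p.c₁ else p.c₃

/-- The averaged strain `h_{LR}` of a jump from `uL` to `uR`. -/
def avgStrain (uL uR : State) : ℝ :=
  (p.c uL.2 * uL.2 + p.c uR.2 * uR.2 + uR.1 - uL.1) / (p.c uL.2 + p.c uR.2)

/-- Rankine-Hugoniot relations for a discontinuity with speed `V` between `uL` and `uR`. -/
def RankineHugoniot (V : ℝ) (uL uR : State) : Prop :=
  V * (uR.2 - uL.2) + (uR.1 - uL.1) = 0 ∧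
    V * (uR.1 - uL.1) + (p.stress uR.2 - p.stress uL.2) = 0

/-- The entropy dissipation rate of a discontinuity between strains `wL` and `wR`. -/
def dissipation (wL wR : ℝ) : ℝ :=
  - ∫ y in wL..wR, (p.stress y - (p.stress wR + p.stress wL) / 2)

/-- The minimal entropy dissipation function, meant for `V ∈ (-c₃, 0]`. -/
def psiMin (V : ℝ) : ℝ :=
  (p.k₁ - p.k₃) / 2 * p.wM * (p.wm - (p.k₁ - V ^ 2) / (p.k₃ - V ^ 2) * p.wM)

/-- The maximal entropy dissipation function, meant for `V ∈ [0, c₃]`. -/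
def psiMax (V : ℝ) : ℝ :=
  (p.k₁ - p.k₃) / 2 * p.wm * (p.wM - (p.k₃ - V ^ 2) / (p.k₁ - V ^ 2) * p.wm)

/-- The left derivative `φ'(c₃)`. -/
def slopeAtSound (φ : ℝ → ℝ) : ℝ := derivWithin φ (Ioc 0 p.c₃) p.c₃

/-- The standing assumptions on an entropy dissipation function `φ` on `(-c₃, c₃]`. -/
structure IsDissipationFunction (φ : ℝ → ℝ) : Prop where
  contDiffOn : ContDiffOn ℝ 2 φ (Ioo (-p.c₃) 0 ∪ Ioc 0 p.c₃)
  left_zero : ∃ l, Tendsto φ (𝓝[<] 0) (𝓝 l)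
  right_zero : ∃ l, Tendsto φ (𝓝[>] 0) (𝓝 l)
  deriv_left_zero : ∃ l, Tendsto (deriv φ) (𝓝[<] 0) (𝓝 l)
  deriv_right_zero : ∃ l, Tendsto (deriv φ) (𝓝[>] 0) (𝓝 l)
  tendsto_sound : Tendsto φ (𝓝[<] p.c₃) (𝓝 (p.psiMax p.c₃))
  third_deriv : DifferentiableWithinAt ℝ (iteratedDerivWithin 2 φ (Ioc 0 p.c₃))
    (Ioc 0 p.c₃) p.c₃
  tendsto_neg_sound : Tendsto φ (𝓝[>] (-p.c₃)) atBot
  strictMonoOn : StrictMonoOn φ (Ioc (-p.c₃) p.c₃)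
  bounds_neg : ∀ V ∈ Ioc (-p.c₃) 0, p.psiMin V ≤ φ V ∧ φ V ≤ 0
  bounds_nonneg : ∀ V ∈ Icc 0 p.c₃, 0 ≤ φ V ∧ φ V ≤ p.psiMax V

/-- The values of `φ` at the speed `V`. Since `φ` may jump at `0`, the graph of `φ` is completed
there by the segment between the two one-sided limits, so that `φ` has a single-valued
continuous inverse. -/
def kineticGraph (φ : ℝ → ℝ) (V : ℝ) : Set ℝ :=
  if V = 0 then Icc (Function.leftLim φ 0) (Function.rightLim φ 0) else {φ V}

/-- The kinetic relation along a subsonic phase boundary with speed `V`: the dissipation is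
`-φ(V)` when phase 1 is on the left and `φ(-V)` when phase 3 is on the left. -/
def Kinetic (φ : ℝ → ℝ) (V : ℝ) (uL uR : State) : Prop :=
  (uL ∈ p.H₁ ∧ uR ∈ p.H₃ ∧ - p.dissipation uL.2 uR.2 ∈ kineticGraph φ V) ∨
    (uL ∈ p.H₃ ∧ uR ∈ p.H₁ ∧ p.dissipation uL.2 uR.2 ∈ kineticGraph φ (-V))

end Material

/-! ### The Riemann problem -/

/-- The self-similar step function with leftmost state `u₀` and then a list of pairs
(speed of a wave, state behind it), ordered from left to right; its argument is `ξ = x / t`. -/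
def fan : State → List (ℝ × State) → ℝ → State
  | u₀, [], _ => u₀
  | u₀, (s, u) :: l, ξ => if ξ < s then u₀ else fan u l ξ

/-- `IsRiemannSolution p φ uL uR R`: the function `R (x / t)` is the admissible solution of the
Riemann problem with left state `uL` and right state `uR`. -/
inductive IsRiemannSolution (p : Material) (φ : ℝ → ℝ) (uL uR : State) : (ℝ → State) → Prop
  /-- Both states in phase 1, no new phase. -/
  | stay₁ (us : State) (hL : uL ∈ p.H₁) (hR : uR ∈ p.H₁)
      (hh : -1 < p.avgStrain uL uR ∧ p.avgStrain uL uR ≤ p.wM) (hs : us ∈ p.H₁)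
      (h1 : p.RankineHugoniot (-p.c₁) uL us) (h2 : p.RankineHugoniot p.c₁ us uR) :
      IsRiemannSolution p φ uL uR (fan uL [(-p.c₁, us), (p.c₁, uR)])
  /-- Both states in phase 3, no new phase. -/
  | stay₃ (us : State) (hL : uL ∈ p.H₃) (hR : uR ∈ p.H₃)
      (hh : p.wm ≤ p.avgStrain uL uR) (hs : us ∈ p.H₃)
      (h1 : p.RankineHugoniot (-p.c₃) uL us) (h2 : p.RankineHugoniot p.c₃ us uR) :
      IsRiemannSolution p φ uL uR (fan uL [(-p.c₃, us), (p.c₃, uR)])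
  /-- Both states in phase 1, a phase 3 state is created. -/
  | nucleate₁ (u1 u2 u3 : State) (V' V : ℝ) (hL : uL ∈ p.H₁) (hR : uR ∈ p.H₁)
      (hh : p.wM < p.avgStrain uL uR) (hu1 : u1 ∈ p.H₁) (hu2 : u2 ∈ p.H₃) (hu3 : u3 ∈ p.H₁)
      (hV' : V' ∈ Ioo (-p.c₃) 0) (hV : V ∈ Ioo 0 p.c₃)
      (h1 : p.RankineHugoniot (-p.c₁) uL u1) (h2 : p.RankineHugoniot V' u1 u2)
      (h3 : p.RankineHugoniot V u2 u3) (h4 : p.RankineHugoniot p.c₁ u3 uR)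
      (hk' : p.Kinetic φ V' u1 u2) (hk : p.Kinetic φ V u2 u3) :
      IsRiemannSolution p φ uL uR (fan uL [(-p.c₁, u1), (V', u2), (V, u3), (p.c₁, uR)])
  /-- Both states in phase 3, a phase 1 state is created. -/
  | nucleate₃ (u1 u2 u3 : State) (V' V : ℝ) (hL : uL ∈ p.H₃) (hR : uR ∈ p.H₃)
      (hh : p.avgStrain uL uR < p.wm) (hu1 : u1 ∈ p.H₃) (hu2 : u2 ∈ p.H₁) (hu3 : u3 ∈ p.H₃)
      (hV' : V' ∈ Ioo (-p.c₃) 0) (hV : V ∈ Ioo 0 p.c₃)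
      (h1 : p.RankineHugoniot (-p.c₃) uL u1) (h2 : p.RankineHugoniot V' u1 u2)
      (h3 : p.RankineHugoniot V u2 u3) (h4 : p.RankineHugoniot p.c₃ u3 uR)
      (hk' : p.Kinetic φ V' u1 u2) (hk : p.Kinetic φ V u2 u3) :
      IsRiemannSolution p φ uL uR (fan uL [(-p.c₃, u1), (V', u2), (V, u3), (p.c₃, uR)])
  /-- Phase 1 on the left and phase 3 on the right, subsonic phase boundary. -/
  | sub₁₃ (um up : State) (V : ℝ) (hL : uL ∈ p.H₁) (hR : uR ∈ p.H₃)
      (hh : 0 < p.avgStrain uL uR) (hm : um ∈ p.H₁) (hp : up ∈ p.H₃)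
      (hV : V ∈ Ioo (-p.c₃) p.c₃)
      (h1 : p.RankineHugoniot (-p.c₁) uL um) (h2 : p.RankineHugoniot V um up)
      (h3 : p.RankineHugoniot p.c₃ up uR) (hk : p.Kinetic φ V um up) :
      IsRiemannSolution p φ uL uR (fan uL [(-p.c₁, um), (V, up), (p.c₃, uR)])
  /-- Phase 1 on the left and phase 3 on the right, supersonic (or sonic) phase boundary. -/
  | super₁₃ (um : State) (V : ℝ) (hL : uL ∈ p.H₁) (hR : uR ∈ p.H₃)
      (hh : p.avgStrain uL uR ≤ 0) (hm : um ∈ p.H₁) (hV : V ∈ Ico p.c₃ p.c₁)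
      (h1 : p.RankineHugoniot (-p.c₁) uL um) (h2 : p.RankineHugoniot V um uR) :
      IsRiemannSolution p φ uL uR (fan uL [(-p.c₁, um), (V, uR)])
  /-- Phase 3 on the left and phase 1 on the right, subsonic phase boundary. -/
  | sub₃₁ (um up : State) (V : ℝ) (hL : uL ∈ p.H₃) (hR : uR ∈ p.H₁)
      (hh : 0 < p.avgStrain uL uR) (hm : um ∈ p.H₃) (hp : up ∈ p.H₁)
      (hV : V ∈ Ioo (-p.c₃) p.c₃)
      (h1 : p.RankineHugoniot (-p.c₃) uL um) (h2 : p.RankineHugoniot V um up)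
      (h3 : p.RankineHugoniot p.c₁ up uR) (hk : p.Kinetic φ V um up) :
      IsRiemannSolution p φ uL uR (fan uL [(-p.c₃, um), (V, up), (p.c₁, uR)])
  /-- Phase 3 on the left and phase 1 on the right, supersonic (or sonic) phase boundary. -/
  | super₃₁ (up : State) (V : ℝ) (hL : uL ∈ p.H₃) (hR : uR ∈ p.H₁)
      (hh : p.avgStrain uL uR ≤ 0) (hp : up ∈ p.H₁) (hV : V ∈ Ioc (-p.c₁) (-p.c₃))
      (h1 : p.RankineHugoniot V uL up) (h2 : p.RankineHugoniot p.c₁ up uR) :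
      IsRiemannSolution p φ uL uR (fan uL [(V, up), (p.c₁, uR)])

/-! ### Functions of bounded variation -/

/-- Total variation on an open interval `s` of (the Lebesgue class of) `f`: the least pointwise
variation of a representative. -/
def totalVariation (f : ℝ → State) (s : Set ℝ) : ℝ≥0∞ :=
  ⨅ (g : ℝ → State) (_ : f =ᵐ[volume.restrict s] g), eVariationOn g s

/-- The norm `‖f‖_{L¹(s)} + TV(f, s)` of `BV(s)`. -/
def bvNorm (f : ℝ → State) (s : Set ℝ) : ℝ≥0∞ :=
  eLpNorm f 1 (volume.restrict s) + totalVariation f s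

/-! ### Glimm's scheme -/

/-- `IsGlimmApproximation p φ lam h a u₀ u`: the function `u t x`, for `t ≥ 0`, is the approximate
solution given by Glimm's scheme with space mesh size `h`, time mesh size `τ = h / lam`, sampling
sequence `a 1, a 2, …` and initial data `u₀`. Here `R n m` is the Riemann solution issued from
the point `(t, x) = (n τ, m h)`, for `n + m` even. -/
def IsGlimmApproximation (p : Material) (φ : ℝ → ℝ) (lam h : ℝ) (a : ℕ → ℝ)
    (u₀ : ℝ → State) (u : ℝ → ℝ → State) : Prop :=
  ∃ R : ℕ → ℤ → ℝ → State,
    -- cell averages of the initial data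
    (∀ m : ℤ, Even m → ∀ x ∈ Ico (m * h) ((m + 2) * h),
      u 0 x = (1 / (2 * h)) • ∫ y in (m * h)..((m + 2) * h), u₀ y) ∧
    -- Riemann problems in each time strip
    (∀ (n : ℕ) (m : ℤ), Even (n + m) →
      IsRiemannSolution p φ (u (n * (h / lam)) ((m - 1) * h)) (u (n * (h / lam)) (m * h))
          (R n m) ∧
        ∀ t ∈ Ioo (n * (h / lam)) ((n + 1) * (h / lam)),
          ∀ x ∈ Ico ((m - 1) * h) ((m + 1) * h),
            u t x = R n m ((x - m * h) / (t - n * (h / lam)))) ∧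
    -- sampling of the left limit at the point `(m + 1 + a (n + 1)) h`, at time `(n + 1) τ - 0`
    (∀ (n : ℕ) (m : ℤ), Even (n + 1 + m) → ∀ x ∈ Ico (m * h) ((m + 2) * h),
      Tendsto (fun y : ℝ => R n (m + 1) ((y - (m + 1) * h) / (h / lam)))
        (𝓝[<] ((m + 1 + a (n + 1)) * h)) (𝓝 (u ((n + 1) * (h / lam)) x)))

/-- `χ` is the phase boundary of `u`: at each time `t ≥ 0`, the state is in phase 1 on the left of
`χ t` and in phase 3 on the right. (At most one such `χ t` exists.) -/
def IsPhaseBoundary (p : Material) (u : ℝ → ℝ → State) (χ : ℝ → ℝ) : Prop :=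
  ∀ t, 0 ≤ t → (∀ x < χ t, u t x ∈ p.H₁) ∧ ∀ x > χ t, u t x ∈ p.H₃

/-- The piecewise constant front with states `uL` and `uR` located at `y`. -/
def front (uL uR : State) (y x : ℝ) : State := if x < y then uL else uR

/-- `N₂ = ‖u₀ - uL‖_{L^∞(x < 0)} + ‖u₀ - uR‖_{L^∞(x > 0)}`. -/
def dataSup (uL uR : State) (u₀ : ℝ → State) : ℝ≥0∞ :=
  eLpNorm (fun x => u₀ x - uL) ∞ (volume.restrict (Iio 0)) +
    eLpNorm (fun x => u₀ x - uR) ∞ (volume.restrict (Ioi 0))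

open Classical in
/-- `N₁ = TV(u₀; x < 0) + TV(u₀; x > 0)`, to which `N₂` is added when `V = c₃`. -/
def dataVariation (p : Material) (V : ℝ) (uL uR : State) (u₀ : ℝ → State) : ℝ≥0∞ :=
  totalVariation u₀ (Iio 0) + totalVariation u₀ (Ioi 0) +
    if V = p.c₃ then dataSup uL uR u₀ else 0

end

end PhaseDyn

/-! Inside a phase the system is linear: `v - c w` travels with speed `c`, `v + c w` with speed
`-c`, and contact discontinuities cross without interacting. There the sampling in Glimm's scheme
only shifts sequences of Riemann invariants. All nonlinearity sits at the phase boundary. It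
receives `r = v - c₁ w` from the left and `q = v + c₃ w` from the right, sends `l = v + c₁ w` to the
left and, when subsonic, `s = v - c₃ w` to the right; a supersonic boundary overtakes `s` instead.
The averaged strain is `h = (q - r)/(c₁ + c₃)`, and its sign separates the two regimes.

The Riemann solver at the front. Multiplying the two Rankine-Hugoniot relations gives `h² = wl wr
Q(V)`, where the kinetic relation prescribes `wl wr` as a decreasing function of `V`. Monotonicity
yields a unique subsonic speed for each `h > 0` (`exists_isSubsonic`, `IsSubsonic.unique`) and,
quantitatively (`speed_gap`), Lipschitz dependence away from `h = 0`. At `h = 0` the relations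
degenerate. Dividing the kinetic relation by `c₃ - V` turns it into a regular equation for the
strain ahead (`sonicSq`), whose value at `V = c₃` is the square of the strain `√(φ'(c₃)/c₃)`
required of a sonic front. With this state the subsonic and supersonic branches fit together in a
Lipschitz way. Moreover the strain behind is `0` at `h = 0` whatever the strain ahead, so `s`
influences the emitted `l` only with weight `max (-h) 0`. These facts are collected in
`IsLocalSolver`.

The Glimm functional. The values of `r` and `q` are only transported and absorbed, `s` is emitted
from `r, q`, and `l` from `r, q, s` and never returns. Hence uniform bounds do not deteriorate
(`IsNear.step`). For the variation, `HasPotential` adds the variations of the four sequences, the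
jumps about to be emitted, and the interaction term `L max (-h) 0 · TV(s)`. Absorbing a jump of `r`
or `q` lowers its weighted variation by enough to pay for the change of the outgoing invariants and
of `h`; overtaking a jump of `s` is paid by the interaction term. So the functional does not
increase (`HasPotential.step`).

Conclusion. Uniqueness of all local Riemann solutions identifies every Glimm approximation with the
orbit of `Config.step` (`IsNear.isRealization`). The bounds in space and time follow by summing over
grid cells. The initial smallness comes from the total variation alone: a function whose distance to
a constant is integrable on a half-line stays within its variation of that constant. -/

namespace PhaseDyn

/-! ### Stress, dissipation, and the Rankine-Hugoniot relations in Riemann invariants. -/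

namespace Material

variable (p : Material)

lemma k₁_pos : 0 < p.k₁ := p.k₃_pos.trans p.k₃_lt

lemma c₃_pos : 0 < p.c₃ := Real.sqrt_pos.2 p.k₃_pos

lemma c₃_lt_c₁ : p.c₃ < p.c₁ := Real.sqrt_lt_sqrt p.k₃_pos.le p.k₃_lt

lemma c₁_pos : 0 < p.c₁ := p.c₃_pos.trans p.c₃_lt_c₁

lemma c₁_sq : p.c₁ ^ 2 = p.k₁ := Real.sq_sqrt p.k₁_pos.le

lemma c₃_sq : p.c₃ ^ 2 = p.k₃ := Real.sq_sqrt p.k₃_pos.le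

lemma wm_pos : 0 < p.wm := p.wM_pos.trans p.wM_lt

lemma stress_of_le {w : ℝ} (hw : w ≤ p.wM) : p.stress w = p.c₁ ^ 2 * w := by
  simp [stress, hw, p.c₁_sq]

lemma stress_of_mid {w : ℝ} (hw : p.wM ≤ w) (hw' : w ≤ p.wm) :
    p.stress w = p.k₃ * p.wm + (p.k₁ * p.wM - p.k₃ * p.wm) * (w - p.wm) / (p.wM - p.wm) := by
  rcases hw.eq_or_lt with rfl | h
  · have : p.wM - p.wm ≠ 0 := (sub_neg.2 p.wM_lt).ne
    rw [stress_of_le _ le_rfl, p.c₁_sq]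
    field_simp
    ring
  · simp [stress, h.not_ge, hw']

lemma stress_of_ge {w : ℝ} (hw : p.wm ≤ w) : p.stress w = p.c₃ ^ 2 * w := by
  rcases hw.eq_or_lt with rfl | h
  · rw [stress_of_mid _ p.wM_lt.le le_rfl, p.c₃_sq]
    simp
  · simp [stress, h.not_ge, (p.wM_lt.trans h).not_ge, p.c₃_sq]

lemma continuous_stress : Continuous p.stress := by
  have hne : p.wM - p.wm ≠ 0 := (sub_neg.2 p.wM_lt).ne
  unfold stress
  refine Continuous.if_le (by fun_prop) (Continuous.if_le (by fun_prop) (by fun_prop)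
    (by fun_prop) (by fun_prop) ?_) (by fun_prop) (by fun_prop) ?_
  · rintro x rfl
    simp
  · rintro x rfl
    simp only [p.wM_lt.le, if_true]
    field_simp
    ring

/-- The integral is a sum of three trapezoids. The squares of the end strains cancel against the
mean stress, so the kinetic relation prescribes the product of the two strains. -/
lemma neg_dissipation {wL wR : ℝ} (hL : wL ≤ p.wM) (hR : p.wm ≤ wR) :
    - p.dissipation wL wR = (p.k₁ - p.k₃) / 2 * (p.wM * p.wm - wL * wR) := by
  have hne : p.wM - p.wm ≠ 0 := (sub_neg.2 p.wM_lt).ne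
  have hint : ∀ a b, IntervalIntegrable p.stress volume a b :=
    fun a b => p.continuous_stress.intervalIntegrable a b
  have e1 : ∫ y in wL..p.wM, p.stress y = p.k₁ * (p.wM ^ 2 - wL ^ 2) / 2 := by
    rw [intervalIntegral.integral_congr (g := fun y => p.k₁ * y)]
    · rw [intervalIntegral.integral_const_mul, integral_id]; ring
    · intro y hy
      rw [uIcc_of_le hL] at hy
      show p.stress y = p.k₁ * y
      rw [p.stress_of_le hy.2, p.c₁_sq]
  have e2 : ∫ y in p.wM..p.wm, p.stress y
      = (p.wm - p.wM) * (p.k₁ * p.wM + p.k₃ * p.wm) / 2 := by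
    rw [intervalIntegral.integral_congr (g := fun y => (p.k₃ * p.wm
      - (p.k₁ * p.wM - p.k₃ * p.wm) * p.wm / (p.wM - p.wm))
      + (p.k₁ * p.wM - p.k₃ * p.wm) / (p.wM - p.wm) * y)]
    · rw [intervalIntegral.integral_add (by simp) (by
        exact (continuous_const.mul continuous_id).intervalIntegrable _ _),
        intervalIntegral.integral_const_mul, integral_id, intervalIntegral.integral_const,
        smul_eq_mul]
      field_simp
      ring
    · intro y hy
      rw [uIcc_of_le p.wM_lt.le] at hy
      simp only [p.stress_of_mid hy.1 hy.2]
      ring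
  have e3 : ∫ y in p.wm..wR, p.stress y = p.k₃ * (wR ^ 2 - p.wm ^ 2) / 2 := by
    rw [intervalIntegral.integral_congr (g := fun y => p.k₃ * y)]
    · rw [intervalIntegral.integral_const_mul, integral_id]; ring
    · intro y hy
      rw [uIcc_of_le hR] at hy
      show p.stress y = p.k₃ * y
      rw [p.stress_of_ge hy.1, p.c₃_sq]
  have e : ∫ y in wL..wR, p.stress y = p.k₁ * (p.wM ^ 2 - wL ^ 2) / 2 +
      (p.wm - p.wM) * (p.k₁ * p.wM + p.k₃ * p.wm) / 2 + p.k₃ * (wR ^ 2 - p.wm ^ 2) / 2 := by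
    rw [← e1, ← e2, ← e3, intervalIntegral.integral_add_adjacent_intervals (hint _ _) (hint _ _),
      intervalIntegral.integral_add_adjacent_intervals (hint _ _) (hint _ _)]
  rw [dissipation, neg_neg, intervalIntegral.integral_sub (hint _ _) (by simp), e,
    p.stress_of_le hL, p.stress_of_ge hR, p.c₁_sq, p.c₃_sq]
  simp only [intervalIntegral.integral_const, smul_eq_mul]
  ring

/-- At speed `-c` the two relations are proportional, so a contact discontinuity preserves one
invariant and leaves the other free. -/
lemma rankineHugoniot_neg_sound {c : ℝ} {u u' : State} (h : p.stress u.2 = c ^ 2 * u.2)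
    (h' : p.stress u'.2 = c ^ 2 * u'.2) :
    p.RankineHugoniot (-c) u u' ↔ u'.1 - c * u'.2 = u.1 - c * u.2 := by
  unfold RankineHugoniot
  rw [h, h']
  constructor
  · rintro ⟨h1, -⟩
    linarith
  · intro h1
    exact ⟨by linarith, by linear_combination (-c) * h1⟩

lemma rankineHugoniot_sound {c : ℝ} {u u' : State} (h : p.stress u.2 = c ^ 2 * u.2)
    (h' : p.stress u'.2 = c ^ 2 * u'.2) :
    p.RankineHugoniot c u u' ↔ u.1 + c * u.2 = u'.1 + c * u'.2 := by
  unfold RankineHugoniot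
  rw [h, h']
  constructor
  · rintro ⟨h1, -⟩
    linarith
  · intro h1
    exact ⟨by linarith, by linear_combination (-c) * h1⟩

/-- The Rankine-Hugoniot relations for a phase boundary in terms of the incoming data. -/
lemma rankineHugoniot_iff {V h : ℝ} {u u' : State} (hu : u.2 ≤ p.wM) (hu' : p.wm ≤ u'.2)
    (hh : (p.c₁ + p.c₃) * h = (u'.1 + p.c₃ * u'.2) - (u.1 - p.c₁ * u.2)) :
    p.RankineHugoniot V u u' ↔
      (p.c₁ - V) * h = (p.c₃ - V) * u'.2 ∧ (p.c₃ + V) * h = (p.c₁ + V) * u.2 := by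
  have hc : p.c₁ + p.c₃ ≠ 0 := (add_pos p.c₁_pos p.c₃_pos).ne'
  unfold RankineHugoniot
  rw [p.stress_of_le hu, p.stress_of_ge hu']
  constructor
  · rintro ⟨h1, h2⟩
    constructor
    · apply mul_left_cancel₀ hc
      linear_combination (p.c₁ - V) * hh + (p.c₁ - V) * h1 - h2 + V * h1
    · apply mul_left_cancel₀ hc
      linear_combination (p.c₃ + V) * hh + (p.c₃ + V) * h1 + h2 - V * h1
  · rintro ⟨h1, h2⟩
    have h3 : V * (u'.2 - u.2) + (u'.1 - u.1) = 0 := by linear_combination hh.symm + h1 + h2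
    refine ⟨h3, ?_⟩
    linear_combination V * h3 - (p.c₃ + V) * h1 + (p.c₁ - V) * h2

lemma c_of_mem_H₁ {u : State} (h : u ∈ p.H₁) : p.c u.2 = p.c₁ := by simp [c, h.2]

lemma c_of_mem_H₃ {u : State} (h : u ∈ p.H₃) : p.c u.2 = p.c₃ := by
  have : p.wm ≤ u.2 := h
  simp [c, (p.wM_lt.trans_le this).not_ge]

lemma disjoint_phases {u : State} (h : u ∈ p.H₁) (h' : u ∈ p.H₃) : False := by
  have : p.wm ≤ u.2 := h'
  linarith [h.2, p.wM_lt]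

lemma avgStrain_left {u u' : State} (h : u ∈ p.H₁) (h' : u' ∈ p.H₁) :
    p.avgStrain u u' = ((u'.1 + p.c₁ * u'.2) - (u.1 - p.c₁ * u.2)) / (2 * p.c₁) := by
  rw [avgStrain, p.c_of_mem_H₁ h, p.c_of_mem_H₁ h']
  congr 1 <;> ring

lemma avgStrain_right {u u' : State} (h : u ∈ p.H₃) (h' : u' ∈ p.H₃) :
    p.avgStrain u u' = ((u'.1 + p.c₃ * u'.2) - (u.1 - p.c₃ * u.2)) / (2 * p.c₃) := by
  rw [avgStrain, p.c_of_mem_H₃ h, p.c_of_mem_H₃ h']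
  congr 1 <;> ring

lemma avgStrain_front {u u' : State} (h : u ∈ p.H₁) (h' : u' ∈ p.H₃) :
    p.avgStrain u u' = ((u'.1 + p.c₃ * u'.2) - (u.1 - p.c₁ * u.2)) / (p.c₁ + p.c₃) := by
  rw [avgStrain, p.c_of_mem_H₁ h, p.c_of_mem_H₃ h']
  congr 1; ring

end Material

/-! ### Fans -/

/-- The left-continuous version of `fan`. -/
noncomputable def leftFan : State → List (ℝ × State) → ℝ → State
  | u₀, [], _ => u₀
  | u₀, (s, u) :: l, ξ => if ξ ≤ s then u₀ else leftFan u l ξ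

/-- The scheme samples left limits, so a sample exactly on a wave takes the state to its left; hence
`≤` in `leftFan` against `<` in `fan`. -/
lemma tendsto_fan_left (u₀ : State) (l : List (ℝ × State)) (ξ : ℝ) :
    Tendsto (fan u₀ l) (𝓝[<] ξ) (𝓝 (leftFan u₀ l ξ)) := by
  induction l generalizing u₀ with
  | nil => exact tendsto_const_nhds
  | cons a l ih =>
    obtain ⟨s, u⟩ := a
    by_cases h : ξ ≤ s
    · simp only [leftFan, h, if_true]
      refine tendsto_const_nhds.congr' ?_
      filter_upwards [self_mem_nhdsWithin] with y hy
      simp [fan, lt_of_lt_of_le hy h]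
    · simp only [leftFan, h, if_false]
      refine (ih u).congr' ?_
      filter_upwards [mem_nhdsWithin_of_mem_nhds (Ioi_mem_nhds (not_le.1 h))] with y hy
      simp [fan, (le_of_lt (mem_Ioi.1 hy)).not_gt]

/-- A single discontinuity between the phases is a Riemann solution only as a phase boundary. -/
lemma IsRiemannSolution.single {p : Material} {φ : ℝ → ℝ} {uL uR : State} {Vs : ℝ}
    (hL : uL ∈ p.H₁) (hR : uR ∈ p.H₃) (h : IsRiemannSolution p φ uL uR (fan uL [(Vs, uR)])) :
    (Vs ∈ Ioo (-p.c₃) p.c₃ ∧ 0 < p.avgStrain uL uR ∧ p.RankineHugoniot Vs uL uR ∧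
      p.Kinetic φ Vs uL uR) ∨
    (Vs ∈ Ico p.c₃ p.c₁ ∧ p.avgStrain uL uR ≤ 0 ∧ p.RankineHugoniot Vs uL uR) := by
  have hc3 := p.c₃_pos
  have hc := p.c₃_lt_c₁
  -- The equality is one of functions of `ξ`. Speeds and states are recovered from it by evaluation,
  -- using that the two phases are disjoint.
  generalize hF : fan uL [(Vs, uR)] = F at h
  have hval : ∀ ξ, F ξ = if ξ < Vs then uL else uR := by
    intro ξ; rw [← hF]; simp [fan]
  have h1 : ∀ ξ, F ξ ∈ p.H₁ → ξ < Vs ∧ F ξ = uL := by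
    intro ξ hξ
    rw [hval] at hξ ⊢
    by_cases h' : ξ < Vs
    · simp [h']
    · rw [if_neg h'] at hξ; exact (p.disjoint_phases hξ hR).elim
  have h3 : ∀ ξ, F ξ ∈ p.H₃ → Vs ≤ ξ ∧ F ξ = uR := by
    intro ξ hξ
    rw [hval] at hξ ⊢
    by_cases h' : ξ < Vs
    · rw [if_pos h'] at hξ; exact (p.disjoint_phases hL hξ).elim
    · simp [h', not_lt.1 h']
  cases h with
  | stay₁ us hL hR' => exact (p.disjoint_phases hR' hR).elim
  | stay₃ us hL' hR' => exact (p.disjoint_phases hL hL').elim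
  | nucleate₁ u1 u2 u3 V' V hL hR' => exact (p.disjoint_phases hR' hR).elim
  | nucleate₃ u1 u2 u3 V' V hL' hR' => exact (p.disjoint_phases hL hL').elim
  | sub₃₁ um up V hL' hR' => exact (p.disjoint_phases hL hL').elim
  | super₃₁ up V hL' hR' => exact (p.disjoint_phases hL hL').elim
  | sub₁₃ um up V hL hR hh hm hp hV ha hb hd hk =>
    have hm' : ∀ ξ, -p.c₁ ≤ ξ → ξ < V →
        fan uL [(-p.c₁, um), (V, up), (p.c₃, uR)] ξ = um := by
      intro ξ h1 h2
      simp [fan, h1.not_gt, h2]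
    have hp' : fan uL [(-p.c₁, um), (V, up), (p.c₃, uR)] V = up := by
      simp [fan, hV.2, (show ¬ V < -p.c₁ by linarith [hV.1])]
    -- At `-c₁` the fan shows `um`, in phase 1, hence `um = uL`; at `V` it shows `up`, in phase 3,
    -- hence `up = uR` and `Vs ≤ V`.
    obtain ⟨-, e1⟩ := h1 (-p.c₁) (by rw [hm' _ le_rfl (by linarith [hV.1])]; exact hm)
    rw [hm' _ le_rfl (by linarith [hV.1])] at e1
    obtain ⟨g1, e2⟩ := h3 V (by rw [hp']; exact hp)
    rw [hp'] at e2
    subst e1 e2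
    -- Every point of `[-c₁, V)` shows phase 1 and so lies below `Vs`; the maximum with `-c₁` keeps
    -- the test point to the right of the contact.
    have : V = Vs := by
      refine le_antisymm (le_of_forall_lt fun x hx => ?_) g1
      have := (h1 (max (-p.c₁) x) (by
        rw [hm' _ (le_max_left _ _) (max_lt (by linarith [hV.1]) hx)]; exact hm)).1
      exact (le_max_right _ _).trans_lt this
    subst this
    exact Or.inl ⟨hV, hh, hb, hk⟩
  | super₁₃ um V hL hR hh hm hV ha hb =>
    have hm' : ∀ ξ, -p.c₁ ≤ ξ → ξ < V → fan uL [(-p.c₁, um), (V, uR)] ξ = um := by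
      intro ξ h1 h2
      simp [fan, h1.not_gt, h2]
    have hp' : fan uL [(-p.c₁, um), (V, uR)] V = uR := by
      simp [fan, (show ¬ V < -p.c₁ by linarith [hV.1])]
    obtain ⟨-, e1⟩ := h1 (-p.c₁) (by rw [hm' _ le_rfl (by linarith [hV.1])]; exact hm)
    rw [hm' _ le_rfl (by linarith [hV.1])] at e1
    obtain ⟨g1, -⟩ := h3 V (by rw [hp']; exact hR)
    subst e1
    have : V = Vs := by
      refine le_antisymm (le_of_forall_lt fun x hx => ?_) g1
      have := (h1 (max (-p.c₁) x) (by
        rw [hm' _ (le_max_left _ _) (max_lt (by linarith [hV.1]) hx)]; exact hm)).1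
      exact (le_max_right _ _).trans_lt this
    subst this
    exact Or.inr ⟨hV, hh, hb⟩


/-! ### Subsonic phase boundaries: existence, uniqueness, monotonicity of the speed. -/

namespace Material

variable {p : Material} {φ : ℝ → ℝ}

/-- The strains `wl`, `wr` on the sides of an admissible subsonic phase boundary of speed `V`, in
terms of the averaged strain `h` of the incoming data. -/
structure IsSubsonic (p : Material) (φ : ℝ → ℝ) (h V wl wr : ℝ) : Prop where
  speed : V ∈ Ioo (-p.c₃) p.c₃
  right_eq : (p.c₁ - V) * h = (p.c₃ - V) * wr
  left_eq : (p.c₃ + V) * h = (p.c₁ + V) * wl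
  left_le : wl ≤ p.wM
  le_right : p.wm ≤ wr
  kinetic : (p.k₁ - p.k₃) / 2 * (p.wM * p.wm - wl * wr) ∈ kineticGraph φ V

lemma IsDissipationFunction.le_leftLim (hφ : p.IsDissipationFunction φ) {V : ℝ}
    (hV : V ∈ Ioo (-p.c₃) 0) : φ V ≤ Function.leftLim φ 0 := by
  obtain ⟨l, hl⟩ := hφ.left_zero
  rw [leftLim_eq_of_tendsto hl]
  refine ge_of_tendsto hl ?_
  filter_upwards [Ioo_mem_nhdsLT hV.2] with x hx
  exact (hφ.strictMonoOn ⟨hV.1, hV.2.le.trans p.c₃_pos.le⟩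
    ⟨hV.1.trans hx.1, hx.2.le.trans p.c₃_pos.le⟩ hx.1).le

lemma IsDissipationFunction.rightLim_le (hφ : p.IsDissipationFunction φ) {V : ℝ}
    (hV : V ∈ Ioc 0 p.c₃) : Function.rightLim φ 0 ≤ φ V := by
  obtain ⟨l, hl⟩ := hφ.right_zero
  rw [rightLim_eq_of_tendsto hl]
  refine le_of_tendsto hl ?_
  have := p.c₃_pos
  filter_upwards [Ioo_mem_nhdsGT hV.1] with x hx
  exact (hφ.strictMonoOn ⟨by linarith [hx.1], hx.2.le.trans hV.2⟩
    ⟨by linarith [hV.1], hV.2⟩ hx.2).le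

lemma kineticGraph_of_ne {V : ℝ} (hV : V ≠ 0) : kineticGraph φ V = {φ V} := by
  simp [kineticGraph, hV]

lemma kineticGraph_zero :
    kineticGraph φ 0 = Icc (Function.leftLim φ 0) (Function.rightLim φ 0) := by
  simp [kineticGraph]

/-- The segment that fills the jump at `0` separates the values of `φ` at negative speeds from those
at positive speeds, so the completed graph stays monotone. -/
lemma IsDissipationFunction.kineticGraph_mono (hφ : p.IsDissipationFunction φ) {V V' x y : ℝ}
    (hV : V ∈ Ioo (-p.c₃) p.c₃) (hV' : V' ∈ Ioo (-p.c₃) p.c₃) (hlt : V < V')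
    (hx : x ∈ kineticGraph φ V) (hy : y ∈ kineticGraph φ V') : x ≤ y := by
  rcases eq_or_ne V 0 with rfl | h0
  · rw [kineticGraph_zero] at hx
    rw [kineticGraph_of_ne hlt.ne'] at hy
    rw [mem_singleton_iff.1 hy]
    exact hx.2.trans (hφ.rightLim_le ⟨hlt, hV'.2.le⟩)
  · rw [kineticGraph_of_ne h0] at hx
    rw [mem_singleton_iff.1 hx]
    rcases eq_or_ne V' 0 with rfl | h0'
    · rw [kineticGraph_zero] at hy
      exact (hφ.le_leftLim ⟨hV.1, hlt⟩).trans hy.1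
    · rw [kineticGraph_of_ne h0'] at hy
      rw [mem_singleton_iff.1 hy]
      exact (hφ.strictMonoOn ⟨hV.1, hV.2.le⟩ ⟨hV'.1, hV'.2.le⟩ hlt).le

/-- At `V = 0` the bounds pass to the one-sided limits of `φ`, because `psiMin` and `psiMax` are
continuous there. -/
lemma IsDissipationFunction.kineticGraph_bounds (hφ : p.IsDissipationFunction φ) {V x : ℝ}
    (hV : V ∈ Ioo (-p.c₃) p.c₃) (hx : x ∈ kineticGraph φ V) :
    (V ≤ 0 → p.psiMin V ≤ x) ∧ (0 ≤ V → x ≤ p.psiMax V) ∧ (V < 0 → x ≤ 0) ∧ (0 < V → 0 ≤ x) := by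
  have h3 := p.c₃_pos
  have h31 := p.c₃_lt_c₁
  rcases eq_or_ne V 0 with rfl | h0
  · rw [kineticGraph_zero] at hx
    refine ⟨fun _ => ?_, fun _ => ?_, fun h => (lt_irrefl _ h).elim,
      fun h => (lt_irrefl _ h).elim⟩
    · refine le_trans ?_ hx.1
      obtain ⟨l, hl⟩ := hφ.left_zero
      rw [leftLim_eq_of_tendsto hl]
      have hc : ContinuousAt p.psiMin 0 := by
        unfold psiMin
        have : p.k₃ - (0 : ℝ) ^ 2 ≠ 0 := by simpa using p.k₃_pos.ne'
        fun_prop (disch := assumption)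
      refine le_of_tendsto_of_tendsto (hc.tendsto.mono_left nhdsWithin_le_nhds) hl ?_
      filter_upwards [Ioo_mem_nhdsLT (neg_lt_zero.2 h3)] with x hx
      exact (hφ.bounds_neg x ⟨hx.1, hx.2.le⟩).1
    · refine hx.2.trans ?_
      obtain ⟨l, hl⟩ := hφ.right_zero
      rw [rightLim_eq_of_tendsto hl]
      have hc : ContinuousAt p.psiMax 0 := by
        unfold psiMax
        have : p.k₁ - (0 : ℝ) ^ 2 ≠ 0 := by simpa using p.k₁_pos.ne'
        fun_prop (disch := assumption)
      refine le_of_tendsto_of_tendsto hl (hc.tendsto.mono_left nhdsWithin_le_nhds) ?_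
      filter_upwards [Ioo_mem_nhdsGT h3] with x hx
      exact (hφ.bounds_nonneg x ⟨hx.1.le, hx.2.le⟩).2
  · rw [kineticGraph_of_ne h0, mem_singleton_iff] at hx
    rw [hx]
    exact ⟨fun h => (hφ.bounds_neg V ⟨hV.1, h⟩).1, fun h => (hφ.bounds_nonneg V ⟨h, hV.2.le⟩).2,
      fun h => (hφ.bounds_neg V ⟨hV.1, h.le⟩).2, fun h => (hφ.bounds_nonneg V ⟨h.le, hV.2.le⟩).1⟩

lemma sq_lt_of_speed {V : ℝ} (hV : V ∈ Ioo (-p.c₃) p.c₃) : 0 < p.k₃ - V ^ 2 ∧ 0 < p.k₁ - V ^ 2 := by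
  have h1 : 0 < p.k₃ - V ^ 2 := by
    rw [← p.c₃_sq]
    nlinarith [hV.1, hV.2]
  exact ⟨h1, by linarith [p.k₃_lt]⟩

/-- The strains of a subsonic phase boundary lie in the respective phases. -/
lemma IsDissipationFunction.strain_bounds (hφ : p.IsDissipationFunction φ) {V wl wr : ℝ}
    (hV : V ∈ Ioo (-p.c₃) p.c₃) (hl : 0 < wl) (hr : 0 < wr)
    (hRH : (p.k₁ - V ^ 2) * wl = (p.k₃ - V ^ 2) * wr)
    (hk : (p.k₁ - p.k₃) / 2 * (p.wM * p.wm - wl * wr) ∈ kineticGraph φ V) :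
    wl ≤ p.wM ∧ p.wm ≤ wr := by
  obtain ⟨b1, b2, b3, b4⟩ := hφ.kineticGraph_bounds hV hk
  obtain ⟨hp3, hp1⟩ := p.sq_lt_of_speed hV
  have hd : 0 < (p.k₁ - p.k₃) / 2 := by linarith [p.k₃_lt]
  have hM := p.wM_pos
  have hm := p.wm_pos
  -- By `hRH` the product `wl wr` is a positive multiple of `wl²`, and `psiMin V` is the kinetic
  -- value at `wl = wM`. The lower bound on `φ` is thus exactly `wl ≤ wM`; `key2` is the same
  -- argument with `psiMax` and `wr = wm`.
  have key1 : V ≤ 0 → wl ≤ p.wM := by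
    intro h
    have := b1 h
    rw [psiMin, mul_assoc] at this
    have h2 := le_of_mul_le_mul_left this hd
    have e : wl * wr = (p.k₁ - V ^ 2) / (p.k₃ - V ^ 2) * (wl * wl) := by
      field_simp
      linear_combination -hRH
    have h3 : (p.k₁ - V ^ 2) / (p.k₃ - V ^ 2) * (wl * wl) ≤
        (p.k₁ - V ^ 2) / (p.k₃ - V ^ 2) * (p.wM * p.wM) := by
      rw [← e]; linarith
    have h4 := le_of_mul_le_mul_left h3 (div_pos hp1 hp3)
    nlinarith
  have key2 : 0 ≤ V → p.wm ≤ wr := by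
    intro h
    have := b2 h
    rw [psiMax, mul_assoc] at this
    have h2 := le_of_mul_le_mul_left this hd
    have e : wl * wr = (p.k₃ - V ^ 2) / (p.k₁ - V ^ 2) * (wr * wr) := by
      field_simp
      linear_combination hRH
    have h3 : (p.k₃ - V ^ 2) / (p.k₁ - V ^ 2) * (p.wm * p.wm) ≤
        (p.k₃ - V ^ 2) / (p.k₁ - V ^ 2) * (wr * wr) := by
      rw [← e]; linarith
    have h4 := le_of_mul_le_mul_left h3 (div_pos hp3 hp1)
    nlinarith
  -- The remaining bound comes from the sign of `φ`: for `V < 0` one has `wl wr ≥ wM wm`, for `V >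
  -- 0` the reverse. At `V = 0` both keys apply.
  rcases lt_trichotomy V 0 with h | h | h
  · have h1 := key1 h.le
    have h2 := nonpos_of_mul_nonpos_right (b3 h) hd
    exact ⟨h1, by nlinarith⟩
  · exact ⟨key1 h.le, key2 h.ge⟩
  · have h1 := key2 h.le
    have h2 := nonneg_of_mul_nonneg_right (b4 h) hd
    exact ⟨by nlinarith, h1⟩

/-- The subsonic phase boundary exists for every positive averaged strain. -/
theorem IsDissipationFunction.exists_isSubsonic (hφ : p.IsDissipationFunction φ) {h : ℝ}
    (hh : 0 < h) : ∃ V wl wr, IsSubsonic p φ h V wl wr := by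
  have h3 := p.c₃_pos
  have h31 := p.c₃_lt_c₁
  have hk : p.k₁ - p.k₃ ≠ 0 := (sub_pos.2 p.k₃_lt).ne'
  -- it suffices to find the speed
  suffices H : ∃ V ∈ Ioo (-p.c₃) p.c₃, ∃ g, (p.k₁ - p.k₃) / 2 * (p.wM * p.wm - g) ∈
      kineticGraph φ V ∧ g * ((p.c₃ - V) * (p.c₁ + V) / ((p.c₁ - V) * (p.c₃ + V))) = h ^ 2 by
    obtain ⟨V, hV, g, hg, e⟩ := H
    have a1 : 0 < p.c₃ - V := by linarith [hV.2]
    have a2 : 0 < p.c₃ + V := by linarith [hV.1]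
    have a3 : 0 < p.c₁ - V := by linarith
    have a4 : 0 < p.c₁ + V := by linarith
    have eg : (p.c₃ + V) * h / (p.c₁ + V) * ((p.c₁ - V) * h / (p.c₃ - V)) = g := by
      field_simp at e ⊢
      linear_combination -e
    have hb := hφ.strain_bounds hV (wl := (p.c₃ + V) * h / (p.c₁ + V))
      (wr := (p.c₁ - V) * h / (p.c₃ - V)) (by positivity) (by positivity)
      (by rw [← p.c₁_sq, ← p.c₃_sq]; field_simp; ring) (by rw [eg]; exact hg)
    exact ⟨V, _, _, hV, by field_simp, by field_simp, hb.1, hb.2, by rw [eg]; exact hg⟩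
  -- Here `g x` is the product `wl wr` belonging to the kinetic value `x`, and the product of the
  -- two Rankine-Hugoniot relations reads `g x * Q V = h²`.
  set Q : ℝ → ℝ := fun V => (p.c₃ - V) * (p.c₁ + V) / ((p.c₁ - V) * (p.c₃ + V)) with hQ
  set g : ℝ → ℝ := fun x => p.wM * p.wm - 2 / (p.k₁ - p.k₃) * x with hg
  have hgφ : ∀ x, (p.k₁ - p.k₃) / 2 * (p.wM * p.wm - g x) = x := by
    intro x; simp only [hg]; field_simp; ring
  have hgc : Continuous g := by fun_prop
  have hQc : ∀ V ∈ Ioc (-p.c₃) p.c₃, ContinuousAt Q V := by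
    intro V hV
    have : (p.c₁ - V) * (p.c₃ + V) ≠ 0 :=
      (mul_pos (by linarith [hV.2]) (by linarith [hV.1])).ne'
    fun_prop (disch := assumption)
  have hQ0 : Q 0 = 1 := by
    simp only [hQ]
    have : p.c₁ ≠ 0 := p.c₁_pos.ne'
    field_simp
    ring
  have hφc : ContinuousOn φ (Ioo (-p.c₃) 0 ∪ Ioc 0 p.c₃) := hφ.contDiffOn.continuousOn
  have hF : ∀ s, s ⊆ Ioo (-p.c₃) 0 ∪ Ioo 0 p.c₃ → ContinuousOn (fun V => g (φ V) * Q V) s := by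
    intro s hs V hV
    refine ((hgc.continuousAt.comp_continuousWithinAt ((hφc V ?_).mono ?_)).mul
      (hQc V ?_).continuousWithinAt)
    · exact (hs hV).imp id fun h => ⟨h.1, h.2.le⟩
    · exact hs.trans (union_subset_union_right _ Ioo_subset_Ioc_self)
    · rcases hs hV with h | h
      · exact ⟨h.1, h.2.le.trans h3.le⟩
      · exact ⟨by linarith [h.1], h.2.le⟩
  have hQt : ∀ V ∈ Ioc (-p.c₃) p.c₃, ∀ s, Tendsto Q (𝓝[s] V) (𝓝 (Q V)) :=
    fun V hV s => (hQc V hV).tendsto.mono_left nhdsWithin_le_nhds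
  obtain ⟨l, hl⟩ := hφ.left_zero
  obtain ⟨r, hr⟩ := hφ.right_zero
  have hlL := leftLim_eq_of_tendsto hl
  have hrR := rightLim_eq_of_tendsto hr
  have hl' : Tendsto (fun V => g (φ V) * Q V) (𝓝[<] 0) (𝓝 (g l)) := by
    have := ((hgc.tendsto l).comp hl).mul (hQt 0 ⟨by linarith, h3.le⟩ (Iio 0))
    rwa [hQ0, mul_one] at this
  have hr' : Tendsto (fun V => g (φ V) * Q V) (𝓝[>] 0) (𝓝 (g r)) := by
    have := ((hgc.tendsto r).comp hr).mul (hQt 0 ⟨by linarith, h3.le⟩ (Ioi 0))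
    rwa [hQ0, mul_one] at this
  -- The three cases compare `h²` with the interval `[g r, g l]` due to the jump of `φ` at `0`.
  -- Below it, the intermediate value theorem applies on `(0, c₃)`, where the left side runs from `g
  -- r` to `0` since `Q c₃ = 0`.
  by_cases c1 : h ^ 2 < g r
  · have hs' : Tendsto (fun V => g (φ V) * Q V) (𝓝[<] p.c₃) (𝓝 0) := by
      have := ((hgc.tendsto _).comp hφ.tendsto_sound).mul
        (hQt p.c₃ ⟨by linarith, le_rfl⟩ (Iio _))
      have e : Q p.c₃ = 0 := by simp [hQ]
      rwa [e, mul_zero] at this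
    have : NeBot (𝓝[>] (0 : ℝ)) := inferInstance
    obtain ⟨V, hV, e⟩ := (isPreconnected_Ioo (a := (0 : ℝ)) (b := p.c₃)).intermediate_value_Ioo
      (l₁ := 𝓝[<] p.c₃) (l₂ := 𝓝[>] 0) (le_principal_iff.2 (Ioo_mem_nhdsLT h3))
      (le_principal_iff.2 (Ioo_mem_nhdsGT h3)) (hF _ subset_union_right) hs' hr'
      (show h ^ 2 ∈ Ioo 0 (g r) from ⟨by positivity, c1⟩)
    refine ⟨V, ⟨by linarith [hV.1], hV.2⟩, g (φ V), ?_, e⟩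
    rw [hgφ, kineticGraph_of_ne hV.1.ne']
    rfl
  by_cases c2 : g l < h ^ 2
  -- Above the interval the speed is negative: `φ → -∞` at `-c₃` drives `g ∘ φ` to `+∞`, and `Q ≥ 1`
  -- for negative speeds.
  · have hs' : Tendsto (fun V => g (φ V) * Q V) (𝓝[>] (-p.c₃)) atTop := by
      have t1 : Tendsto (fun V => g (φ V)) (𝓝[>] (-p.c₃)) atTop := by
        have hk' : 0 < 2 / (p.k₁ - p.k₃) := div_pos two_pos (sub_pos.2 p.k₃_lt)
        refine (tendsto_atTop_add_const_left _ (p.wM * p.wm)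
          (tendsto_neg_atBot_atTop.comp
            (hφ.tendsto_neg_sound.const_mul_atBot hk'))).congr fun V => ?_
        simp [hg, sub_eq_add_neg]
      refine tendsto_atTop_mono' _ ?_ t1
      filter_upwards [t1.eventually_ge_atTop 0, Ioo_mem_nhdsGT (neg_lt_zero.2 h3)] with V h1 h2
      refine le_mul_of_one_le_right h1 ?_
      simp only [hQ]
      rw [one_le_div (mul_pos (by linarith [h2.2]) (by linarith [h2.1]))]
      nlinarith [h2.2]
    obtain ⟨V, hV, e⟩ := (isPreconnected_Ioo (a := -p.c₃) (b := (0 : ℝ))).intermediate_value_Ioi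
      (l₁ := 𝓝[<] 0) (l₂ := 𝓝[>] (-p.c₃)) (le_principal_iff.2 (Ioo_mem_nhdsLT (neg_lt_zero.2 h3)))
      (le_principal_iff.2 (Ioo_mem_nhdsGT (neg_lt_zero.2 h3))) (hF _ subset_union_left) hl' hs'
      (show h ^ 2 ∈ Ioi (g l) from c2)
    refine ⟨V, ⟨hV.1, hV.2.trans h3⟩, g (φ V), ?_, e⟩
    rw [hgφ, kineticGraph_of_ne hV.2.ne]
    rfl
  -- Inside the interval the speed is `0`: `Q 0 = 1` and the value lies on the completed segment.
  · refine ⟨0, ⟨by linarith, h3⟩, h ^ 2, ?_, ?_⟩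
    · rw [kineticGraph_zero, hlL, hrR]
      have hd : 0 < (p.k₁ - p.k₃) / 2 := by linarith [p.k₃_lt]
      constructor
      · rw [← hgφ l]
        exact mul_le_mul_of_nonneg_left (by linarith) hd.le
      · rw [← hgφ r]
        exact mul_le_mul_of_nonneg_left (by linarith) hd.le
    · change h ^ 2 * Q 0 = h ^ 2
      rw [hQ0, mul_one]

namespace IsSubsonic

variable {h h' V V' wl wl' wr wr' : ℝ}

lemma right_pos (S : IsSubsonic p φ h V wl wr) : 0 < wr := p.wm_pos.trans_le S.le_right

lemma strain_pos (S : IsSubsonic p φ h V wl wr) : 0 < h := by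
  have h31 := p.c₃_lt_c₁
  have : 0 < (p.c₁ - V) * h := by
    rw [S.right_eq]; exact mul_pos (by linarith [S.speed.2]) S.right_pos
  exact pos_of_mul_pos_right this (by linarith [S.speed.2])

lemma left_pos (S : IsSubsonic p φ h V wl wr) : 0 < wl := by
  have h31 := p.c₃_lt_c₁
  have : 0 < (p.c₁ + V) * wl := by
    rw [← S.left_eq]; exact mul_pos (by linarith [S.speed.1]) S.strain_pos
  exact pos_of_mul_pos_right this (by linarith [S.speed.1])

/-- Both factors of `h² = (wl wr) Q(V)` decrease in `V`: the first by monotonicity of the kinetic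
graph, the second with an explicit rate. Clearing denominators keeps the inequality meaningful up to
`±c₃`. -/
lemma speed_gap (hφ : p.IsDissipationFunction φ) (S : IsSubsonic p φ h V wl wr)
    (S' : IsSubsonic p φ h' V' wl' wr') (hlt : V < V') :
    wl * wr * (2 * (p.c₁ - p.c₃) ^ 2 * p.c₃ * (V' - V)) ≤
      ((p.c₁ - V) * (p.c₃ + V)) * ((p.c₁ - V') * (p.c₃ + V')) * (h ^ 2 - h' ^ 2) := by
  have h3 := p.c₃_pos
  have h31 := p.c₃_lt_c₁
  obtain ⟨a1, a2⟩ := S.speed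
  obtain ⟨b1, b2⟩ := S'.speed
  have hg : wl' * wr' ≤ wl * wr := by
    have := hφ.kineticGraph_mono S.speed S'.speed hlt S.kinetic S'.kinetic
    have := le_of_mul_le_mul_left this (by linarith [p.k₃_lt])
    linarith
  have e1 : (p.c₁ - V) * (p.c₃ + V) * h ^ 2 = (p.c₃ - V) * (p.c₁ + V) * (wl * wr) := by
    linear_combination (p.c₃ + V) * h * S.right_eq + (p.c₃ - V) * wr * S.left_eq
  have e2 : (p.c₁ - V') * (p.c₃ + V') * h' ^ 2 = (p.c₃ - V') * (p.c₁ + V') * (wl' * wr') := by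
    linear_combination (p.c₃ + V') * h' * S'.right_eq + (p.c₃ - V') * wr' * S'.left_eq
  -- The cross-multiplied difference of `Q V` and `Q V'` equals `2 (c₁ - c₃)(V' - V)(c₁ c₃ + V V')`,
  -- and `V V' ≥ -c₃²`.
  have hVV : p.c₃ * (p.c₁ - p.c₃) ≤ p.c₁ * p.c₃ + V * V' := by nlinarith
  have d : 0 ≤ (p.c₁ - V) * (p.c₃ + V) := mul_nonneg (by linarith) (by linarith)
  have f' : 0 ≤ (p.c₃ - V') * (p.c₁ + V') := mul_nonneg (by linarith) (by linarith)
  have i1 : (p.c₁ - V) * (p.c₃ + V) * ((p.c₃ - V') * (p.c₁ + V')) * (wl' * wr') ≤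
      (p.c₁ - V) * (p.c₃ + V) * ((p.c₃ - V') * (p.c₁ + V')) * (wl * wr) :=
    mul_le_mul_of_nonneg_left hg (mul_nonneg d f')
  have hgp : 0 < wl * wr := mul_pos S.left_pos S.right_pos
  have i2 : wl * wr * (2 * (p.c₁ - p.c₃) * (V' - V) * (p.c₃ * (p.c₁ - p.c₃))) ≤
      wl * wr * (2 * (p.c₁ - p.c₃) * (V' - V) * (p.c₁ * p.c₃ + V * V')) := by
    refine mul_le_mul_of_nonneg_left (mul_le_mul_of_nonneg_left hVV ?_) hgp.le
    have : 0 < p.c₁ - p.c₃ := by linarith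
    have : 0 < V' - V := by linarith
    positivity
  calc _ = wl * wr * (2 * (p.c₁ - p.c₃) * (V' - V) * (p.c₃ * (p.c₁ - p.c₃))) := by ring
    _ ≤ _ := i2
    _ = ((p.c₁ - V') * (p.c₃ + V')) * ((p.c₁ - V) * (p.c₃ + V) * h ^ 2) -
        (p.c₁ - V) * (p.c₃ + V) * ((p.c₃ - V') * (p.c₁ + V')) * (wl * wr) := by
      rw [e1]; ring
    _ ≤ ((p.c₁ - V') * (p.c₃ + V')) * ((p.c₁ - V) * (p.c₃ + V) * h ^ 2) -
        (p.c₁ - V) * (p.c₃ + V) * ((p.c₃ - V') * (p.c₁ + V')) * (wl' * wr') := by linarith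
    _ = _ := by linear_combination (p.c₁ - V) * (p.c₃ + V) * e2

lemma lt_of_speed_lt (hφ : p.IsDissipationFunction φ) (S : IsSubsonic p φ h V wl wr)
    (S' : IsSubsonic p φ h' V' wl' wr') (hlt : V < V') : h' < h := by
  have h3 := p.c₃_pos
  have h31 := p.c₃_lt_c₁
  obtain ⟨a1, a2⟩ := S.speed
  obtain ⟨b1, b2⟩ := S'.speed
  have := S.speed_gap hφ S' hlt
  have h1 : 0 < wl * wr * (2 * (p.c₁ - p.c₃) ^ 2 * p.c₃ * (V' - V)) := by
    have : 0 < V' - V := by linarith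
    have : 0 < p.c₁ - p.c₃ := by linarith
    have := S.left_pos
    have := S.right_pos
    positivity
  have h2 : 0 < h ^ 2 - h' ^ 2 := by
    refine pos_of_mul_pos_right (h1.trans_le this) ?_
    exact mul_nonneg (mul_nonneg (by linarith) (by linarith))
      (mul_nonneg (by linarith) (by linarith))
  nlinarith [S.strain_pos, S'.strain_pos]

lemma unique (hφ : p.IsDissipationFunction φ) (S : IsSubsonic p φ h V wl wr)
    (S' : IsSubsonic p φ h V' wl' wr') : V = V' ∧ wl = wl' ∧ wr = wr' := by
  have h31 := p.c₃_lt_c₁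
  have hV : V = V' := by
    rcases lt_trichotomy V V' with hlt | heq | hlt
    · exact (lt_irrefl _ (S.lt_of_speed_lt hφ S' hlt)).elim
    · exact heq
    · exact (lt_irrefl _ (S'.lt_of_speed_lt hφ S hlt)).elim
  subst hV
  have a1 := S.speed.1
  have a2 := S.speed.2
  refine ⟨rfl, ?_, ?_⟩
  · apply mul_left_cancel₀ (show p.c₁ + V ≠ 0 by linarith)
    rw [← S.left_eq, ← S'.left_eq]
  · apply mul_left_cancel₀ (show p.c₃ - V ≠ 0 by linarith)
    rw [← S.right_eq, ← S'.right_eq]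

end IsSubsonic

end Material


/-! ### Lipschitz dependence of the strain ahead, away from and up to the sonic speed. -/

open Classical in
/-- The slope of the chord of `f` between `x` and `b`, extended by the derivative at `b`. -/
noncomputable def endSlope (f : ℝ → ℝ) (a b x : ℝ) : ℝ :=
  if x = b then derivWithin f (Icc a b) b else (f b - f x) / (b - x)

/-- For `x < y < b` the chord slope from `x` is a weighted mean of the slopes over `[x, y]` and `[y,
b]`, with weights proportional to the lengths. By the mean value theorem both are values of `f'`,
which is Lipschitz since `f` is `C²`. -/
lemma exists_lipschitz_endSlope {f : ℝ → ℝ} {a b : ℝ} (hab : a < b)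
    (hf : ContDiffOn ℝ 2 f (Icc a b)) :
    ∃ K, 0 ≤ K ∧ ∀ x ∈ Icc a b, ∀ y ∈ Icc a b,
      |endSlope f a b x - endSlope f a b y| ≤ K * |x - y| := by
  have hu := uniqueDiffOn_Icc hab
  have hf' : ContDiffOn ℝ 1 (derivWithin f (Icc a b)) (Icc a b) := hf.derivWithin hu (by norm_num)
  obtain ⟨K, hK⟩ := isCompact_Icc.exists_bound_of_continuousOn
    (hf'.continuousOn_derivWithin hu le_rfl)
  have hK0 : 0 ≤ K := (norm_nonneg _).trans (hK a (left_mem_Icc.2 hab.le))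
  have hlip : ∀ x ∈ Icc a b, ∀ y ∈ Icc a b,
      |derivWithin f (Icc a b) x - derivWithin f (Icc a b) y| ≤ K * |x - y| := by
    intro x hx y hy
    have := (convex_Icc a b).norm_image_sub_le_of_norm_derivWithin_le
      (hf'.differentiableOn (by norm_num)) hK hy hx
    simpa [Real.norm_eq_abs] using this
  have hmvt : ∀ x y, a ≤ x → x < y → y ≤ b →
      ∃ c ∈ Ioo x y, f y - f x = derivWithin f (Icc a b) c * (y - x) := by
    intro x y hx hxy hy
    have hsub : Icc x y ⊆ Icc a b := Icc_subset_Icc hx hy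
    have hmem : ∀ z ∈ Ioo x y, Icc a b ∈ 𝓝 z := fun z hz =>
      Icc_mem_nhds (hx.trans_lt hz.1) (hz.2.trans_le hy)
    have hd : DifferentiableOn ℝ f (Icc a b) := hf.differentiableOn (by norm_num)
    obtain ⟨c, hc, e⟩ := exists_deriv_eq_slope f hxy (hf.continuousOn.mono hsub)
      (hd.mono (Ioo_subset_Icc_self.trans hsub))
    refine ⟨c, hc, ?_⟩
    rw [derivWithin_of_mem_nhds (hmem c hc), e]
    field_simp [(sub_pos.2 hxy).ne']
  -- the estimate for ordered points
  have key : ∀ x ∈ Icc a b, ∀ y ∈ Icc a b, x < y →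
      |endSlope f a b x - endSlope f a b y| ≤ K * |x - y| := by
    intro x hx y hy hxy
    have hxb : x < b := hxy.trans_le hy.2
    have hxb' : 0 < b - x := sub_pos.2 hxb
    rcases hy.2.eq_or_lt with rfl | hyb
    · obtain ⟨c, hc, e⟩ := hmvt x y hx.1 hxb le_rfl
      have e1 : endSlope f a y x = derivWithin f (Icc a y) c := by
        rw [endSlope, if_neg hxb.ne, e]
        field_simp
      rw [e1, endSlope, if_pos rfl]
      refine (hlip c ⟨hx.1.trans hc.1.le, hc.2.le⟩ y hy).trans ?_
      refine mul_le_mul_of_nonneg_left ?_ hK0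
      rw [abs_sub_comm, abs_sub_comm x, abs_of_pos (sub_pos.2 hc.2), abs_of_pos (sub_pos.2 hxy)]
      linarith [hc.1]
    · obtain ⟨c, hc, e⟩ := hmvt x y hx.1 hxy hy.2
      obtain ⟨d, hd, e'⟩ := hmvt y b hy.1 hyb le_rfl
      have hyb' : 0 < b - y := sub_pos.2 hyb
      have e1 : endSlope f a b y = derivWithin f (Icc a b) d := by
        rw [endSlope, if_neg hyb.ne, e']
        field_simp
      have e2 : endSlope f a b x * (b - x) = derivWithin f (Icc a b) c * (y - x) +
          derivWithin f (Icc a b) d * (b - y) := by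
        rw [endSlope, if_neg hxb.ne, ← e, ← e']
        field_simp
        ring
      -- The factor `b - x` is compensated by `|c - d| ≤ b - x`, so no power of the distance to `b`
      -- is lost.
      have e3 : (endSlope f a b x - endSlope f a b y) * (b - x) =
          (derivWithin f (Icc a b) c - derivWithin f (Icc a b) d) * (y - x) := by
        rw [sub_mul, e2, e1]; ring
      have e4 : |endSlope f a b x - endSlope f a b y| * (b - x) ≤ K * (b - x) * |x - y| := by
        rw [← abs_of_pos hxb', ← abs_mul, e3, abs_mul, abs_sub_comm x y, abs_of_pos hxb']
        refine mul_le_mul_of_nonneg_right ?_ (abs_nonneg _)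
        refine (hlip c ⟨hx.1.trans hc.1.le, hc.2.le.trans hy.2⟩ d
          ⟨hy.1.trans hd.1.le, hd.2.le⟩).trans ?_
        refine mul_le_mul_of_nonneg_left ?_ hK0
        rw [abs_le]
        constructor <;> linarith [hc.1, hc.2, hd.1, hd.2]
      refine le_of_mul_le_mul_right ?_ hxb'
      linarith
  refine ⟨K, hK0, fun x hx y hy => ?_⟩
  rcases lt_trichotomy x y with h | rfl | h
  · exact key x hx y hy h
  · simp
  · rw [abs_sub_comm, abs_sub_comm x]
    exact key y hy x hx h

namespace Material

variable {p : Material} {φ : ℝ → ℝ}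

namespace IsSubsonic

variable {h h' V V' wl wl' wr wr' : ℝ}

/-- For `h ≥ h₀ > 0` the quantities that could degenerate, `wl wr` and `c₃ - V`, stay bounded below.
Then `speed_gap` makes `V` Lipschitz in `h`, and `right_eq` transfers this to the strain. -/
lemma exists_lipschitz_of_pos (hφ : p.IsDissipationFunction φ) {h₀ h₁ : ℝ} (h₀_pos : 0 < h₀) :
    ∃ L, 0 ≤ L ∧ ∀ h V wl wr h' V' wl' wr', IsSubsonic p φ h V wl wr →
      IsSubsonic p φ h' V' wl' wr' → h ∈ Icc h₀ h₁ → h' ∈ Icc h₀ h₁ →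
      |wr - wr'| ≤ L * |h - h'| := by
  have c3 := p.c₃_pos
  have c31 := p.c₃_lt_c₁
  obtain ⟨V₀, wl₀, wr₀, S₀⟩ := hφ.exists_isSubsonic h₀_pos
  have hd₀ : 0 < p.c₃ - V₀ := by linarith [S₀.speed.2]
  obtain ⟨d₀, hd₀e⟩ : ∃ d, d = p.c₃ - V₀ := ⟨_, rfl⟩
  rw [← hd₀e] at hd₀
  by_cases h01 : h₁ < h₀
  · exact ⟨0, le_rfl, fun h V wl wr h' V' wl' wr' _ _ hh => by linarith [hh.1, hh.2]⟩
  have h1pos : 0 < h₁ := by linarith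
  have hM := p.wM_pos
  have hm := p.wm_pos
  -- Lower bound of `wl wr`: for `V > 0`, or `V = 0`, from `wr ≥ wm` and `left_eq`; for `V < 0` from
  -- `φ ≤ 0`.
  obtain ⟨g₀, hg₀⟩ : ∃ x, x = min (p.wM * p.wm) (p.wm * (h₀ * p.c₃ / (2 * p.c₁))) := ⟨_, rfl⟩
  have hg₀pos : 0 < g₀ :=
    hg₀ ▸ lt_min (by positivity) (by have := p.c₁_pos; positivity)
  have hg₀l : g₀ ≤ p.wM * p.wm := hg₀ ▸ min_le_left _ _
  have hg₀r : g₀ ≤ p.wm * (h₀ * p.c₃ / (2 * p.c₁)) := hg₀ ▸ min_le_right _ _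
  have hg : ∀ h V wl wr, IsSubsonic p φ h V wl wr → h₀ ≤ h → g₀ ≤ wl * wr := by
    intro h V wl wr S hh
    rcases le_or_gt 0 V with hV | hV
    · refine hg₀r.trans ?_
      rw [mul_comm wl]
      refine mul_le_mul S.le_right ?_ (by have := p.c₁_pos; positivity) S.right_pos.le
      rw [div_le_iff₀ (by linarith)]
      have e1 : h₀ * p.c₃ ≤ (p.c₃ + V) * h := by
        rw [mul_comm]
        exact mul_le_mul (by linarith) hh h₀_pos.le (by linarith)
      rw [S.left_eq] at e1
      have e2 : (p.c₁ + V) * wl ≤ 2 * p.c₁ * wl :=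
        mul_le_mul_of_nonneg_right (by linarith [S.speed.2]) S.left_pos.le
      linarith
    · refine hg₀l.trans ?_
      have b3 := (hφ.kineticGraph_bounds S.speed S.kinetic).2.2.1 hV
      have := nonpos_of_mul_nonpos_right b3 (by linarith [p.k₃_lt])
      linarith
  -- The speed decreases with `h`, so it is at most the speed `V₀` belonging to `h₀`.
  have hVle : ∀ h V wl wr, IsSubsonic p φ h V wl wr → h₀ ≤ h → d₀ ≤ p.c₃ - V := by
    intro h V wl wr S hh
    by_contra! hlt
    have := S₀.lt_of_speed_lt hφ S (by linarith)
    linarith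
  obtain ⟨A, hA⟩ : ∃ x, x = 2 * (p.c₁ - p.c₃) ^ 2 * p.c₃ := ⟨_, rfl⟩
  have hApos : 0 < A := by
    have : 0 < p.c₁ - p.c₃ := by linarith
    rw [hA]; positivity
  obtain ⟨m, hmdef⟩ : ∃ x, x = (p.c₁ + p.c₃) * (2 * p.c₃) := ⟨_, rfl⟩
  have hmpos : 0 < m := by rw [hmdef]; have := p.c₁_pos; positivity
  obtain ⟨B, hB⟩ : ∃ x, x = m * m * (2 * h₁) / (g₀ * A) := ⟨_, rfl⟩
  have hBpos : 0 ≤ B := by rw [hB]; positivity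
  obtain ⟨D, hD⟩ : ∃ x, x = (2 * p.c₁ * h₁) / d₀ := ⟨_, rfl⟩
  have hDpos : 0 ≤ D := by rw [hD]; have := p.c₁_pos; positivity
  obtain ⟨L, hL⟩ : ∃ x, x = (2 * p.c₁ + B * (h₁ + D)) / d₀ := ⟨_, rfl⟩
  have hLpos : 0 ≤ L := by rw [hL]; have := p.c₁_pos; positivity
  have key : ∀ h V wl wr h' V' wl' wr', IsSubsonic p φ h V wl wr →
      IsSubsonic p φ h' V' wl' wr' → h ∈ Icc h₀ h₁ → h' ∈ Icc h₀ h₁ → V ≤ V' →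
      |wr - wr'| ≤ L * |h - h'| := by
    intro h V wl wr h' V' wl' wr' S S' hh hh' hVV
    have hs := S.speed
    have hs' := S'.speed
    have hVd : V' - V ≤ B * |h - h'| := by
      rcases hVV.eq_or_lt with rfl | hlt
      · rw [sub_self]; positivity
      · have i1 := S.speed_gap hφ S' hlt
        have i2 : 0 ≤ h - h' := sub_nonneg.2 (S.lt_of_speed_lt hφ S' hlt).le
        rw [abs_of_nonneg i2, hB, div_mul_eq_mul_div, le_div_iff₀ (by positivity)]
        have d1 : (p.c₁ - V) * (p.c₃ + V) ≤ m := hmdef ▸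
          mul_le_mul (by linarith [hs.1]) (by linarith [hs.2]) (by linarith [hs.1]) (by linarith)
        have d2 : (p.c₁ - V') * (p.c₃ + V') ≤ m := hmdef ▸
          mul_le_mul (by linarith [hs'.1]) (by linarith [hs'.2]) (by linarith [hs'.1])
            (by linarith)
        have d0 : 0 ≤ (p.c₁ - V') * (p.c₃ + V') :=
          mul_nonneg (by linarith [hs'.2]) (by linarith [hs'.1])
        have i3 : h ^ 2 - h' ^ 2 ≤ 2 * h₁ * (h - h') := by
          rw [sq_sub_sq]
          exact mul_le_mul_of_nonneg_right (by linarith [hh.2, hh'.2]) i2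
        have i4 : 0 ≤ h ^ 2 - h' ^ 2 := by
          rw [sq_sub_sq]
          exact mul_nonneg (by linarith [S.strain_pos, S'.strain_pos]) i2
        calc (V' - V) * (g₀ * A) = g₀ * (A * (V' - V)) := by ring
          _ ≤ wl * wr * (A * (V' - V)) := by
            refine mul_le_mul_of_nonneg_right (hg _ _ _ _ S hh.1) ?_
            exact mul_nonneg hApos.le (by linarith)
          _ ≤ _ := hA ▸ i1
          _ ≤ m * m * (2 * h₁ * (h - h')) :=
            mul_le_mul (mul_le_mul d1 d2 d0 hmpos.le) i3 i4 (by positivity)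
          _ = _ := by ring
    have hd := hVle _ _ _ _ S hh.1
    have hd' := hVle _ _ _ _ S' hh'.1
    have hD' : wr' ≤ D := by
      rw [hD, le_div_iff₀ hd₀]
      have e1 := S'.right_eq
      have e2 : (p.c₁ - V') * h' ≤ 2 * p.c₁ * h₁ :=
        mul_le_mul (by linarith [hs'.1]) hh'.2 S'.strain_pos.le (by linarith)
      have e3 := mul_le_mul_of_nonneg_right hd' S'.right_pos.le
      linarith
    have e : (p.c₃ - V) * (wr - wr') = (p.c₁ - V) * (h - h') + (V' - V) * (h' - wr') := by
      linear_combination -S.right_eq + S'.right_eq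
    have habs : d₀ * |wr - wr'| ≤ 2 * p.c₁ * |h - h'| + (V' - V) * (h₁ + D) := by
      calc d₀ * |wr - wr'| ≤ (p.c₃ - V) * |wr - wr'| :=
            mul_le_mul_of_nonneg_right hd (abs_nonneg _)
        _ = |(p.c₁ - V) * (h - h') + (V' - V) * (h' - wr')| := by
            rw [← e, abs_mul, abs_of_pos (show 0 < p.c₃ - V by linarith)]
        _ ≤ |(p.c₁ - V) * (h - h')| + |(V' - V) * (h' - wr')| := abs_add_le _ _
        _ ≤ _ := by
            rw [abs_mul, abs_mul, abs_of_pos (show 0 < p.c₁ - V by linarith [hs.2]),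
              abs_of_nonneg (show 0 ≤ V' - V by linarith)]
            refine add_le_add (mul_le_mul_of_nonneg_right (by linarith [hs.1]) (abs_nonneg _))
              (mul_le_mul_of_nonneg_left ?_ (by linarith))
            rw [abs_le]
            constructor <;> linarith [S'.right_pos, S'.strain_pos, hh'.2]
    rw [hL, div_mul_eq_mul_div, le_div_iff₀ hd₀]
    have := mul_le_mul_of_nonneg_right hVd (show 0 ≤ h₁ + D by linarith)
    linarith
  refine ⟨L, hLpos, fun h V wl wr h' V' wl' wr' S S' hh hh' => ?_⟩
  rcases le_total V V' with hVV | hVV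
  · exact key _ _ _ _ _ _ _ _ S S' hh hh' hVV
  · rw [abs_sub_comm, abs_sub_comm h]
    exact key _ _ _ _ _ _ _ _ S' S hh' hh hVV

end IsSubsonic

/-- The square of the strain ahead of a nearly sonic phase boundary of speed `V`. -/
noncomputable def sonicSq (p : Material) (φ : ℝ → ℝ) (V : ℝ) : ℝ :=
  2 / (p.k₁ - p.k₃) * endSlope φ (p.c₃ / 2) p.c₃ V * ((p.k₁ - V ^ 2) / (p.c₃ + V))

/-- A nearly sonic phase boundary, including the sonic one. -/
structure IsNearSonic (p : Material) (φ : ℝ → ℝ) (h V W : ℝ) : Prop where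
  speed : V ∈ Icc (p.c₃ / 2) p.c₃
  le_strain : p.wm ≤ W
  eq : (p.c₁ - V) * h = (p.c₃ - V) * W
  sq : W ^ 2 = sonicSq p φ V

lemma IsDissipationFunction.contDiffOn_right (hφ : p.IsDissipationFunction φ) :
    ContDiffOn ℝ 2 φ (Icc (p.c₃ / 2) p.c₃) :=
  hφ.contDiffOn.mono fun _ hx => Or.inr ⟨by linarith [hx.1, p.c₃_pos], hx.2⟩

/-- Continuity from the left identifies `φ c₃` with the prescribed limit, the kinetic value for `wl
wr = 0`. Hence `φ c₃ - φ V` is a multiple of `wl wr`. -/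
lemma IsDissipationFunction.sound (hφ : p.IsDissipationFunction φ) :
    φ p.c₃ = (p.k₁ - p.k₃) / 2 * (p.wM * p.wm) := by
  have h3 := p.c₃_pos
  have h1 : Tendsto φ (𝓝[<] p.c₃) (𝓝 (φ p.c₃)) := by
    have := (hφ.contDiffOn_right.continuousOn p.c₃ ⟨by linarith, le_rfl⟩).tendsto
    refine this.mono_left ?_
    rw [← nhdsWithin_Ioo_eq_nhdsLT (show p.c₃ / 2 < p.c₃ by linarith)]
    exact nhdsWithin_mono _ Ioo_subset_Icc_self
  rw [tendsto_nhds_unique h1 hφ.tendsto_sound, psiMax, p.c₃_sq]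
  simp
  ring

lemma endSlope_sound :
    endSlope φ (p.c₃ / 2) p.c₃ p.c₃ = p.slopeAtSound φ := by
  have h3 := p.c₃_pos
  rw [endSlope, if_pos rfl, slopeAtSound]
  refine derivWithin_congr_set ?_
  filter_upwards [Ioi_mem_nhds (show p.c₃ / 2 < p.c₃ by linarith)] with x hx
  have hx' : p.c₃ / 2 < x := hx
  refine propext ⟨fun h => ⟨by linarith, h.2⟩, fun h => ⟨hx'.le, h.2⟩⟩

/-- The relation `φ c₃ - φ V = (k₁ - k₃)/2 · wl wr` and `(k₁ - V²) wl = (k₃ - V²) wr` both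
degenerate at `V = c₃`. Dividing by `c₃ - V` leaves a formula for `wr²` that is regular up to the
sonic speed. -/
lemma IsSubsonic.isNearSonic (hφ : p.IsDissipationFunction φ) {h V wl wr : ℝ}
    (S : IsSubsonic p φ h V wl wr) (hV : p.c₃ / 2 ≤ V) : IsNearSonic p φ h V wr := by
  have h3 := p.c₃_pos
  have h31 := p.c₃_lt_c₁
  refine ⟨⟨hV, S.speed.2.le⟩, S.le_right, S.right_eq, ?_⟩
  have hk := S.kinetic
  have hkk : p.k₁ - p.k₃ ≠ 0 := (sub_pos.2 p.k₃_lt).ne'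
  rw [kineticGraph_of_ne (by linarith), mem_singleton_iff] at hk
  have a1 : p.c₃ - V ≠ 0 := by linarith [S.speed.2]
  have a2 : p.c₃ + V ≠ 0 := by linarith
  rw [sonicSq, endSlope, if_neg S.speed.2.ne, hφ.sound, ← hk, ← p.c₁_sq] at *
  have e := S.left_eq
  have e' := S.right_eq
  have e3 : (p.c₁ - V) * (p.c₁ + V) * wl = (p.c₃ - V) * (p.c₃ + V) * wr := by
    linear_combination (p.c₃ + V) * e' - (p.c₁ - V) * e
  field_simp
  linear_combination (-wr) * e3

/-- At `V = c₃` the chord slope is `φ'(c₃)` and `k₁ - V²` cancels `k₁ - k₃`, leaving `W² =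
φ'(c₃)/c₃`. This places the sonic front at the end of the subsonic branch. -/
lemma isNearSonic_sound {W : ℝ} (hW : p.wm ≤ W)
    (hW' : W = Real.sqrt (p.slopeAtSound φ / p.c₃)) : IsNearSonic p φ 0 p.c₃ W := by
  have h3 := p.c₃_pos
  refine ⟨⟨by linarith, le_rfl⟩, hW, by simp, ?_⟩
  have hkk : p.k₁ - p.k₃ ≠ 0 := (sub_pos.2 p.k₃_lt).ne'
  -- Otherwise `Real.sqrt` takes its default value `0`, which is not a phase 3 strain.
  have hpos : 0 ≤ p.slopeAtSound φ / p.c₃ := by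
    by_contra! hneg
    rw [Real.sqrt_eq_zero_of_nonpos hneg.le] at hW'
    linarith [p.wm_pos]
  rw [hW', Real.sq_sqrt hpos, sonicSq, endSlope_sound, p.c₃_sq]
  field_simp
  ring

lemma exists_lipschitz_sonicSq (hφ : p.IsDissipationFunction φ) :
    ∃ K, 0 ≤ K ∧ ∀ x ∈ Icc (p.c₃ / 2) p.c₃, ∀ y ∈ Icc (p.c₃ / 2) p.c₃,
      |sonicSq p φ x - sonicSq p φ y| ≤ K * |x - y| := by
  have h3 := p.c₃_pos
  obtain ⟨K, hK0, hK⟩ := exists_lipschitz_endSlope (show p.c₃ / 2 < p.c₃ by linarith)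
    hφ.contDiffOn_right
  set G := endSlope φ (p.c₃ / 2) p.c₃ with hG
  set R : ℝ → ℝ := fun V => (p.k₁ - V ^ 2) / (p.c₃ + V) with hR
  have hc : ContDiffOn ℝ 1 R (Icc (p.c₃ / 2) p.c₃) := by
    refine ContDiffOn.div (by fun_prop) (by fun_prop) fun x hx => ?_
    linarith [hx.1]
  have hu := uniqueDiffOn_Icc (show p.c₃ / 2 < p.c₃ by linarith)
  obtain ⟨M, hM⟩ := isCompact_Icc.exists_bound_of_continuousOn
    (hc.continuousOn_derivWithin hu le_rfl)
  obtain ⟨N, hN⟩ := isCompact_Icc.exists_bound_of_continuousOn hc.continuousOn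
  have hc3 : p.c₃ ∈ Icc (p.c₃ / 2) p.c₃ := ⟨by linarith, le_rfl⟩
  have hM0 : 0 ≤ M := (norm_nonneg _).trans (hM _ hc3)
  have hN0 : 0 ≤ N := (norm_nonneg _).trans (hN _ hc3)
  have hk : 0 < 2 / (p.k₁ - p.k₃) := div_pos two_pos (sub_pos.2 p.k₃_lt)
  have hGb : ∀ x ∈ Icc (p.c₃ / 2) p.c₃, |G x| ≤ |G p.c₃| + K * p.c₃ := by
    intro x hx
    have h1 := hK x hx _ hc3
    have h2 : |x - p.c₃| ≤ p.c₃ := by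
      rw [abs_le]; constructor <;> linarith [hx.1, hx.2]
    have h3 := mul_le_mul_of_nonneg_left h2 hK0
    have h4 : |G x| ≤ |G x - G p.c₃| + |G p.c₃| := by
      simpa using abs_add_le (G x - G p.c₃) (G p.c₃)
    linarith
  refine ⟨2 / (p.k₁ - p.k₃) * ((|G p.c₃| + K * p.c₃) * M + N * K), by positivity,
    fun x hx y hy => ?_⟩
  have e : sonicSq p φ x - sonicSq p φ y =
      2 / (p.k₁ - p.k₃) * (G x * (R x - R y) + R y * (G x - G y)) := by
    simp only [sonicSq, hG, hR]; ring
  have hRl : |R x - R y| ≤ M * |x - y| := by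
    simpa [Real.norm_eq_abs] using (convex_Icc _ _).norm_image_sub_le_of_norm_derivWithin_le
      (hc.differentiableOn (by norm_num)) hM hy hx
  rw [e, abs_mul, abs_of_pos hk, mul_assoc]
  refine mul_le_mul_of_nonneg_left ((abs_add_le _ _).trans ?_) hk.le
  rw [abs_mul, abs_mul, add_mul, mul_assoc, mul_assoc]
  refine add_le_add (mul_le_mul (hGb x hx) hRl (abs_nonneg _) ((abs_nonneg _).trans (hGb x hx)))
    (mul_le_mul (hN y hy) (hK x hx y hy) (abs_nonneg _) hN0)

/-- The strain `W` is a Lipschitz function of `V` by `sonicSq`, as `W + W' ≥ 2 wm`. In the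
difference of the two relations between `h` and `V`, the term in `V' - V` has the coefficient `W (c₁
- c₃)`, bounded below, while the term in `W - W'` carries `c₃ - V'`, which is small with `h'` and
can be absorbed. -/
lemma exists_lipschitz_nearSonic (hφ : p.IsDissipationFunction φ) :
    ∃ δ > 0, ∃ L, 0 ≤ L ∧ ∀ h V W h' V' W', IsNearSonic p φ h V W → IsNearSonic p φ h' V' W' →
      h ≤ δ → h' ≤ δ → |W - W'| ≤ L * |h - h'| := by
  have h3 := p.c₃_pos
  have h31 := p.c₃_lt_c₁
  have h1 := p.c₁_pos
  have hm := p.wm_pos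
  obtain ⟨K, hK0, hK⟩ := exists_lipschitz_sonicSq hφ
  set L₁ := K / (2 * p.wm) with hL₁
  have hL₁0 : 0 ≤ L₁ := by positivity
  have hκ : 0 < p.c₁ - p.c₃ := by linarith
  -- Chosen so that the term in `W - W'` is at most half of the lower bound `wm (c₁ - c₃)(V' - V)`
  -- of the main term.
  set δ := p.wm ^ 2 * (p.c₁ - p.c₃) / (2 * (p.c₁ ^ 2 * (L₁ + 1))) with hδ
  have hδpos : 0 < δ := by positivity
  have hδe : δ * (2 * (p.c₁ ^ 2 * (L₁ + 1))) = p.wm ^ 2 * (p.c₁ - p.c₃) := by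
    rw [hδ]; field_simp
  set B := 2 * p.c₁ ^ 2 / (p.wm * (p.c₁ - p.c₃)) with hB
  have hWV : ∀ h V W h' V' W', IsNearSonic p φ h V W → IsNearSonic p φ h' V' W' →
      |W - W'| ≤ L₁ * |V - V'| := by
    intro h V W h' V' W' S S'
    have e : (W + W') * (W - W') = sonicSq p φ V - sonicSq p φ V' := by
      rw [← S.sq, ← S'.sq]; ring
    have i1 := S.le_strain
    have i2 := S'.le_strain
    have i3 := hK V S.speed V' S'.speed
    rw [← e, abs_mul, abs_of_pos (show 0 < W + W' by linarith)] at i3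
    rw [hL₁, div_mul_eq_mul_div, le_div_iff₀ (by positivity)]
    nlinarith [abs_nonneg (W - W')]
  have key : ∀ h V W h' V' W', IsNearSonic p φ h V W → IsNearSonic p φ h' V' W' →
      h ≤ δ → h' ≤ δ → V ≤ V' → |W - W'| ≤ L₁ * B * |h - h'| := by
    intro h V W h' V' W' S S' hh hh' hVV
    have s1 := S.speed
    have s2 := S'.speed
    have i1 := hWV _ _ _ _ _ _ S S'
    rw [abs_sub_comm V, abs_of_nonneg (sub_nonneg.2 hVV)] at i1
    have e : (p.c₁ - V) * (p.c₁ - V') * (h - h') =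
        W * ((p.c₁ - p.c₃) * (V' - V)) + (p.c₃ - V') * (p.c₁ - V) * (W - W') := by
      linear_combination (p.c₁ - V') * S.eq - (p.c₁ - V) * S'.eq
    have i2 : p.wm * (p.c₁ - p.c₃) * (V' - V) ≤ W * ((p.c₁ - p.c₃) * (V' - V)) := by
      rw [mul_assoc]
      exact mul_le_mul_of_nonneg_right S.le_strain (mul_nonneg hκ.le (by linarith))
    have i3 : p.wm * (p.c₃ - V') ≤ p.c₁ * δ := by
      calc p.wm * (p.c₃ - V') ≤ W' * (p.c₃ - V') :=
            mul_le_mul_of_nonneg_right S'.le_strain (by linarith [s2.2])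
        _ = (p.c₁ - V') * h' := by rw [S'.eq]; ring
        _ ≤ (p.c₁ - V') * δ := mul_le_mul_of_nonneg_left hh' (by linarith [s2.2])
        _ ≤ _ := mul_le_mul_of_nonneg_right (by linarith [s2.1]) hδpos.le
    have i4 : p.wm * ((p.c₃ - V') * (p.c₁ - V) * |W - W'|) ≤
        p.wm * (p.wm * (p.c₁ - p.c₃) / 2 * (V' - V)) := by
      calc p.wm * ((p.c₃ - V') * (p.c₁ - V) * |W - W'|)
          = p.wm * (p.c₃ - V') * ((p.c₁ - V) * |W - W'|) := by ring
        _ ≤ p.c₁ * δ * (p.c₁ * (L₁ * (V' - V))) := by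
            refine mul_le_mul i3 (mul_le_mul (by linarith [s1.1]) i1 (abs_nonneg _) h1.le)
              (mul_nonneg (by linarith [s1.2]) (abs_nonneg _)) (by positivity)
        _ ≤ p.c₁ * δ * (p.c₁ * ((L₁ + 1) * (V' - V))) := by
            refine mul_le_mul_of_nonneg_left (mul_le_mul_of_nonneg_left
              (mul_le_mul_of_nonneg_right (by linarith) (by linarith)) h1.le) (by positivity)
        _ = δ * (2 * (p.c₁ ^ 2 * (L₁ + 1))) / 2 * (V' - V) := by ring
        _ = _ := by rw [hδe]; ring
    have i5 := le_of_mul_le_mul_left i4 hm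
    have i6 : W * ((p.c₁ - p.c₃) * (V' - V)) ≤
        p.c₁ ^ 2 * |h - h'| + (p.c₃ - V') * (p.c₁ - V) * |W - W'| := by
      have j1 : W * ((p.c₁ - p.c₃) * (V' - V)) =
        (p.c₁ - V) * (p.c₁ - V') * (h - h') - (p.c₃ - V') * (p.c₁ - V) * (W - W') := by
        rw [e]; ring
      have j2 : (p.c₁ - V) * (p.c₁ - V') * (h - h') ≤ p.c₁ ^ 2 * |h - h'| := by
        rw [sq]
        have : (p.c₁ - V) * (p.c₁ - V') ≤ p.c₁ * p.c₁ :=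
          mul_le_mul (by linarith [s1.1]) (by linarith [s2.1]) (by linarith [s2.2]) h1.le
        have j3 : 0 ≤ (p.c₁ - V) * (p.c₁ - V') :=
          mul_nonneg (by linarith [s1.2]) (by linarith [s2.2])
        exact (mul_le_mul_of_nonneg_left (le_abs_self _) j3).trans
          (mul_le_mul_of_nonneg_right this (abs_nonneg _))
      have j4 : -((p.c₃ - V') * (p.c₁ - V) * |W - W'|) ≤
          (p.c₃ - V') * (p.c₁ - V) * (W - W') := by
        rw [← mul_neg]
        refine mul_le_mul_of_nonneg_left (neg_abs_le _) ?_
        exact mul_nonneg (by linarith [s2.2]) (by linarith [s1.2])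
      linarith
    have i7 : V' - V ≤ B * |h - h'| := by
      rw [hB, div_mul_eq_mul_div, le_div_iff₀ (by positivity)]
      linarith
    calc |W - W'| ≤ L₁ * (V' - V) := i1
      _ ≤ L₁ * (B * |h - h'|) := mul_le_mul_of_nonneg_left i7 hL₁0
      _ = _ := by ring
  refine ⟨δ, hδpos, L₁ * B, by positivity, fun h V W h' V' W' S S' hh hh' => ?_⟩
  rcases le_total V V' with hVV | hVV
  · exact key _ _ _ _ _ _ S S' hh hh' hVV
  · rw [abs_sub_comm, abs_sub_comm h]
    exact key _ _ _ _ _ _ S' S hh' hh hVV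

end Material

/-! ### The front strains as functions of the averaged strain, through all regimes. -/

namespace Material

variable (p : Material) (φ : ℝ → ℝ)

open Classical in
/-- The strain ahead of the subsonic phase boundary with averaged strain `h`. -/
noncomputable def subStrain (h : ℝ) : ℝ :=
  if H : ∃ wr V wl, IsSubsonic p φ h V wl wr then H.choose else 0

/-- The strain behind a phase boundary. -/
noncomputable def backStrain (h W : ℝ) : ℝ :=
  h * (2 * p.c₃ * W - (p.c₁ + p.c₃) * h) / ((p.c₁ + p.c₃) * W - 2 * p.c₁ * h)

/-- The speed of a phase boundary. -/
noncomputable def frontSpeed (h W : ℝ) : ℝ := (p.c₃ * W - p.c₁ * h) / (W - h)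

/-- The strain ahead of the phase boundary for the given strain `w` on the right. -/
noncomputable def frontStrain (h w : ℝ) : ℝ := if 0 < h then subStrain p φ h else w

variable {p φ}

lemma IsDissipationFunction.isSubsonic (hφ : p.IsDissipationFunction φ) {h : ℝ} (hh : 0 < h) :
    ∃ V wl, IsSubsonic p φ h V wl (subStrain p φ h) := by
  obtain ⟨V, wl, wr, S⟩ := hφ.exists_isSubsonic hh
  have H : ∃ wr V wl, IsSubsonic p φ h V wl wr := ⟨wr, V, wl, S⟩
  rw [subStrain, dif_pos H]
  exact H.choose_spec

/-- The two relations are linear in `V` and in `wl`. The denominators are positive because `(c₁ -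
V)(W - h) = (c₁ - c₃) W` and `(c₁ + c₃) W - 2 c₁ h = (c₁ + V)(W - h)`. -/
lemma speed_eq {h V W wl : ℝ} (hW : 0 < W) (hV : V < p.c₁) (hV' : -p.c₁ < V)
    (e : (p.c₁ - V) * h = (p.c₃ - V) * W) (e' : (p.c₃ + V) * h = (p.c₁ + V) * wl) :
    V = p.frontSpeed h W ∧ wl = p.backStrain h W ∧ 0 < W - h ∧
      0 < (p.c₁ + p.c₃) * W - 2 * p.c₁ * h := by
  have h31 := p.c₃_lt_c₁
  have h1 : 0 < W - h := by
    have : (p.c₁ - V) * (W - h) = (p.c₁ - p.c₃) * W := by linear_combination -e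
    have h2 : 0 < (p.c₁ - p.c₃) * W := mul_pos (by linarith) hW
    rw [← this] at h2
    exact pos_of_mul_pos_right h2 (by linarith)
  have h2 : (p.c₁ + p.c₃) * W - 2 * p.c₁ * h = (p.c₁ + V) * (W - h) := by linear_combination -e
  have h3 : 0 < p.c₁ + V := by linarith
  have h4 : 0 < (p.c₁ + p.c₃) * W - 2 * p.c₁ * h := h2 ▸ mul_pos h3 h1
  refine ⟨?_, ?_, h1, h4⟩
  · rw [frontSpeed, eq_div_iff h1.ne']
    linear_combination e
  · rw [backStrain, eq_div_iff h4.ne', h2]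
    linear_combination (-(W - h)) * e' + h * e

lemma speed_eqs {h W : ℝ} (h1 : W - h ≠ 0) (h2 : (p.c₁ + p.c₃) * W - 2 * p.c₁ * h ≠ 0) :
    (p.c₁ - p.frontSpeed h W) * h = (p.c₃ - p.frontSpeed h W) * W ∧
    (p.c₃ + p.frontSpeed h W) * h = (p.c₁ + p.frontSpeed h W) * p.backStrain h W := by
  rw [frontSpeed, backStrain]
  have e : p.c₁ + (p.c₃ * W - p.c₁ * h) / (W - h) =
      ((p.c₁ + p.c₃) * W - 2 * p.c₁ * h) / (W - h) := by field_simp; ring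
  constructor
  · field_simp; ring
  · rw [e, div_mul_div_comm, eq_div_iff (mul_ne_zero h1 h2)]
    field_simp
    ring

lemma frontSpeed_mem {h W : ℝ} (hW : 0 < W) (hh : h ≤ 0) :
    p.frontSpeed h W ∈ Ico p.c₃ p.c₁ := by
  have h31 := p.c₃_lt_c₁
  have h1 : 0 < W - h := by linarith
  rw [frontSpeed]
  constructor
  · rw [le_div_iff₀ h1]; nlinarith
  · rw [div_lt_iff₀ h1]; nlinarith

/-- Three cases for the averaged strain of the unperturbed front. If positive, nearby fronts are
subsonic with `h` bounded away from `0`; if negative, nearby fronts are supersonic and the function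
is constant; if zero, the front is sonic and `hchar` makes the two branches meet. -/
lemma exists_lipschitz_frontStrain (hφ : p.IsDissipationFunction φ) {uL uR : State} {V : ℝ}
    (hL : uL ∈ p.H₁) (hR : uR ∈ p.H₃) (hstar : IsRiemannSolution p φ uL uR (fan uL [(V, uR)]))
    (hchar : V = p.c₃ → uL.2 = 0 ∧ uR.2 = Real.sqrt (p.slopeAtSound φ / p.c₃)) :
    p.frontStrain φ (p.avgStrain uL uR) uR.2 = uR.2 ∧
    uL.2 = p.backStrain (p.avgStrain uL uR) uR.2 ∧ 0 < uR.2 - p.avgStrain uL uR ∧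
    0 < (p.c₁ + p.c₃) * uR.2 - 2 * p.c₁ * p.avgStrain uL uR ∧
    ∃ δ > 0, ∃ L, 0 ≤ L ∧ ∀ h h', |h - p.avgStrain uL uR| ≤ δ → |h' - p.avgStrain uL uR| ≤ δ →
      |p.frontStrain φ h uR.2 - p.frontStrain φ h' uR.2| ≤ L * |h - h'| := by
  have c3 := p.c₃_pos
  have c31 := p.c₃_lt_c₁
  have hRm : p.wm ≤ uR.2 := hR
  have hRpos : 0 < uR.2 := p.wm_pos.trans_le hRm
  have hc : 0 < p.c₁ + p.c₃ := by linarith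
  have hh : (p.c₁ + p.c₃) * p.avgStrain uL uR =
      (uR.1 + p.c₃ * uR.2) - (uL.1 - p.c₁ * uL.2) := by
    rw [p.avgStrain_front hL hR]; field_simp
  obtain ⟨h₀, hh₀⟩ : ∃ h₀, h₀ = p.avgStrain uL uR := ⟨_, rfl⟩
  have hsin := hstar.single hL hR
  rw [← hh₀] at hh hsin ⊢
  have hRH : p.RankineHugoniot V uL uR := by rcases hsin with h | h; exacts [h.2.2.1, h.2.2]
  obtain ⟨e1, e2⟩ := (p.rankineHugoniot_iff hL.2 hRm hh).1 hRH
  have hV1 : V < p.c₁ := by rcases hsin with h | h <;> linarith [h.1.2]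
  have hV2 : -p.c₁ < V := by rcases hsin with h | h <;> linarith [h.1.1]
  obtain ⟨-, hb, hp1, hp2⟩ := speed_eq hRpos hV1 hV2 e1 e2
  rcases hsin with ⟨hV, hpos, -, hk⟩ | ⟨hV, hpos, -⟩
  · have S₀ : IsSubsonic p φ h₀ V uL.2 uR.2 := by
      refine ⟨hV, e1, e2, hL.2, hRm, ?_⟩
      rcases hk with ⟨-, -, hk⟩ | ⟨hk, -, -⟩
      · rwa [p.neg_dissipation hL.2 hRm] at hk
      · exact (p.disjoint_phases hL hk).elim
    obtain ⟨L, hL0, hLip⟩ := IsSubsonic.exists_lipschitz_of_pos hφ (h₁ := 2 * h₀) (half_pos hpos)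
    have hsub : ∀ h w, |h - h₀| ≤ h₀ / 2 → 0 < h ∧ h ∈ Icc (h₀ / 2) (2 * h₀) ∧
        ∃ V wl, IsSubsonic p φ h V wl (p.frontStrain φ h w) := by
      intro h w hh
      rw [abs_le] at hh
      have h0 : 0 < h := by linarith [hh.1]
      refine ⟨h0, ⟨by linarith [hh.1], by linarith [hh.2]⟩, ?_⟩
      rw [frontStrain, if_pos h0]
      exact hφ.isSubsonic h0
    refine ⟨?_, hb, hp1, hp2, h₀ / 2, half_pos hpos, L, hL0, fun h h' hh hh' => ?_⟩
    · obtain ⟨-, -, V', wl', S⟩ := hsub h₀ uR.2 (by simp; linarith)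
      exact (S.unique hφ S₀).2.2
    · obtain ⟨-, hm, V, wl, S⟩ := hsub h uR.2 hh
      obtain ⟨-, hm', V', wl', S'⟩ := hsub h' uR.2 hh'
      exact hLip _ _ _ _ _ _ _ _ S S' hm hm'
  · rcases hpos.eq_or_lt with h0 | hneg
    · have hVc : V = p.c₃ := by
        rw [h0, mul_zero] at e1
        rcases mul_eq_zero.1 e1.symm with h | h <;> linarith
      obtain ⟨hw, hw'⟩ := hchar hVc
      have N₀ := isNearSonic_sound hRm hw'
      obtain ⟨δ, hδ, L, hL0, hLip⟩ := exists_lipschitz_nearSonic hφ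
      have hm := p.wm_pos
      have h1 := p.c₁_pos
      -- The second bound forces `V ≥ c₃/2`: `wm (c₃ - V) ≤ 2 c₁ h ≤ wm c₃/2`.
      set η := min δ (p.wm * p.c₃ / (4 * p.c₁)) with hη
      have hηpos : 0 < η := lt_min hδ (by positivity)
      -- For `h ≤ 0` the value is the constant strain of the sonic front, so it belongs to the
      -- near-sonic family at `max h 0`. The map `h ↦ max h 0` is 1-Lipschitz.
      have hns : ∀ h, |h - h₀| ≤ η → ∃ V, IsNearSonic p φ (max h 0) V (p.frontStrain φ h uR.2) := by
        intro h hh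
        rw [h0, sub_zero, abs_le] at hh
        by_cases hpos : 0 < h
        · rw [frontStrain, if_pos hpos, max_eq_left hpos.le]
          obtain ⟨V, wl, S⟩ := hφ.isSubsonic hpos
          refine ⟨V, S.isNearSonic hφ ?_⟩
          have i1 : h * (4 * p.c₁) ≤ p.wm * p.c₃ := by
            rw [← le_div_iff₀ (by positivity)]
            exact hh.2.trans (min_le_right _ _)
          have i2 := S.right_eq
          have i3 : (p.c₃ - V) * p.wm ≤ (p.c₃ - V) * subStrain p φ h :=
            mul_le_mul_of_nonneg_left S.le_right (by linarith [S.speed.2])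
          have i4 : (p.c₁ - V) * h ≤ 2 * p.c₁ * h :=
            mul_le_mul_of_nonneg_right (by linarith [S.speed.1]) hpos.le
          have i5 : p.wm * (p.c₃ - V) ≤ p.wm * (p.c₃ / 2) := by linarith
          linarith [le_of_mul_le_mul_left i5 hm]
        · rw [frontStrain, if_neg hpos, max_eq_right (not_lt.1 hpos)]
          exact ⟨_, N₀⟩
      refine ⟨?_, hb, hp1, hp2, η, hηpos, L, hL0, fun h h' hh hh' => ?_⟩
      · rw [frontStrain, if_neg (by linarith)]
      · obtain ⟨V, N⟩ := hns h hh
        obtain ⟨V', N'⟩ := hns h' hh'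
        rw [h0, sub_zero] at hh hh'
        refine (hLip _ _ _ _ _ _ N N' ?_ ?_).trans ?_
        · exact max_le (((le_abs_self _).trans hh).trans (min_le_left _ _)) hδ.le
        · exact max_le (((le_abs_self _).trans hh').trans (min_le_left _ _)) hδ.le
        · exact mul_le_mul_of_nonneg_left (by simpa using abs_max_sub_max_le_abs h h' 0) hL0
    · have hc : ∀ h, |h - h₀| ≤ -h₀ / 2 → p.frontStrain φ h uR.2 = uR.2 := by
        intro h hh
        rw [abs_le] at hh
        rw [frontStrain, if_neg (by linarith [hh.2])]
      refine ⟨hc h₀ (by simp; linarith), hb, hp1, hp2, -h₀ / 2, by linarith, 0, le_rfl,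
        fun h h' hh hh' => ?_⟩
      rw [hc h hh, hc h' hh']
      simp

/-- For fixed `h` the difference in `W` has the exact factor `h²`. One power is kept in the
estimate: it is the weight with which the strain ahead acts on the state behind. -/
lemma exists_lipschitz_backStrain {h₀ W₀ : ℝ} (hD : 0 < (p.c₁ + p.c₃) * W₀ - 2 * p.c₁ * h₀) :
    ∃ η > 0, ∃ K, 0 ≤ K ∧ ∀ h W h' W', |h - h₀| ≤ η → |W - W₀| ≤ η → |h' - h₀| ≤ η →
      |W' - W₀| ≤ η → |p.backStrain h W - p.backStrain h' W'| ≤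
        K * |h - h'| + K * |h| * |W - W'| := by
  have c1 := p.c₁_pos
  have c3 := p.c₃_pos
  have c31 := p.c₃_lt_c₁
  obtain ⟨D₀, hD₀⟩ : ∃ D, D = (p.c₁ + p.c₃) * W₀ - 2 * p.c₁ * h₀ := ⟨_, rfl⟩
  rw [← hD₀] at hD
  -- Keeps the denominator `(c₁ + c₃) W - 2 c₁ h` above half of its value at the base point.
  set η := min 1 (D₀ / (2 * (3 * p.c₁ + p.c₃))) with hη
  have hηpos : 0 < η := lt_min one_pos (by positivity)
  have hη1 : η ≤ 1 := min_le_left _ _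
  have hη2 : η * (3 * p.c₁ + p.c₃) ≤ D₀ / 2 := by
    have : η ≤ D₀ / (2 * (3 * p.c₁ + p.c₃)) := min_le_right _ _
    rw [le_div_iff₀ (by positivity)] at this
    linarith
  have hDle : ∀ h W, |h - h₀| ≤ η → |W - W₀| ≤ η →
      D₀ / 2 ≤ (p.c₁ + p.c₃) * W - 2 * p.c₁ * h := by
    intro h W hh hW
    have i1 := mul_le_mul_of_nonneg_left (abs_le.1 hW).1 (show 0 ≤ p.c₁ + p.c₃ by linarith)
    have i2 := mul_le_mul_of_nonneg_left (abs_le.1 hh).2 (show 0 ≤ 2 * p.c₁ by linarith)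
    linarith
  obtain ⟨M, hM⟩ : ∃ M, M = |h₀| + |W₀| + 1 := ⟨_, rfl⟩
  have hM0 : 0 ≤ M := by rw [hM]; positivity
  have hbd : ∀ x x₀ : ℝ, |x - x₀| ≤ η → |x| ≤ |x₀| + 1 := by
    intro x x₀ hx
    have := abs_add_le (x - x₀) x₀
    rw [sub_add_cancel] at this
    linarith
  have hhM : ∀ h, |h - h₀| ≤ η → |h| ≤ M := by
    intro h hh; rw [hM]; linarith [hbd h h₀ hh, abs_nonneg W₀]
  have hWM : ∀ W, |W - W₀| ≤ η → |W| ≤ M := by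
    intro h hh; rw [hM]; linarith [hbd h W₀ hh, abs_nonneg h₀]
  obtain ⟨A, hA⟩ : ∃ A, A = 2 * p.c₃ * (p.c₁ + p.c₃) * M ^ 2 + 2 * (p.c₁ + p.c₃) ^ 2 * M ^ 2 +
    2 * p.c₁ * (p.c₁ + p.c₃) * M ^ 2 + M * (p.c₁ - p.c₃) ^ 2 := ⟨_, rfl⟩
  have hA0 : 0 ≤ A := by rw [hA]; positivity
  refine ⟨η, hηpos, A / (D₀ / 2) ^ 2, by positivity, fun h W h' W' hh hW hh' hW' => ?_⟩
  have d1 := hDle h W hh hW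
  have d2 := hDle h W' hh hW'
  have d3 := hDle h' W' hh' hW'
  have e1 : p.backStrain h W - p.backStrain h W' = h * h * (p.c₁ - p.c₃) ^ 2 * (W - W') /
      (((p.c₁ + p.c₃) * W - 2 * p.c₁ * h) * ((p.c₁ + p.c₃) * W' - 2 * p.c₁ * h)) := by
    have n1 : (p.c₁ + p.c₃) * W - 2 * p.c₁ * h ≠ 0 := by linarith
    have n2 : (p.c₁ + p.c₃) * W' - 2 * p.c₁ * h ≠ 0 := by linarith
    rw [backStrain, backStrain, div_sub_div _ _ n1 n2]
    congr 1
    ring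
  have e2 : p.backStrain h W' - p.backStrain h' W' = (h - h') * (2 * p.c₃ * (p.c₁ + p.c₃) *
      (W' * W') - (p.c₁ + p.c₃) ^ 2 * (W' * h + W' * h') + 2 * p.c₁ * (p.c₁ + p.c₃) * (h * h')) /
      (((p.c₁ + p.c₃) * W' - 2 * p.c₁ * h) * ((p.c₁ + p.c₃) * W' - 2 * p.c₁ * h')) := by
    have n1 : (p.c₁ + p.c₃) * W' - 2 * p.c₁ * h ≠ 0 := by linarith
    have n2 : (p.c₁ + p.c₃) * W' - 2 * p.c₁ * h' ≠ 0 := by linarith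
    rw [backStrain, backStrain, div_sub_div _ _ n1 n2]
    congr 1
    ring
  have hmul : ∀ x y : ℝ, |x| ≤ M → |y| ≤ M → |x * y| ≤ M ^ 2 := by
    intro x y hx hy
    rw [abs_mul, sq]
    exact mul_le_mul hx hy (abs_nonneg _) hM0
  have hdiv : ∀ N D D' B : ℝ, D₀ / 2 ≤ D → D₀ / 2 ≤ D' → |N| ≤ B →
      |N / (D * D')| ≤ B / (D₀ / 2) ^ 2 := by
    intro N D D' B h1 h2 hB
    have h3 : 0 < D * D' := mul_pos (by linarith) (by linarith)
    rw [abs_div, abs_of_pos h3]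
    refine div_le_div₀ ((abs_nonneg _).trans hB) hB (by positivity) ?_
    rw [sq]
    exact mul_le_mul h1 h2 (by linarith) (by linarith)
  have b1 : |p.backStrain h W - p.backStrain h W'| ≤ A / (D₀ / 2) ^ 2 * |h| * |W - W'| := by
    rw [e1]
    refine (hdiv _ _ _ (A * |h| * |W - W'|) d1 d2 ?_).trans (le_of_eq (by ring))
    rw [abs_mul, abs_mul, abs_mul, abs_of_nonneg (sq_nonneg (p.c₁ - p.c₃))]
    refine mul_le_mul_of_nonneg_right ?_ (abs_nonneg _)
    calc |h| * |h| * (p.c₁ - p.c₃) ^ 2 ≤ M * |h| * (p.c₁ - p.c₃) ^ 2 := by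
          gcongr; exact hhM h hh
      _ = M * (p.c₁ - p.c₃) ^ 2 * |h| := by ring
      _ ≤ A * |h| := by
          refine mul_le_mul_of_nonneg_right ?_ (abs_nonneg _)
          rw [hA]
          have : 0 ≤ 2 * p.c₃ * (p.c₁ + p.c₃) * M ^ 2 + 2 * (p.c₁ + p.c₃) ^ 2 * M ^ 2 +
            2 * p.c₁ * (p.c₁ + p.c₃) * M ^ 2 := by positivity
          linarith
  have b2 : |p.backStrain h W' - p.backStrain h' W'| ≤ A / (D₀ / 2) ^ 2 * |h - h'| := by
    rw [e2]
    refine (hdiv _ _ _ (A * |h - h'|) d2 d3 ?_).trans (le_of_eq (by ring))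
    rw [abs_mul, mul_comm]
    refine mul_le_mul_of_nonneg_right ?_ (abs_nonneg _)
    have j1 := abs_le.1 (hmul W' W' (hWM _ hW') (hWM _ hW'))
    have j2 := abs_le.1 (hmul W' h (hWM _ hW') (hhM _ hh))
    have j3 := abs_le.1 (hmul W' h' (hWM _ hW') (hhM _ hh'))
    have j4 := abs_le.1 (hmul h h' (hhM _ hh) (hhM _ hh'))
    have k1 : 0 ≤ 2 * p.c₃ * (p.c₁ + p.c₃) := by positivity
    have k2 : 0 ≤ (p.c₁ + p.c₃) ^ 2 := by positivity
    have k3 : 0 ≤ 2 * p.c₁ * (p.c₁ + p.c₃) := by positivity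
    have k4 : 0 ≤ M * (p.c₁ - p.c₃) ^ 2 := by positivity
    rw [hA, abs_le]
    constructor
    · linarith [mul_le_mul_of_nonneg_left j1.1 k1, mul_le_mul_of_nonneg_left j2.2 k2,
        mul_le_mul_of_nonneg_left j3.2 k2, mul_le_mul_of_nonneg_left j4.1 k3]
    · linarith [mul_le_mul_of_nonneg_left j1.2 k1, mul_le_mul_of_nonneg_left j2.1 k2,
        mul_le_mul_of_nonneg_left j3.1 k2, mul_le_mul_of_nonneg_left j4.2 k3]
  have := abs_sub_le (p.backStrain h W) (p.backStrain h W') (p.backStrain h' W')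
  linarith

/-- The strain behind the front depends Lipschitz continuously on the data, and depends on the
strain ahead only in proportion to the supersonic part of the averaged strain. -/
lemma exists_lipschitz_backStrain_frontStrain {h₀ W₀ : ℝ} (hW₀ : 0 < W₀)
    (hD : 0 < (p.c₁ + p.c₃) * W₀ - 2 * p.c₁ * h₀) (hs : p.frontStrain φ h₀ W₀ = W₀) {δ L : ℝ}
    (hδ : 0 < δ) (hL : 0 ≤ L) (hLip : ∀ h h', |h - h₀| ≤ δ → |h' - h₀| ≤ δ →
      |p.frontStrain φ h W₀ - p.frontStrain φ h' W₀| ≤ L * |h - h'|) :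
    ∃ η > 0, ∃ K, 0 ≤ K ∧ ∀ h w h' w', |h - h₀| ≤ η → |w - W₀| ≤ η → |h' - h₀| ≤ η →
      |w' - W₀| ≤ η → 0 < p.frontStrain φ h w ∧
        |p.backStrain h (p.frontStrain φ h w) - p.backStrain h' (p.frontStrain φ h' w')| ≤
          K * |h - h'| + K * max (-h) 0 * |w - w'| := by
  obtain ⟨η₁, hη₁, K, hK, hB⟩ := exists_lipschitz_backStrain hD
  obtain ⟨η, hη, i1, i2, i3, i4⟩ : ∃ η > 0, η ≤ η₁ ∧ η ≤ δ ∧ L * η ≤ η₁ ∧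
      (L + 1) * η ≤ W₀ / 2 := by
    refine ⟨min (min η₁ δ) (min (η₁ / (L + 1)) (W₀ / 2 / (L + 1))), by positivity,
      (min_le_left _ _).trans (min_le_left _ _), (min_le_left _ _).trans (min_le_right _ _), ?_, ?_⟩
    · have : min (min η₁ δ) (min (η₁ / (L + 1)) (W₀ / 2 / (L + 1))) ≤ η₁ / (L + 1) :=
        (min_le_right _ _).trans (min_le_left _ _)
      rw [le_div_iff₀ (by positivity)] at this
      have h0 : 0 ≤ min (min η₁ δ) (min (η₁ / (L + 1)) (W₀ / 2 / (L + 1))) := by positivity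
      linarith
    · have : min (min η₁ δ) (min (η₁ / (L + 1)) (W₀ / 2 / (L + 1))) ≤ W₀ / 2 / (L + 1) :=
        (min_le_right _ _).trans (min_le_right _ _)
      rw [le_div_iff₀ (by positivity)] at this
      linarith
  have hself : |h₀ - h₀| ≤ δ := by simpa using hδ.le
  have hpos : ∀ h w, 0 < h → p.frontStrain φ h w = p.frontStrain φ h W₀ := by
    intro h w hh; simp [frontStrain, hh]
  have hneg : ∀ h w, ¬ 0 < h → p.frontStrain φ h w = w := by
    intro h w hh; simp [frontStrain, hh]
  have hclose : ∀ h w, |h - h₀| ≤ η → |w - W₀| ≤ η →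
      |p.frontStrain φ h w - W₀| ≤ η₁ ∧ |p.frontStrain φ h w - W₀| ≤ (L + 1) * η := by
    intro h w hh hw
    by_cases h0 : 0 < h
    · have := hLip h h₀ (hh.trans i2) hself
      rw [hs] at this
      rw [hpos h w h0]
      have h2 := mul_le_mul_of_nonneg_left hh hL
      exact ⟨by linarith, by linarith⟩
    · rw [hneg h w h0]
      have := mul_nonneg hL hη.le
      exact ⟨hw.trans i1, by linarith⟩
  have hzero : ∀ W, p.backStrain 0 W = 0 := by intro W; simp [backStrain]
  obtain ⟨M, hM⟩ : ∃ M, M = |h₀| + η := ⟨_, rfl⟩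
  have hM0 : 0 ≤ M := by rw [hM]; positivity
  have hhM : ∀ h, |h - h₀| ≤ η → |h| ≤ M := by
    intro h hh
    have := abs_add_le (h - h₀) h₀
    rw [sub_add_cancel] at this
    linarith
  -- For averaged strains of opposite signs the comparison passes through `h = 0`, where the strain
  -- behind vanishes for every strain ahead; there `|h| + |h'| = h - h'`. So `w` and `w'` drop out.
  have hmixed : ∀ h w h' w', |h - h₀| ≤ η → |w - W₀| ≤ η → |h' - h₀| ≤ η →
      |w' - W₀| ≤ η → 0 ≤ h → h' ≤ 0 →
        |p.backStrain h (p.frontStrain φ h w) - p.backStrain h' (p.frontStrain φ h' w')| ≤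
          K * |h - h'| := by
    intro h w h' w' hh hw hh' hw' h0 h0'
    have hz : |0 - h₀| ≤ η₁ := by
      rw [abs_le] at hh hh' ⊢
      constructor <;> linarith [hh.1, hh.2, hh'.1, hh'.2]
    have j1 := hB h _ 0 _ (hh.trans i1) (hclose h w hh hw).1 hz (hclose h w hh hw).1
    have j2 := hB h' _ 0 _ (hh'.trans i1) (hclose h' w' hh' hw').1 hz (hclose h' w' hh' hw').1
    rw [hzero] at j1 j2
    simp only [sub_zero, sub_self, abs_zero, mul_zero, add_zero] at j1 j2
    have := abs_sub (p.backStrain h (p.frontStrain φ h w))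
      (p.backStrain h' (p.frontStrain φ h' w'))
    rw [abs_of_nonneg h0] at j1
    rw [abs_of_nonpos h0'] at j2
    rw [abs_of_nonneg (by linarith : 0 ≤ h - h')]
    linarith
  refine ⟨η, hη, K + K * M * L, by positivity, fun h w h' w' hh hw hh' hw' => ⟨?_, ?_⟩⟩
  · have := (abs_le.1 (hclose h w hh hw).2).1
    linarith
  · have hKM : 0 ≤ K * M * L := by positivity
    have t1 : 0 ≤ (K + K * M * L) * max (-h) 0 * |w - w'| := by positivity
    by_cases h0 : 0 < h
    · by_cases h0' : 0 < h'
      · have j := hB h _ h' _ (hh.trans i1) (hclose h w hh hw).1 (hh'.trans i1)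
          (hclose h' w' hh' hw').1
        have j2 := hLip h h' (hh.trans i2) (hh'.trans i2)
        rw [← hpos h w h0, ← hpos h' w' h0'] at j2
        have j3 : K * |h| * |p.frontStrain φ h w - p.frontStrain φ h' w'| ≤
            K * M * (L * |h - h'|) := by
          gcongr
          exact hhM h hh
        linarith
      · have := hmixed h w h' w' hh hw hh' hw' h0.le (not_lt.1 h0')
        have : 0 ≤ K * M * L * |h - h'| := by positivity
        linarith
    · by_cases h0' : 0 < h'
      · have := hmixed h' w' h w hh' hw' hh hw h0'.le (not_lt.1 h0)
        rw [abs_sub_comm, abs_sub_comm h'] at this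
        have : 0 ≤ K * M * L * |h - h'| := by positivity
        linarith
      · have j := hB h _ h' _ (hh.trans i1) (hclose h w hh hw).1 (hh'.trans i1)
          (hclose h' w' hh' hw').1
        rw [max_eq_left (by linarith : 0 ≤ -h), ← abs_of_nonpos (not_lt.1 h0)]
        rw [hneg h w h0, hneg h' w' h0'] at j ⊢
        have t2 : 0 ≤ K * M * L * |h - h'| := by positivity
        have t3 : 0 ≤ K * M * L * |h| * |w - w'| := by positivity
        linarith

end Material

/-! ### The local Riemann solver in terms of incoming and outgoing invariants. -/

/-- The state with Riemann invariants `v - c w = r` and `v + c w = l`. -/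
noncomputable def ofInvariants (c r l : ℝ) : State := ((r + l) / 2, (l - r) / (2 * c))

lemma ofInvariants_left {c : ℝ} (hc : c ≠ 0) (r l : ℝ) :
    (ofInvariants c r l).1 - c * (ofInvariants c r l).2 = r := by
  simp only [ofInvariants]; field_simp; ring

lemma ofInvariants_right {c : ℝ} (hc : c ≠ 0) (r l : ℝ) :
    (ofInvariants c r l).1 + c * (ofInvariants c r l).2 = l := by
  simp only [ofInvariants]; field_simp; ring

lemma ofInvariants_eq {c : ℝ} (hc : c ≠ 0) (u : State) :
    ofInvariants c (u.1 - c * u.2) (u.1 + c * u.2) = u := by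
  ext
  · simp only [ofInvariants]; ring
  · simp only [ofInvariants]; field_simp; ring

lemma eq_ofInvariants {c r l : ℝ} (hc : c ≠ 0) {u : State} (h : u.1 - c * u.2 = r)
    (h' : u.1 + c * u.2 = l) : u = ofInvariants c r l := by
  rw [← h, ← h', ofInvariants_eq hc]

lemma norm_ofInvariants_sub_le {c : ℝ} (hc : 0 < c) (r l r' l' : ℝ) :
    ‖ofInvariants c r l - ofInvariants c r' l'‖ ≤
      (1 / 2 + 1 / (2 * c)) * (|r - r'| + |l - l'|) := by
  have h0 : 0 ≤ 1 / (2 * c) * (|r - r'| + |l - l'|) := by positivity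
  have h0' : 0 ≤ |r - r'| + |l - l'| := by positivity
  rw [add_mul]
  refine max_le ?_ ?_
  · have e : (ofInvariants c r l - ofInvariants c r' l').1 = 1 / 2 * ((r - r') + (l - l')) := by
      simp only [ofInvariants, Prod.fst_sub]; ring
    rw [e, Real.norm_eq_abs, abs_mul, abs_of_pos (by norm_num : (0 : ℝ) < 1 / 2)]
    linarith [abs_add_le (r - r') (l - l')]
  · have e : (ofInvariants c r l - ofInvariants c r' l').2 =
        1 / (2 * c) * ((l - l') - (r - r')) := by
      simp only [ofInvariants, Prod.snd_sub]; field_simp; ring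
    rw [e, Real.norm_eq_abs, abs_mul, abs_of_pos (by positivity : (0 : ℝ) < 1 / (2 * c))]
    have := mul_le_mul_of_nonneg_left (abs_sub (l - l') (r - r'))
      (by positivity : (0 : ℝ) ≤ 1 / (2 * c))
    linarith

namespace Material

variable (p : Material) (φ : ℝ → ℝ)

/-- The averaged strain of the data `r`, `q` coming into a phase boundary. -/
noncomputable def gap (r q : ℝ) : ℝ := (q - r) / (p.c₁ + p.c₃)

/-- The strain ahead of the phase boundary with data `r` on the left, `q`, `s` on the right. -/
noncomputable def ahead (r q s : ℝ) : ℝ := p.frontStrain φ (p.gap r q) ((q - s) / (2 * p.c₃))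

/-- The outgoing invariant behind the phase boundary. -/
noncomputable def outLeft (r q s : ℝ) : ℝ :=
  r + 2 * p.c₁ * p.backStrain (p.gap r q) (p.ahead φ r q s)

/-- The outgoing invariant ahead of a subsonic phase boundary. -/
noncomputable def outRight (w₀ r q : ℝ) : ℝ := q - 2 * p.c₃ * p.frontStrain φ (p.gap r q) w₀

/-- The speed of the phase boundary. -/
noncomputable def speed (r q s : ℝ) : ℝ := p.frontSpeed (p.gap r q) (p.ahead φ r q s)

/-- The waves of the Riemann solution in a single phase with sound speed `c`. -/
noncomputable def contactWaves (c r r' l' : ℝ) : List (ℝ × State) :=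
  [(-c, ofInvariants c r l'), (c, ofInvariants c r' l')]

/-- The waves of the Riemann solution containing the phase boundary. -/
noncomputable def frontWaves (w₀ r q s : ℝ) : List (ℝ × State) :=
  if 0 < p.gap r q then
    [(-p.c₁, ofInvariants p.c₁ r (p.outLeft φ r q s)),
      (p.speed φ r q s, ofInvariants p.c₃ (p.outRight φ w₀ r q) q), (p.c₃, ofInvariants p.c₃ s q)]
  else
    [(-p.c₁, ofInvariants p.c₁ r (p.outLeft φ r q s)),
      (p.speed φ r q s, ofInvariants p.c₃ s q)]

/-- The solution of all Riemann problems whose invariants are `δ`-close to those of a given phase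
boundary. -/
structure IsLocalSolver (w₀ r₀ l₀ q₀ s₀ δ L : ℝ) : Prop where
  pos : 0 < δ
  one_le : 1 ≤ L
  lip_left : ∀ r q s r' q' s', |r - r₀| ≤ δ → |q - q₀| ≤ δ → |s - s₀| ≤ δ → |r' - r₀| ≤ δ →
    |q' - q₀| ≤ δ → |s' - s₀| ≤ δ → |p.outLeft φ r q s - p.outLeft φ r' q' s'| ≤
      L * (|r - r'| + |q - q'|) + L * max (-p.gap r q) 0 * |s - s'|
  lip_right : ∀ r q r' q', |r - r₀| ≤ δ → |q - q₀| ≤ δ → |r' - r₀| ≤ δ → |q' - q₀| ≤ δ →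
    |p.outRight φ w₀ r q - p.outRight φ w₀ r' q'| ≤ L * (|r - r'| + |q - q'|)
  out_left : p.outLeft φ r₀ q₀ s₀ = l₀
  out_right : p.outRight φ w₀ r₀ q₀ = s₀
  subsonic : ∀ r q s, |r - r₀| ≤ δ → |q - q₀| ≤ δ → |s - s₀| ≤ δ → 0 < p.gap r q →
    p.speed φ r q s ∈ Ioo (-p.c₃) p.c₃
  supersonic : ∀ r q s, |r - r₀| ≤ δ → |q - q₀| ≤ δ → |s - s₀| ≤ δ → p.gap r q ≤ 0 →
    p.speed φ r q s ∈ Ico p.c₃ p.c₁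
  mem_left : ∀ r l, |r - r₀| ≤ δ → |l - l₀| ≤ δ → ofInvariants p.c₁ r l ∈ p.H₁
  mem_right : ∀ q s, |q - q₀| ≤ δ → |s - s₀| ≤ δ → ofInvariants p.c₃ s q ∈ p.H₃
  riemann_left : ∀ r l r' l', |r - r₀| ≤ δ → |l - l₀| ≤ δ → |r' - r₀| ≤ δ → |l' - l₀| ≤ δ →
    ∀ R, IsRiemannSolution p φ (ofInvariants p.c₁ r l) (ofInvariants p.c₁ r' l') R ↔
      R = fan (ofInvariants p.c₁ r l) (contactWaves p.c₁ r r' l')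
  riemann_right : ∀ q s q' s', |q - q₀| ≤ δ → |s - s₀| ≤ δ → |q' - q₀| ≤ δ → |s' - s₀| ≤ δ →
    ∀ R, IsRiemannSolution p φ (ofInvariants p.c₃ s q) (ofInvariants p.c₃ s' q') R ↔
      R = fan (ofInvariants p.c₃ s q) (contactWaves p.c₃ s s' q')
  riemann_front : ∀ r l q s, |r - r₀| ≤ δ → |l - l₀| ≤ δ → |q - q₀| ≤ δ → |s - s₀| ≤ δ →
    ∀ R, IsRiemannSolution p φ (ofInvariants p.c₁ r l) (ofInvariants p.c₃ s q) R ↔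
      R = fan (ofInvariants p.c₁ r l) (p.frontWaves φ w₀ r q s)

variable {p φ}

/-- The contact of speed `-c₁` keeps `v - c₁ w` and that of speed `c₁` keeps `v + c₁ w`, which
determines the middle state. Its strain is the averaged strain, so `hs` rules out nucleation. -/
lemma riemann_left_iff {r l r' l' : ℝ} (h : ofInvariants p.c₁ r l ∈ p.H₁)
    (h' : ofInvariants p.c₁ r' l' ∈ p.H₁) (hs : ofInvariants p.c₁ r l' ∈ p.H₁) (R : ℝ → State) :
    IsRiemannSolution p φ (ofInvariants p.c₁ r l) (ofInvariants p.c₁ r' l') R ↔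
      R = fan (ofInvariants p.c₁ r l) (contactWaves p.c₁ r r' l') := by
  have hc := p.c₁_pos.ne'
  have havg : p.avgStrain (ofInvariants p.c₁ r l) (ofInvariants p.c₁ r' l') =
      (ofInvariants p.c₁ r l').2 := by
    rw [p.avgStrain_left h h', ofInvariants_left hc, ofInvariants_right hc]; rfl
  have st := fun {u : State} (hu : u ∈ p.H₁) => p.stress_of_le hu.2
  constructor
  · intro H
    cases H with
    | stay₁ us hL hR hh hs h1 h2 =>
      rw [p.rankineHugoniot_neg_sound (st hL) (st hs), ofInvariants_left hc] at h1
      rw [p.rankineHugoniot_sound (st hs) (st hR), ofInvariants_right hc] at h2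
      rw [eq_ofInvariants hc h1 h2]; rfl
    | stay₃ us hL => exact (p.disjoint_phases h hL).elim
    | nucleate₁ u1 u2 u3 V' V hL hR hh => rw [havg] at hh; exact (hh.not_ge hs.2).elim
    | nucleate₃ u1 u2 u3 V' V hL => exact (p.disjoint_phases h hL).elim
    | sub₁₃ um up V hL hR => exact (p.disjoint_phases h' hR).elim
    | super₁₃ um V hL hR => exact (p.disjoint_phases h' hR).elim
    | sub₃₁ um up V hL => exact (p.disjoint_phases h hL).elim
    | super₃₁ up V hL => exact (p.disjoint_phases h hL).elim
  · rintro rfl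
    refine .stay₁ (ofInvariants p.c₁ r l') h h' (by rw [havg]; exact hs) hs ?_ ?_
    · rw [p.rankineHugoniot_neg_sound (st h) (st hs), ofInvariants_left hc, ofInvariants_left hc]
    · rw [p.rankineHugoniot_sound (st hs) (st h'), ofInvariants_right hc, ofInvariants_right hc]

lemma riemann_right_iff {q s q' s' : ℝ} (h : ofInvariants p.c₃ s q ∈ p.H₃)
    (h' : ofInvariants p.c₃ s' q' ∈ p.H₃) (hs : ofInvariants p.c₃ s q' ∈ p.H₃) (R : ℝ → State) :
    IsRiemannSolution p φ (ofInvariants p.c₃ s q) (ofInvariants p.c₃ s' q') R ↔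
      R = fan (ofInvariants p.c₃ s q) (contactWaves p.c₃ s s' q') := by
  have hc := p.c₃_pos.ne'
  have havg : p.avgStrain (ofInvariants p.c₃ s q) (ofInvariants p.c₃ s' q') =
      (ofInvariants p.c₃ s q').2 := by
    rw [p.avgStrain_right h h', ofInvariants_left hc, ofInvariants_right hc]; rfl
  have st := fun {u : State} (hu : u ∈ p.H₃) => p.stress_of_ge (show p.wm ≤ u.2 from hu)
  constructor
  · intro H
    cases H with
    | stay₃ us hL hR hh hs h1 h2 =>
      rw [p.rankineHugoniot_neg_sound (st hL) (st hs), ofInvariants_left hc] at h1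
      rw [p.rankineHugoniot_sound (st hs) (st hR), ofInvariants_right hc] at h2
      rw [eq_ofInvariants hc h1 h2]; rfl
    | stay₁ us hL => exact (p.disjoint_phases hL h).elim
    | nucleate₃ u1 u2 u3 V' V hL hR hh => rw [havg] at hh; exact (hh.not_ge hs).elim
    | nucleate₁ u1 u2 u3 V' V hL => exact (p.disjoint_phases hL h).elim
    | sub₁₃ um up V hL hR => exact (p.disjoint_phases hL h).elim
    | super₁₃ um V hL hR => exact (p.disjoint_phases hL h).elim
    | sub₃₁ um up V hL hR => exact (p.disjoint_phases hR h').elim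
    | super₃₁ up V hL hR => exact (p.disjoint_phases hR h').elim
  · rintro rfl
    refine .stay₃ (ofInvariants p.c₃ s q') h h' (by rw [havg]; exact hs) hs ?_ ?_
    · rw [p.rankineHugoniot_neg_sound (st h) (st hs), ofInvariants_left hc, ofInvariants_left hc]
    · rw [p.rankineHugoniot_sound (st hs) (st h'), ofInvariants_right hc, ofInvariants_right hc]

lemma gap_eq (r q : ℝ) : (p.c₁ + p.c₃) * p.gap r q = q - r := by
  have : p.c₁ + p.c₃ ≠ 0 := (add_pos p.c₁_pos p.c₃_pos).ne'
  rw [gap]; field_simp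

lemma outLeft_strain (r q s : ℝ) :
    (ofInvariants p.c₁ r (p.outLeft φ r q s)).2 =
      p.backStrain (p.gap r q) (p.ahead φ r q s) := by
  have := p.c₁_pos.ne'
  simp only [ofInvariants, outLeft]; field_simp; ring

lemma outRight_strain (w₀ r q : ℝ) :
    (ofInvariants p.c₃ (p.outRight φ w₀ r q) q).2 = p.frontStrain φ (p.gap r q) w₀ := by
  have := p.c₃_pos.ne'
  simp only [ofInvariants, outRight]; field_simp; ring

lemma ahead_of_pos {r q : ℝ} (h : 0 < p.gap r q) (s w : ℝ) :
    p.ahead φ r q s = p.frontStrain φ (p.gap r q) w := by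
  simp [ahead, frontStrain, h]

lemma ahead_of_nonpos {r q : ℝ} (h : p.gap r q ≤ 0) (s : ℝ) :
    p.ahead φ r q s = (ofInvariants p.c₃ s q).2 := by
  simp [ahead, frontStrain, h.not_gt, ofInvariants]

lemma speed_of_pos (hφ : p.IsDissipationFunction φ) {r q : ℝ} (h : 0 < p.gap r q) (s : ℝ) :
    IsSubsonic p φ (p.gap r q) (p.speed φ r q s) (p.backStrain (p.gap r q) (p.ahead φ r q s))
      (p.ahead φ r q s) := by
  obtain ⟨V, wl, S⟩ := hφ.isSubsonic h
  have e : p.ahead φ r q s = subStrain p φ (p.gap r q) := by simp [ahead, frontStrain, h]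
  rw [speed, e]
  have h31 := p.c₃_lt_c₁
  obtain ⟨e1, e2, -, -⟩ := speed_eq S.right_pos (by linarith [S.speed.2]) (by linarith [S.speed.1])
    S.right_eq S.left_eq
  rw [← e1, ← e2]
  exact S

/-- The contacts transmit `r` and `q` to the boundary, so its states and speed solve the two linear
relations for the averaged strain `gap r q`. For positive gap uniqueness is `IsSubsonic.unique`; for
nonpositive gap the right state is known and the relations are solved explicitly. -/
lemma riemann_front_iff (hφ : p.IsDissipationFunction φ) (w₀ : ℝ) {r l q s : ℝ}
    (h : ofInvariants p.c₁ r l ∈ p.H₁) (h' : ofInvariants p.c₃ s q ∈ p.H₃)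
    (hm : ofInvariants p.c₁ r (p.outLeft φ r q s) ∈ p.H₁) (R : ℝ → State) :
    IsRiemannSolution p φ (ofInvariants p.c₁ r l) (ofInvariants p.c₃ s q) R ↔
      R = fan (ofInvariants p.c₁ r l) (p.frontWaves φ w₀ r q s) := by
  have hc := p.c₁_pos.ne'
  have hc' := p.c₃_pos.ne'
  have h3 := p.c₃_pos
  have h31 := p.c₃_lt_c₁
  have havg : p.avgStrain (ofInvariants p.c₁ r l) (ofInvariants p.c₃ s q) = p.gap r q := by
    rw [p.avgStrain_front h h', ofInvariants_left hc, ofInvariants_right hc']; rfl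
  have st := fun {u : State} (hu : u ∈ p.H₁) => p.stress_of_le hu.2
  have st' := fun {u : State} (hu : u ∈ p.H₃) => p.stress_of_ge (show p.wm ≤ u.2 from hu)
  constructor
  · intro H
    cases H with
    | stay₁ us hL hR => exact (p.disjoint_phases hR h').elim
    | stay₃ us hL => exact (p.disjoint_phases h hL).elim
    | nucleate₁ u1 u2 u3 V' V hL hR => exact (p.disjoint_phases hR h').elim
    | nucleate₃ u1 u2 u3 V' V hL => exact (p.disjoint_phases h hL).elim
    | sub₃₁ um up V hL => exact (p.disjoint_phases h hL).elim
    | super₃₁ up V hL => exact (p.disjoint_phases h hL).elim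
    | sub₁₃ um up V hL hR hh hm hp hV h1 h2 h3 hk =>
      rw [havg] at hh
      rw [p.rankineHugoniot_neg_sound (st hL) (st hm), ofInvariants_left hc] at h1
      rw [p.rankineHugoniot_sound (st' hp) (st' hR), ofInvariants_right hc'] at h3
      obtain ⟨e1, e2⟩ := (p.rankineHugoniot_iff (h := p.gap r q) hm.2 hp (by
        rw [h1, h3, gap_eq])).1 h2
      have hk' : -p.dissipation um.2 up.2 ∈ kineticGraph φ V := by
        rcases hk with ⟨-, -, hk⟩ | ⟨hk, -, -⟩
        · exact hk
        · exact (p.disjoint_phases hm hk).elim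
      rw [p.neg_dissipation hm.2 hp] at hk'
      have S : IsSubsonic p φ (p.gap r q) V um.2 up.2 := ⟨hV, e1, e2, hm.2, hp, hk'⟩
      obtain ⟨i1, i2, i3⟩ := S.unique hφ (speed_of_pos hφ hh s)
      have j1 : um = ofInvariants p.c₁ r (p.outLeft φ r q s) := by
        refine eq_ofInvariants hc h1 ?_
        rw [outLeft, ← i2]; linarith
      have j2 : up = ofInvariants p.c₃ (p.outRight φ w₀ r q) q := by
        refine eq_ofInvariants hc' ?_ h3
        rw [outRight, ← ahead_of_pos hh s, ← i3]; linarith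
      rw [j1, j2, i1, frontWaves, if_pos hh]
    | super₁₃ um V hL hR hh hm hV h1 h2 =>
      rw [havg] at hh
      rw [p.rankineHugoniot_neg_sound (st hL) (st hm), ofInvariants_left hc] at h1
      obtain ⟨e1, e2⟩ := (p.rankineHugoniot_iff (h := p.gap r q) hm.2 hR (by
        rw [h1, ofInvariants_right hc', gap_eq])).1 h2
      have hW : 0 < (ofInvariants p.c₃ s q).2 := p.wm_pos.trans_le hR
      obtain ⟨i1, i2, -, -⟩ := speed_eq hW hV.2 (by linarith [hV.1]) e1 e2
      rw [← ahead_of_nonpos (φ := φ) hh] at i1 i2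
      have j1 : um = ofInvariants p.c₁ r (p.outLeft φ r q s) := by
        refine eq_ofInvariants hc h1 ?_
        rw [outLeft, ← i2]; linarith
      have j2 : V = p.speed φ r q s := i1
      rw [j1, j2, frontWaves, if_neg hh.not_gt]
  · rintro rfl
    have k1 : p.RankineHugoniot (-p.c₁) (ofInvariants p.c₁ r l)
        (ofInvariants p.c₁ r (p.outLeft φ r q s)) := by
      rw [p.rankineHugoniot_neg_sound (st h) (st hm), ofInvariants_left hc, ofInvariants_left hc]
    by_cases hh : 0 < p.gap r q
    · have S := speed_of_pos hφ hh s
      have hp : ofInvariants p.c₃ (p.outRight φ w₀ r q) q ∈ p.H₃ := by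
        change p.wm ≤ _
        rw [outRight_strain, ← ahead_of_pos hh s]
        exact S.le_right
      rw [frontWaves, if_pos hh]
      refine .sub₁₃ _ _ _ h h' (by rw [havg]; exact hh) hm hp S.speed k1 ?_ ?_ (Or.inl ⟨hm, hp, ?_⟩)
      · rw [p.rankineHugoniot_iff (h := p.gap r q) hm.2 hp (by
          rw [gap_eq, ofInvariants_left hc, ofInvariants_right hc']), outLeft_strain,
          outRight_strain, ← ahead_of_pos hh s]
        exact ⟨S.right_eq, S.left_eq⟩
      · rw [p.rankineHugoniot_sound (st' hp) (st' h'), ofInvariants_right hc',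
          ofInvariants_right hc']
      · rw [p.neg_dissipation hm.2 hp, outLeft_strain, outRight_strain, ← ahead_of_pos hh s]
        exact S.kinetic
    · have hh' := not_lt.1 hh
      have hW : 0 < (ofInvariants p.c₃ s q).2 := p.wm_pos.trans_le h'
      have hV := frontSpeed_mem (p := p) hW hh'
      have e := ahead_of_nonpos (φ := φ) hh' s
      rw [frontWaves, if_neg hh]
      refine .super₁₃ _ _ h h' (by rw [havg]; exact hh') hm (by rw [speed, e]; exact hV) k1 ?_
      rw [p.rankineHugoniot_iff (h := p.gap r q) hm.2 h' (by
          rw [gap_eq, ofInvariants_left hc, ofInvariants_right hc']), outLeft_strain, speed, e]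
      refine speed_eqs (by linarith) ?_
      have : 0 ≤ p.c₁ * (-p.gap r q) := mul_nonneg p.c₁_pos.le (by linarith)
      have : 0 < (p.c₁ + p.c₃) * (ofInvariants p.c₃ s q).2 := mul_pos (by linarith) hW
      linarith

/-- The strict inequalities on the unperturbed strains leave room in both phases. On a small enough
neighbourhood the Lipschitz bounds then hold and emitted states stay admissible. -/
theorem exists_isLocalSolver (hφ : p.IsDissipationFunction φ) {uL uR : State} {V : ℝ}
    (hL : uL ∈ p.H₁) (hR : uR ∈ p.H₃) (hL' : uL.2 < p.wM) (hR' : p.wm < uR.2)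
    (hstar : IsRiemannSolution p φ uL uR (fan uL [(V, uR)]))
    (hchar : V = p.c₃ → uL.2 = 0 ∧ uR.2 = Real.sqrt (p.slopeAtSound φ / p.c₃)) :
    ∃ δ L, IsLocalSolver p φ uR.2 (uL.1 - p.c₁ * uL.2) (uL.1 + p.c₁ * uL.2)
      (uR.1 + p.c₃ * uR.2) (uR.1 - p.c₃ * uR.2) δ L := by
  have hc := p.c₁_pos
  have hc' := p.c₃_pos
  have h31 := p.c₃_lt_c₁
  obtain ⟨hs, hb, hp1, hp2, δ₁, hδ₁, L₁, hL₁, hLip₁⟩ :=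
    exists_lipschitz_frontStrain hφ hL hR hstar hchar
  have hRpos : 0 < uR.2 := p.wm_pos.trans hR'
  obtain ⟨η, hη, K, hK, hB⟩ := exists_lipschitz_backStrain_frontStrain hRpos hp2 hs hδ₁ hL₁ hLip₁
  obtain ⟨r₀, hr₀⟩ : ∃ r, r = uL.1 - p.c₁ * uL.2 := ⟨_, rfl⟩
  obtain ⟨l₀, hl₀⟩ : ∃ r, r = uL.1 + p.c₁ * uL.2 := ⟨_, rfl⟩
  obtain ⟨q₀, hq₀⟩ : ∃ r, r = uR.1 + p.c₃ * uR.2 := ⟨_, rfl⟩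
  obtain ⟨s₀, hs₀⟩ : ∃ r, r = uR.1 - p.c₃ * uR.2 := ⟨_, rfl⟩
  have hgap : p.avgStrain uL uR = p.gap r₀ q₀ := by
    rw [p.avgStrain_front hL hR, hr₀, hq₀]; rfl
  rw [hgap] at hs hb hp1 hp2 hLip₁ hB
  rw [← hr₀, ← hl₀, ← hq₀, ← hs₀]
  have hw₀ : (q₀ - s₀) / (2 * p.c₃) = uR.2 := by
    rw [hq₀, hs₀]; field_simp; ring
  have hout : p.outLeft φ r₀ q₀ s₀ = l₀ := by
    rw [outLeft, ahead, hw₀, hs, ← hb, hr₀, hl₀]; ring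
  have hgapd : ∀ r q r' q', |p.gap r q - p.gap r' q'| ≤
      1 / (p.c₁ + p.c₃) * (|r - r'| + |q - q'|) := by
    intro r q r' q'
    have e : p.gap r q - p.gap r' q' = 1 / (p.c₁ + p.c₃) * ((q - q') - (r - r')) := by
      rw [gap, gap]; ring
    rw [e, abs_mul, abs_of_pos (by positivity)]
    refine mul_le_mul_of_nonneg_left ?_ (by positivity)
    linarith [abs_sub (q - q') (r - r')]
  have hwd : ∀ q s q' s', |(q - s) / (2 * p.c₃) - (q' - s') / (2 * p.c₃)| ≤
      1 / (2 * p.c₃) * (|q - q'| + |s - s'|) := by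
    intro q s q' s'
    have e : (q - s) / (2 * p.c₃) - (q' - s') / (2 * p.c₃) =
      1 / (2 * p.c₃) * ((q - q') - (s - s')) := by ring
    rw [e, abs_mul, abs_of_pos (by positivity)]
    exact mul_le_mul_of_nonneg_left (abs_sub _ _) (by positivity)
  obtain ⟨e₀, he₀⟩ : ∃ e, e = 1 / (p.c₁ + p.c₃) := ⟨_, rfl⟩
  obtain ⟨e₃, he₃⟩ : ∃ e, e = 1 / (2 * p.c₃) := ⟨_, rfl⟩
  have he₀pos : 0 < e₀ := by rw [he₀]; positivity
  have he₃pos : 0 < e₃ := by rw [he₃]; positivity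
  rw [← he₀] at hgapd
  rw [← he₃] at hwd
  -- Bounds `max (-gap) 0` on the whole neighbourhood.
  obtain ⟨G, hG⟩ : ∃ G, G = |p.gap r₀ q₀| + δ₁ := ⟨_, rfl⟩
  have hG0 : 0 ≤ G := by rw [hG]; positivity
  obtain ⟨L, hLdef⟩ : ∃ L, L = 1 + 2 * p.c₁ * (K * e₀ + K * G * e₃) + 2 * p.c₁ * (K * e₃) +
    (2 * p.c₃ * (L₁ * e₀)) := ⟨_, rfl⟩
  have t1 : 0 ≤ 2 * p.c₁ * (K * e₀ + K * G * e₃) := by positivity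
  have t2 : 0 ≤ 2 * p.c₁ * (K * e₃) := by positivity
  have t3 : 0 ≤ 2 * p.c₃ * (L₁ * e₀) := by positivity
  have hL1 : 1 ≤ L := by rw [hLdef]; linarith
  obtain ⟨δp, hδp, m1, m2⟩ : ∃ δp > 0, (∀ r l, |r - r₀| ≤ δp → |l - l₀| ≤ δp →
      ofInvariants p.c₁ r l ∈ p.H₁) ∧ (∀ q s, |q - q₀| ≤ δp → |s - s₀| ≤ δp →
      ofInvariants p.c₃ s q ∈ p.H₃) := by
    have a1 : 0 < uL.2 + 1 := by linarith [hL.1]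
    have a2 : 0 < p.wM - uL.2 := by linarith
    have a3 : 0 < uR.2 - p.wm := by linarith
    refine ⟨min (p.c₁ * min ((uL.2 + 1) / 2) (p.wM - uL.2)) (p.c₃ * (uR.2 - p.wm)),
      lt_min (mul_pos hc (lt_min (by linarith) a2)) (mul_pos hc' a3), fun r l hr hl => ?_,
      fun q s hq hs => ?_⟩
    · have b1 : p.c₁ * min ((uL.2 + 1) / 2) (p.wM - uL.2) ≤ p.c₁ * ((uL.2 + 1) / 2) :=
        mul_le_mul_of_nonneg_left (min_le_left _ _) hc.le
      have b2 : p.c₁ * min ((uL.2 + 1) / 2) (p.wM - uL.2) ≤ p.c₁ * (p.wM - uL.2) :=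
        mul_le_mul_of_nonneg_left (min_le_right _ _) hc.le
      have hr' := abs_le.1 (hr.trans (min_le_left _ _))
      have hl' := abs_le.1 (hl.trans (min_le_left _ _))
      have e : l - r = 2 * p.c₁ * uL.2 + ((l - l₀) - (r - r₀)) := by rw [hl₀, hr₀]; ring
      have b3 : 0 < p.c₁ * (uL.2 + 1) := mul_pos hc a1
      constructor
      · change -1 < (l - r) / (2 * p.c₁)
        rw [lt_div_iff₀ (by positivity), e]
        linarith [hr'.2, hl'.1]
      · change (l - r) / (2 * p.c₁) ≤ p.wM
        rw [div_le_iff₀ (by positivity), e]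
        linarith [hr'.1, hl'.2]
    · have hq' := abs_le.1 (hq.trans (min_le_right _ _))
      have hs' := abs_le.1 (hs.trans (min_le_right _ _))
      have e : q - s = 2 * p.c₃ * uR.2 + ((q - q₀) - (s - s₀)) := by rw [hq₀, hs₀]; ring
      change p.wm ≤ (q - s) / (2 * p.c₃)
      rw [le_div_iff₀ (by positivity), e]
      linarith [hq'.1, hs'.2]
  -- `d1` keeps the data in their phases, `d2` the emitted left state in phase 1; `d3` and `d5`
  -- bring averaged strain and right strain into the domain of `hB`, and `d4` the averaged strain
  -- into that of `hLip₁`.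
  obtain ⟨δ, hδ, d1, d2, d3, d4, d5⟩ : ∃ δ > 0, δ ≤ δp ∧ L * (2 + G) * δ ≤ δp ∧
      2 * e₀ * δ ≤ η ∧ 2 * e₀ * δ ≤ δ₁ ∧ 2 * e₃ * δ ≤ η := by
    refine ⟨min (min δp (δp / (L * (2 + G)))) (min (min (η / (2 * e₀)) (δ₁ / (2 * e₀)))
      (η / (2 * e₃))), by positivity, ?_, ?_, ?_, ?_, ?_⟩
    · exact (min_le_left _ _).trans (min_le_left _ _)
    · rw [← le_div_iff₀' (by positivity)]
      exact (min_le_left _ _).trans (min_le_right _ _)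
    · rw [← le_div_iff₀' (by positivity)]
      exact (min_le_right _ _).trans ((min_le_left _ _).trans (min_le_left _ _))
    · rw [← le_div_iff₀' (by positivity)]
      exact (min_le_right _ _).trans ((min_le_left _ _).trans (min_le_right _ _))
    · rw [← le_div_iff₀' (by positivity)]
      exact (min_le_right _ _).trans (min_le_right _ _)
  have hself : ∀ x : ℝ, |x - x| ≤ δ := fun x => by simpa using hδ.le
  have hgapn : ∀ r q, |r - r₀| ≤ δ → |q - q₀| ≤ δ → |p.gap r q - p.gap r₀ q₀| ≤ 2 * e₀ * δ := by
    intro r q hr hq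
    refine (hgapd r q r₀ q₀).trans ?_
    have := mul_le_mul_of_nonneg_left (add_le_add hr hq) he₀pos.le
    linarith
  have hwn : ∀ q s, |q - q₀| ≤ δ → |s - s₀| ≤ δ → |(q - s) / (2 * p.c₃) - uR.2| ≤ η := by
    intro q s hq hs
    rw [← hw₀]
    refine (hwd q s q₀ s₀).trans ?_
    have := mul_le_mul_of_nonneg_left (add_le_add hq hs) he₃pos.le
    linarith
  have hmaxG : ∀ r q, |r - r₀| ≤ δ → |q - q₀| ≤ δ → max (-p.gap r q) 0 ≤ G := by
    intro r q hr hq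
    have i1 := (abs_le.1 (hgapn r q hr hq)).1
    have i2 := neg_abs_le (p.gap r₀ q₀)
    exact max_le (by rw [hG]; linarith) hG0
  have hlip : ∀ r q s r' q' s', |r - r₀| ≤ δ → |q - q₀| ≤ δ → |s - s₀| ≤ δ → |r' - r₀| ≤ δ →
      |q' - q₀| ≤ δ → |s' - s₀| ≤ δ → |p.outLeft φ r q s - p.outLeft φ r' q' s'| ≤
        L * (|r - r'| + |q - q'|) + L * max (-p.gap r q) 0 * |s - s'| := by
    intro r q s r' q' s' hr hq hs hr' hq' hs'
    have j1 := (hB _ _ _ _ ((hgapn r q hr hq).trans d3) (hwn q s hq hs)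
      ((hgapn r' q' hr' hq').trans d3) (hwn q' s' hq' hs')).2
    have hmx : 0 ≤ max (-p.gap r q) 0 := le_max_right _ _
    obtain ⟨M, hM⟩ : ∃ M, M = max (-p.gap r q) 0 := ⟨_, rfl⟩
    have hMG := hmaxG r q hr hq
    rw [← hM] at j1 hMG hmx ⊢
    have j2 : |p.outLeft φ r q s - p.outLeft φ r' q' s'| ≤ |r - r'| + 2 * p.c₁ *
        |p.backStrain (p.gap r q) (p.ahead φ r q s) -
          p.backStrain (p.gap r' q') (p.ahead φ r' q' s')| := by
      have e : p.outLeft φ r q s - p.outLeft φ r' q' s' = (r - r') + 2 * p.c₁ *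
        (p.backStrain (p.gap r q) (p.ahead φ r q s) -
          p.backStrain (p.gap r' q') (p.ahead φ r' q' s')) := by
        rw [outLeft, outLeft]; ring
      rw [e]
      refine (abs_add_le _ _).trans_eq ?_
      rw [abs_mul, abs_of_pos (by positivity : 0 < 2 * p.c₁)]
    have j3 : K * |p.gap r q - p.gap r' q'| ≤ K * (e₀ * (|r - r'| + |q - q'|)) :=
      mul_le_mul_of_nonneg_left (hgapd r q r' q') hK
    have j4 : K * M * |(q - s) / (2 * p.c₃) - (q' - s') / (2 * p.c₃)| ≤
        K * M * (e₃ * (|q - q'| + |s - s'|)) :=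
      mul_le_mul_of_nonneg_left (hwd q s q' s') (mul_nonneg hK hmx)
    have j5 : K * M * (e₃ * |q - q'|) ≤ K * G * (e₃ * |q - q'|) := by gcongr
    have j6 := mul_le_mul_of_nonneg_left (j1.trans (add_le_add j3 j4))
      (by positivity : 0 ≤ 2 * p.c₁)
    have j7 := mul_le_mul_of_nonneg_left j5 (by positivity : 0 ≤ 2 * p.c₁)
    have k1 : 0 ≤ 2 * p.c₁ * (K * G * e₃) * |r - r'| := by positivity
    have k2 : 0 ≤ 2 * p.c₁ * (K * e₃) * (|r - r'| + |q - q'|) := by positivity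
    have k3 : 0 ≤ 2 * p.c₃ * (L₁ * e₀) * (|r - r'| + |q - q'|) := by positivity
    have k4 : 0 ≤ (1 + 2 * p.c₁ * (K * e₀ + K * G * e₃) + (2 * p.c₃ * (L₁ * e₀))) *
      (M * |s - s'|) := by positivity
    have k5 := abs_nonneg (q - q')
    rw [hLdef]
    unfold ahead at j2
    linarith
  refine ⟨δ, L, hδ, hL1, hlip, ?_, hout, ?_, ?_, ?_, ?_, ?_, ?_, ?_, ?_⟩
  · intro r q r' q' hr hq hr' hq'
    have j1 := hLip₁ _ _ ((hgapn r q hr hq).trans d4) ((hgapn r' q' hr' hq').trans d4)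
    have j2 := mul_le_mul_of_nonneg_left (j1.trans (mul_le_mul_of_nonneg_left
      (hgapd r q r' q') hL₁)) (by positivity : 0 ≤ 2 * p.c₃)
    have e : p.outRight φ uR.2 r q - p.outRight φ uR.2 r' q' = (q - q') - 2 * p.c₃ *
        (p.frontStrain φ (p.gap r q) uR.2 - p.frontStrain φ (p.gap r' q') uR.2) := by
      rw [outRight, outRight]; ring
    rw [e]
    refine (abs_sub _ _).trans ?_
    rw [abs_mul, abs_of_pos (by positivity : 0 < 2 * p.c₃)]
    have k1 : 0 ≤ (2 * p.c₁ * (K * e₀ + K * G * e₃) + 2 * p.c₁ * (K * e₃)) *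
      (|r - r'| + |q - q'|) := by positivity
    have k2 := abs_nonneg (r - r')
    rw [hLdef]
    linarith
  · rw [outRight, hs, hq₀, hs₀]; ring
  · intro r q s hr hq hs hpos
    exact (speed_of_pos hφ hpos s).speed
  · intro r q s hr hq hs hneg
    rw [speed, ahead_of_nonpos hneg]
    exact frontSpeed_mem (p.wm_pos.trans_le (m2 q s (hq.trans d1) (hs.trans d1))) hneg
  · exact fun r l hr hl => m1 r l (hr.trans d1) (hl.trans d1)
  · exact fun q s hq hs => m2 q s (hq.trans d1) (hs.trans d1)
  · intro r l r' l' hr hl hr' hl' R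
    exact riemann_left_iff (m1 _ _ (hr.trans d1) (hl.trans d1))
      (m1 _ _ (hr'.trans d1) (hl'.trans d1)) (m1 _ _ (hr.trans d1) (hl'.trans d1)) R
  · intro q s q' s' hq hs hq' hs' R
    exact riemann_right_iff (m2 _ _ (hq.trans d1) (hs.trans d1))
      (m2 _ _ (hq'.trans d1) (hs'.trans d1)) (m2 _ _ (hq'.trans d1) (hs.trans d1)) R
  · intro r l q s hr hl hq hs R
    refine riemann_front_iff hφ uR.2 (m1 _ _ (hr.trans d1) (hl.trans d1))
      (m2 _ _ (hq.trans d1) (hs.trans d1)) (m1 _ _ (hr.trans d1) ?_) R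
    have j := hlip r q s r₀ q₀ s₀ hr hq hs (hself _) (hself _) (hself _)
    rw [hout] at j
    have hmx : 0 ≤ max (-p.gap r q) 0 := le_max_right _ _
    have j2 : L * (|r - r₀| + |q - q₀|) ≤ L * (δ + δ) := by gcongr
    have j3 : L * max (-p.gap r q) 0 * |s - s₀| ≤ L * G * δ := by
      gcongr
      exact hmaxG r q hr hq
    linarith

end Material

/-! ### Sequences of bounded variation -/

/-- The sequence `x, f 0, f 1, …`. -/
def consSeq (x : ℝ) (f : ℕ → ℝ) : ℕ → ℝ
  | 0 => x
  | n + 1 => f n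

/-- The sequence `f 1, f 2, …`. -/
def tailSeq (f : ℕ → ℝ) : ℕ → ℝ := fun n => f (n + 1)

@[simp] lemma consSeq_zero (x : ℝ) (f : ℕ → ℝ) : consSeq x f 0 = x := rfl
@[simp] lemma consSeq_succ (x : ℝ) (f : ℕ → ℝ) (n : ℕ) : consSeq x f (n + 1) = f n := rfl
@[simp] lemma tailSeq_apply (f : ℕ → ℝ) (n : ℕ) : tailSeq f n = f (n + 1) := rfl

/-- The variation of the sequence `f` is at most `t`. -/
def HasVariation (f : ℕ → ℝ) (t : ℝ) : Prop :=
  ∀ n, ∑ i ∈ Finset.range n, |f i - f (i + 1)| ≤ t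

lemma HasVariation.nonneg {f : ℕ → ℝ} {t : ℝ} (h : HasVariation f t) : 0 ≤ t := by
  simpa using h 0

/-- Removing an entry refunds exactly its jump, and `HasVariation.cons` charges exactly the new one.
This exchange is the accounting of the Glimm functional. -/
lemma HasVariation.tail {f : ℕ → ℝ} {t : ℝ} (h : HasVariation f t) :
    HasVariation (tailSeq f) (t - |f 0 - f 1|) := by
  intro n
  have := h (n + 1)
  rw [Finset.sum_range_succ'] at this
  simp only [zero_add] at this
  simp only [tailSeq_apply]
  linarith

lemma HasVariation.cons {f : ℕ → ℝ} {t : ℝ} (h : HasVariation f t) (x : ℝ) :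
    HasVariation (consSeq x f) (t + |x - f 0|) := by
  intro n
  cases n with
  | zero => simpa using add_nonneg h.nonneg (abs_nonneg (x - f 0))
  | succ n =>
    rw [Finset.sum_range_succ']
    simp only [consSeq_succ, consSeq_zero]
    linarith [h n]

/-! ### The evolution of the invariants -/

/-- The Riemann invariants of a piecewise constant function, with the phase boundary at `b`;
the sequences on both sides are indexed by the distance to the phase boundary. -/
structure Config where
  b : ℤ
  r : ℕ → ℝ
  l : ℕ → ℝ
  q : ℕ → ℝ
  s : ℕ → ℝ

namespace Config

variable (p : Material) (φ : ℝ → ℝ) (w₀ : ℝ)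

/-- The speed of the phase boundary. -/
noncomputable def speed (c : Config) : ℝ := p.speed φ (c.r 0) (c.q 0) (c.s 0)

/-- The invariant emitted on the left. -/
noncomputable def outLeft (c : Config) : ℝ := p.outLeft φ (c.r 0) (c.q 0) (c.s 0)

/-- The invariant emitted on the right. -/
noncomputable def outRight (c : Config) : ℝ := p.outRight φ w₀ (c.r 0) (c.q 0)

/-- The averaged strain at the phase boundary. -/
noncomputable def gap (c : Config) : ℝ := p.gap (c.r 0) (c.q 0)

/-- One step of Glimm's scheme, sampled at the speed `ξ`. -/
noncomputable def step (ξ : ℝ) (c : Config) : Config :=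
  if ξ ≤ c.speed p φ then
    ⟨c.b + 1, c.r, if ξ ≤ -p.c₁ then c.l else consSeq (c.outLeft p φ) c.l,
      if ξ ≤ -p.c₃ then c.q else tailSeq c.q, if ξ ≤ p.c₃ then c.s else tailSeq c.s⟩
  else
    ⟨c.b - 1, if ξ ≤ p.c₁ then tailSeq c.r else c.r, c.l, c.q,
      if ξ ≤ p.c₃ then consSeq (c.outRight p φ w₀) c.s else c.s⟩

/-- The invariants of `c` are close to `r₀`, `l₀`, `q₀`, `s₀`. -/
structure IsNear (r₀ l₀ q₀ s₀ D L A : ℝ) (c : Config) : Prop where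
  r : ∀ k, |c.r k - r₀| ≤ D
  q : ∀ k, |c.q k - q₀| ≤ D
  s : ∀ k, |c.s k - s₀| ≤ 2 * L * D
  l : ∀ k, |c.l k - l₀| ≤ A * D

/-- The Glimm functional of `c` is at most `P`. -/
def HasPotential (L P : ℝ) (c : Config) : Prop :=
  ∃ tr tl tq ts, HasVariation c.r tr ∧ HasVariation c.l tl ∧ HasVariation c.q tq ∧
    HasVariation c.s ts ∧ tl + |c.outLeft p φ - c.l 0| +
      (2 * L + L / (p.c₁ + p.c₃)) * (tr + tq) + ts + |c.outRight p φ w₀ - c.s 0| +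
      L * max (-c.gap p) 0 * ts ≤ P

variable {p φ w₀} {r₀ l₀ q₀ s₀ δ L D A P : ℝ}

/-- The factor by which the outgoing invariants may deviate more than the incoming ones. -/
noncomputable def outFactor (p : Material) (r₀ q₀ L : ℝ) : ℝ :=
  2 * L + 2 * L ^ 2 * max (-p.gap r₀ q₀) 0

section

variable (S : p.IsLocalSolver φ w₀ r₀ l₀ q₀ s₀ δ L) (hA : A = outFactor p r₀ q₀ L)
  (hD : A * D ≤ δ)

include hA

lemma two_mul_le_outFactor : 2 * L ≤ A := by
  rw [hA, outFactor]
  have : 0 ≤ 2 * L ^ 2 * max (-p.gap r₀ q₀) 0 := by positivity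
  linarith

include S hD

lemma IsNear.le {c : Config} (hc : c.IsNear r₀ l₀ q₀ s₀ D L A) :
    0 ≤ D ∧ D ≤ δ ∧ 2 * L * D ≤ δ := by
  have h0 : 0 ≤ D := (abs_nonneg _).trans (hc.r 0)
  have h1 := mul_le_mul_of_nonneg_right (two_mul_le_outFactor hA) h0
  have h2 := mul_le_mul_of_nonneg_right S.one_le h0
  exact ⟨h0, by linarith, by linarith⟩

lemma IsNear.near {c : Config} (hc : c.IsNear r₀ l₀ q₀ s₀ D L A) :
    (∀ k, |c.r k - r₀| ≤ δ) ∧ (∀ k, |c.q k - q₀| ≤ δ) ∧ (∀ k, |c.s k - s₀| ≤ δ) ∧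
      ∀ k, |c.l k - l₀| ≤ δ := by
  obtain ⟨h0, h1, h2⟩ := hc.le S hA hD
  exact ⟨fun k => (hc.r k).trans h1, fun k => (hc.q k).trans h1, fun k => (hc.s k).trans h2,
    fun k => (hc.l k).trans hD⟩

/-- The radii follow the order of dependence: `s` is computed from `r, q`, giving `L (D + D)`; `l`
from `r, q, s`, giving `2 L D` plus the weight `L max (-gap r₀ q₀) 0` times `2 L D`. This is the
origin of `outFactor`. -/
lemma IsNear.out_near {c : Config} (hc : c.IsNear r₀ l₀ q₀ s₀ D L A) :
    |c.outLeft p φ - l₀| ≤ A * D ∧ |c.outRight p φ w₀ - s₀| ≤ 2 * L * D := by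
  obtain ⟨h0, h1, h2⟩ := hc.le S hA hD
  obtain ⟨n1, n2, n3, n4⟩ := hc.near S hA hD
  have hself : ∀ x : ℝ, |x - x| ≤ δ := fun x => by simpa using S.pos.le
  have hL : 0 ≤ L := by linarith [S.one_le]
  constructor
  · have j := S.lip_left r₀ q₀ s₀ _ _ _ (hself _) (hself _) (hself _) (n1 0) (n2 0) (n3 0)
    rw [S.out_left, abs_sub_comm l₀, abs_sub_comm r₀, abs_sub_comm q₀, abs_sub_comm s₀] at j
    have j1 := mul_le_mul_of_nonneg_left (add_le_add (hc.r 0) (hc.q 0)) hL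
    have j2 := mul_le_mul_of_nonneg_left (hc.s 0)
      (by positivity : 0 ≤ L * max (-p.gap r₀ q₀) 0)
    rw [hA, outFactor]
    unfold outLeft
    linarith
  · have j := S.lip_right r₀ q₀ _ _ (hself _) (hself _) (n1 0) (n2 0)
    rw [S.out_right, abs_sub_comm s₀, abs_sub_comm r₀, abs_sub_comm q₀] at j
    have j1 := mul_le_mul_of_nonneg_left (add_le_add (hc.r 0) (hc.q 0)) hL
    unfold outRight
    linarith

/-- Sequences only lose entries or gain emitted ones, whose radius depends on those of the incoming
invariants alone. The bounds therefore persist with the same constants. -/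
lemma IsNear.step {c : Config} (hc : c.IsNear r₀ l₀ q₀ s₀ D L A) (ξ : ℝ) :
    (c.step p φ w₀ ξ).IsNear r₀ l₀ q₀ s₀ D L A := by
  obtain ⟨h1, h2⟩ := hc.out_near S hA hD
  have hcons : ∀ {x : ℝ} {f : ℕ → ℝ} {x₀ B : ℝ}, |x - x₀| ≤ B → (∀ k, |f k - x₀| ≤ B) →
      ∀ k, |consSeq x f k - x₀| ≤ B := by
    intro x f x₀ B hx hf k
    cases k with
    | zero => exact hx
    | succ k => exact hf k
  unfold Config.step
  split_ifs <;> constructor <;> first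
    | exact hc.r | exact hc.q | exact hc.s | exact hc.l
    | exact fun k => hc.r (k + 1) | exact fun k => hc.q (k + 1) | exact fun k => hc.s (k + 1)
    | exact hcons h1 hc.l | exact hcons h2 hc.s

/-- Of the weight on `tr + tq`, one `L` pays for the change of `outLeft`, one for that of
`outRight`, and `L/(c₁ + c₃)` for the change of `gap` in the interaction term. Overtaken jumps of
`s` are paid by the interaction term (effect on `outLeft`) and by `ts` (effect on the jump of
`outRight` to `s`). -/
lemma HasPotential.step {c : Config} (hc : c.IsNear r₀ l₀ q₀ s₀ D L A)
    (hP : c.HasPotential p φ w₀ L P) (hP1 : P ≤ 1) (ξ : ℝ) :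
    (c.step p φ w₀ ξ).HasPotential p φ w₀ L P := by
  have hc1 := p.c₁_pos
  have hc3 := p.c₃_pos
  have h31 := p.c₃_lt_c₁
  obtain ⟨n1, n2, n3, n4⟩ := hc.near S hA hD
  obtain ⟨tr, tl, tq, ts, vr, vl, vq, vs, hpot⟩ := hP
  have hL : 0 ≤ L := by linarith [S.one_le]
  have hgapd : ∀ r q r' q', max (-p.gap r' q') 0 ≤
      max (-p.gap r q) 0 + 1 / (p.c₁ + p.c₃) * (|r - r'| + |q - q'|) := by
    intro r q r' q'
    have e : -p.gap r' q' = -p.gap r q + 1 / (p.c₁ + p.c₃) * ((q - q') - (r - r')) := by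
      rw [Material.gap, Material.gap]; ring
    have h1 : 1 / (p.c₁ + p.c₃) * ((q - q') - (r - r')) ≤
        1 / (p.c₁ + p.c₃) * (|r - r'| + |q - q'|) := by
      refine mul_le_mul_of_nonneg_left ?_ (by positivity)
      linarith [le_abs_self (q - q'), neg_abs_le (r - r')]
    refine max_le ?_ (by positivity)
    rw [e]
    linarith [le_max_left (-p.gap r q) 0]
  obtain ⟨e₀, he₀⟩ : ∃ e, e = 1 / (p.c₁ + p.c₃) := ⟨_, rfl⟩
  have he₀' : L / (p.c₁ + p.c₃) = L * e₀ := by rw [he₀]; ring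
  have he₀pos : 0 ≤ e₀ := by rw [he₀]; positivity
  rw [← he₀] at hgapd
  unfold HasPotential
  rw [he₀'] at hpot ⊢
  have k1 := vr.nonneg
  have k2 := vl.nonneg
  have k3 := vq.nonneg
  have k4 := vs.nonneg
  have hM0 : 0 ≤ L * max (-c.gap p) 0 := mul_nonneg hL (le_max_right _ _)
  have hM : 0 ≤ L * max (-c.gap p) 0 * ts := mul_nonneg hM0 k4
  have a1 := abs_nonneg (c.outLeft p φ - c.l 0)
  have a2 := abs_nonneg (c.outRight p φ w₀ - c.s 0)
  have hKpos : 0 ≤ (2 * L + L * e₀) * (tr + tq) := by positivity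
  -- The change of the interaction term is quadratic, a change of `gap` times `ts`; the bound by `1`
  -- makes it linear.
  have hts : ts + |c.outRight p φ w₀ - c.s 0| ≤ 1 := by linarith
  unfold Config.step
  split_ifs with h1 h2 h3 h4 h5 h6 h7 h8 h9 h10 h11
  · exact ⟨tr, tl, tq, ts, vr, vl, vq, vs, hpot⟩
  · linarith
  · linarith
  · linarith
  -- Nothing is absorbed: the jump to the emitted `l` is merely moved from the pending term into the
  -- variation of `l`.
  · refine ⟨tr, _, tq, ts, vr, vl.cons _, vq, vs, ?_⟩
    change _ + |c.outLeft p φ - c.outLeft p φ| + _ + _ + |c.outRight p φ w₀ - _| +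
      L * max (-c.gap p) 0 * _ ≤ _
    rw [sub_self, abs_zero]
    linarith
  · linarith
  · -- the first incoming invariant on the right is absorbed
    refine ⟨tr, _, _, ts, vr, vl.cons _, vq.tail, vs, ?_⟩
    have i1 := S.lip_left _ _ _ _ _ _ (n1 0) (n2 0) (n3 0) (n1 0) (n2 1) (n3 0)
    have i2 := S.lip_right _ _ _ _ (n1 0) (n2 0) (n1 0) (n2 1)
    have i3 := hgapd (c.r 0) (c.q 0) (c.r 0) (c.q 1)
    simp only [sub_self, abs_zero, zero_add, mul_zero, add_zero] at i1 i2 i3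
    have i4 := mul_le_mul_of_nonneg_left i3 (mul_nonneg hL k4)
    have i5 := mul_le_mul_of_nonneg_left (show ts ≤ 1 by linarith)
      (by positivity : 0 ≤ L * (e₀ * |c.q 0 - c.q 1|))
    have i6 := abs_sub_le (p.outRight φ w₀ (c.r 0) (c.q 1)) (p.outRight φ w₀ (c.r 0) (c.q 0))
      (c.s 0)
    rw [abs_sub_comm] at i2
    rw [abs_sub_comm] at i1
    simp only [outLeft, outRight, gap, consSeq_zero, tailSeq_apply, zero_add] at *
    linarith
  -- The sample lies beyond `c₃` and before the front: the supersonic boundary overtakes a jump of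
  -- `s` as well.
  · refine ⟨tr, _, _, _, vr, vl.cons _, vq.tail, vs.tail, ?_⟩
    have i1 := S.lip_left _ _ _ _ _ _ (n1 0) (n2 0) (n3 0) (n1 0) (n2 1) (n3 1)
    have i2 := S.lip_right _ _ _ _ (n1 0) (n2 0) (n1 0) (n2 1)
    have i3 := hgapd (c.r 0) (c.q 0) (c.r 0) (c.q 1)
    simp only [sub_self, abs_zero, zero_add] at i1 i2 i3
    have k5 := vs.tail.nonneg
    have i4 := mul_le_mul_of_nonneg_left i3 (mul_nonneg hL k5)
    have k6 := abs_nonneg (c.s 0 - c.s 1)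
    have i5 := mul_le_mul_of_nonneg_left (show ts - |c.s 0 - c.s 1| ≤ 1 by linarith)
      (by positivity : 0 ≤ L * (e₀ * |c.q 0 - c.q 1|))
    have i6 := abs_sub_le (p.outRight φ w₀ (c.r 0) (c.q 1)) (p.outRight φ w₀ (c.r 0) (c.q 0))
      (c.s 1)
    have i7 := abs_sub_le (p.outRight φ w₀ (c.r 0) (c.q 0)) (c.s 0) (c.s 1)
    rw [abs_sub_comm] at i2
    rw [abs_sub_comm] at i1
    simp only [outLeft, outRight, gap, consSeq_zero, tailSeq_apply, zero_add] at *
    linarith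
  · -- the first incoming invariant on the left is absorbed
    -- A sample after the front but not beyond `c₃` is impossible for a supersonic front.
    have hpos : 0 < p.gap (c.r 0) (c.q 0) := by
      by_contra! hneg
      have := (S.supersonic _ _ _ (n1 0) (n2 0) (n3 0) hneg).1
      unfold Config.speed at h1
      linarith
    have hmx : max (-p.gap (c.r 0) (c.q 0)) 0 = 0 := max_eq_right (by linarith)
    refine ⟨_, tl, tq, _, vr.tail, vl, vq, vs.cons _, ?_⟩
    have hnout : |p.outRight φ w₀ (c.r 0) (c.q 0) - s₀| ≤ δ :=
      (hc.out_near S hA hD).2.trans (hc.le S hA hD).2.2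
    have i1 := S.lip_left _ _ _ _ _ _ (n1 0) (n2 0) (n3 0) (n1 1) (n2 0) hnout
    have i2 := S.lip_right _ _ _ _ (n1 0) (n2 0) (n1 1) (n2 0)
    have i3 := hgapd (c.r 0) (c.q 0) (c.r 1) (c.q 0)
    -- The gap before the step is positive, so replacing `s 0` by the emitted value costs nothing in
    -- `outLeft`. A negative gap after the step is at most the absorbed jump of `r` times `e₀`.
    rw [hmx] at i1 i3
    simp only [sub_self, abs_zero, zero_add, mul_zero, add_zero, zero_mul] at i1 i2 i3
    have i4 := mul_le_mul_of_nonneg_left i3 (mul_nonneg hL (vs.cons (c.outRight p φ w₀)).nonneg)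
    have i5 := mul_le_mul_of_nonneg_left hts (by positivity : 0 ≤ L * (e₀ * |c.r 0 - c.r 1|))
    have i6 := abs_sub_le (p.outLeft φ (c.r 1) (c.q 0) (p.outRight φ w₀ (c.r 0) (c.q 0)))
      (p.outLeft φ (c.r 0) (c.q 0) (c.s 0)) (c.l 0)
    rw [abs_sub_comm] at i1
    rw [abs_sub_comm] at i2
    simp only [outLeft, outRight, gap, consSeq_zero, tailSeq_apply, zero_add] at *
    linarith
  -- The sample lies in `(c₃, c₁]`, right of any emitted `s`: only `r` changes.
  · refine ⟨_, tl, tq, ts, vr.tail, vl, vq, vs, ?_⟩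
    have i1 := S.lip_left _ _ _ _ _ _ (n1 0) (n2 0) (n3 0) (n1 1) (n2 0) (n3 0)
    have i2 := S.lip_right _ _ _ _ (n1 0) (n2 0) (n1 1) (n2 0)
    have i3 := hgapd (c.r 0) (c.q 0) (c.r 1) (c.q 0)
    simp only [sub_self, abs_zero, mul_zero, add_zero] at i1 i2 i3
    have i4 := mul_le_mul_of_nonneg_left i3 (mul_nonneg hL k4)
    have i5 := mul_le_mul_of_nonneg_left (show ts ≤ 1 by linarith)
      (by positivity : 0 ≤ L * (e₀ * |c.r 0 - c.r 1|))
    have i6 := abs_sub_le (p.outLeft φ (c.r 1) (c.q 0) (c.s 0))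
      (p.outLeft φ (c.r 0) (c.q 0) (c.s 0)) (c.l 0)
    rw [abs_sub_comm] at i1
    have i7 := abs_sub_le (p.outRight φ w₀ (c.r 1) (c.q 0)) (p.outRight φ w₀ (c.r 0) (c.q 0))
      (c.s 0)
    rw [abs_sub_comm] at i2
    simp only [outLeft, outRight, gap, tailSeq_apply, zero_add] at *
    linarith
  · linarith
  · exact ⟨tr, tl, tq, ts, vr, vl, vq, vs, hpot⟩

end

end Config


/-! ### Realization of the configurations as grid functions. -/

namespace Config

variable (p : Material) (φ : ℝ → ℝ) (w₀ : ℝ)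

/-- The state in the cell with left end point `m`. -/
noncomputable def cell (c : Config) (m : ℤ) : State :=
  if m < c.b then
    ofInvariants p.c₁ (c.r ((c.b - 2 - m) / 2).toNat) (c.l ((c.b - 2 - m) / 2).toNat)
  else
    ofInvariants p.c₃ (c.s ((m - c.b) / 2).toNat) (c.q ((m - c.b) / 2).toNat)

/-- The waves issued from the grid point `j`. -/
noncomputable def waves (c : Config) (j : ℤ) : List (ℝ × State) :=
  if j < c.b then
    contactWavesAt c ((c.b - 2 - j) / 2).toNat
  else if j = c.b then p.frontWaves φ w₀ (c.r 0) (c.q 0) (c.s 0)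
  else contactWavesAt' c ((j - c.b - 2) / 2).toNat
where
  contactWavesAt (c : Config) (k : ℕ) := Material.contactWaves p.c₁ (c.r (k + 1)) (c.r k) (c.l k)
  contactWavesAt' (c : Config) (k : ℕ) :=
    Material.contactWaves p.c₃ (c.s k) (c.s (k + 1)) (c.q (k + 1))

variable {p φ w₀}

lemma toNat_half (k : ℕ) : ((2 * (k : ℤ)) / 2).toNat = k := by simp

lemma cell_left (c : Config) (k : ℕ) :
    c.cell p (c.b - 2 - 2 * k) = ofInvariants p.c₁ (c.r k) (c.l k) := by
  rw [cell, if_pos (by omega), show c.b - 2 - (c.b - 2 - 2 * (k : ℤ)) = 2 * k by ring, toNat_half]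

lemma cell_right (c : Config) (k : ℕ) :
    c.cell p (c.b + 2 * k) = ofInvariants p.c₃ (c.s k) (c.q k) := by
  rw [cell, if_neg (by omega), show c.b + 2 * (k : ℤ) - c.b = 2 * k by ring, toNat_half]

lemma waves_left (c : Config) (k : ℕ) : c.waves p φ w₀ (c.b - 2 - 2 * k) =
    Material.contactWaves p.c₁ (c.r (k + 1)) (c.r k) (c.l k) := by
  rw [waves, if_pos (by omega), show c.b - 2 - (c.b - 2 - 2 * (k : ℤ)) = 2 * k by ring, toNat_half,
    waves.contactWavesAt]

lemma waves_front (c : Config) :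
    c.waves p φ w₀ c.b = p.frontWaves φ w₀ (c.r 0) (c.q 0) (c.s 0) := by
  rw [waves, if_neg (lt_irrefl _), if_pos rfl]

lemma waves_right (c : Config) (k : ℕ) : c.waves p φ w₀ (c.b + 2 + 2 * k) =
    Material.contactWaves p.c₃ (c.s k) (c.s (k + 1)) (c.q (k + 1)) := by
  rw [waves, if_neg (by omega), if_neg (by omega),
    show c.b + 2 + 2 * (k : ℤ) - c.b - 2 = 2 * k by ring, toNat_half, waves.contactWavesAt']

lemma grid_cases {b j : ℤ} (h : Even (j - b)) :
    (∃ k : ℕ, j = b - 2 - 2 * k) ∨ j = b ∨ ∃ k : ℕ, j = b + 2 + 2 * k := by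
  obtain ⟨i, hi⟩ := h
  rcases lt_trichotomy i 0 with h | h | h
  · exact Or.inl ⟨(-i - 1).toNat, by omega⟩
  · exact Or.inr (Or.inl (by omega))
  · exact Or.inr (Or.inr ⟨(i - 1).toNat, by omega⟩)

lemma cell_left' (c : Config) (k : ℕ) :
    c.cell p (c.b - 2 - 2 * k - 2) = ofInvariants p.c₁ (c.r (k + 1)) (c.l (k + 1)) := by
  rw [← cell_left]; congr 1; push_cast; ring

lemma cell_front_left (c : Config) :
    c.cell p (c.b - 2) = ofInvariants p.c₁ (c.r 0) (c.l 0) := by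
  rw [← cell_left]; congr 1; push_cast; ring

lemma cell_front_right (c : Config) : c.cell p c.b = ofInvariants p.c₃ (c.s 0) (c.q 0) := by
  rw [← cell_right]; congr 1; push_cast; ring

lemma cell_right' (c : Config) (k : ℕ) :
    c.cell p (c.b + 2 + 2 * k - 2) = ofInvariants p.c₃ (c.s k) (c.q k) := by
  rw [← cell_right]; congr 1; ring

lemma cell_right_succ (c : Config) (k : ℕ) :
    c.cell p (c.b + 2 + 2 * k) = ofInvariants p.c₃ (c.s (k + 1)) (c.q (k + 1)) := by
  rw [← cell_right]; congr 1; push_cast; ring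

/-- All wave speeds are at least `-c₁` and, in `IsNear.fan_waves_of_ge`, at most `c₁`. Together with
the CFL condition, neighbouring fans agree on the common edge of their cells. -/
lemma fan_waves_of_lt (c : Config) {j : ℤ} (hj : Even (j - c.b)) {ξ : ℝ} (hξ : ξ < -p.c₁) :
    fan (c.cell p (j - 2)) (c.waves p φ w₀ j) ξ = c.cell p (j - 2) := by
  have h31 := p.c₃_lt_c₁
  have h1 : ξ < -p.c₃ := by linarith
  rcases grid_cases hj with ⟨k, rfl⟩ | rfl | ⟨k, rfl⟩
  · simp [waves_left, Material.contactWaves, fan, hξ]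
  · rw [waves_front, Material.frontWaves]
    split_ifs <;> simp [fan, hξ]
  · simp [waves_right, Material.contactWaves, fan, h1]

variable {r₀ l₀ q₀ s₀ δ L D A P : ℝ}

section

variable (S : p.IsLocalSolver φ w₀ r₀ l₀ q₀ s₀ δ L) (hA : A = outFactor p r₀ q₀ L)
  (hD : A * D ≤ δ)

include S hA hD

lemma IsNear.speed {c : Config} (hc : c.IsNear r₀ l₀ q₀ s₀ D L A) :
    (0 < c.gap p → c.speed p φ ∈ Ioo (-p.c₃) p.c₃) ∧
      (c.gap p ≤ 0 → c.speed p φ ∈ Ico p.c₃ p.c₁) := by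
  obtain ⟨n1, n2, n3, n4⟩ := hc.near S hA hD
  exact ⟨S.subsonic _ _ _ (n1 0) (n2 0) (n3 0), S.supersonic _ _ _ (n1 0) (n2 0) (n3 0)⟩

lemma IsNear.speed_mem {c : Config} (hc : c.IsNear r₀ l₀ q₀ s₀ D L A) :
    c.speed p φ ∈ Ioo (-p.c₃) p.c₁ := by
  obtain ⟨h1, h2⟩ := hc.speed S hA hD
  have := p.c₃_pos
  have := p.c₃_lt_c₁
  rcases lt_or_ge 0 (c.gap p) with h | h
  · exact ⟨(h1 h).1, (h1 h).2.trans p.c₃_lt_c₁⟩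
  · exact ⟨by linarith [(h2 h).1], (h2 h).2⟩

/-- The sampled solution of the Riemann problems is given by `Config.step`. -/
lemma IsNear.cell_step {c : Config} (hc : c.IsNear r₀ l₀ q₀ s₀ D L A) (ξ : ℝ) {j : ℤ}
    (hj : Even (j - c.b)) : (c.step p φ w₀ ξ).cell p (j - 1) =
      leftFan (c.cell p (j - 2)) (c.waves p φ w₀ j) ξ := by
  obtain ⟨hV, hV'⟩ := hc.speed_mem S hA hD
  obtain ⟨hs1, hs2⟩ := hc.speed S hA hD
  have h3 := p.c₃_pos
  have h31 := p.c₃_lt_c₁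
  by_cases hξ : ξ ≤ c.speed p φ
  · have hb : (c.step p φ w₀ ξ).b = c.b + 1 := by simp [Config.step, hξ]
    have hr : (c.step p φ w₀ ξ).r = c.r := by simp [Config.step, hξ]
    have hl : (c.step p φ w₀ ξ).l = if ξ ≤ -p.c₁ then c.l else consSeq (c.outLeft p φ) c.l := by
      simp [Config.step, hξ]
    have hq : (c.step p φ w₀ ξ).q = if ξ ≤ -p.c₃ then c.q else tailSeq c.q := by simp [Config.step, hξ]
    have hs : (c.step p φ w₀ ξ).s = if ξ ≤ p.c₃ then c.s else tailSeq c.s := by simp [Config.step, hξ]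
    rcases grid_cases hj with ⟨k, rfl⟩ | rfl | ⟨k, rfl⟩
    -- The front has moved right, so the cell now around this grid point is one place further from
    -- it.
    · rw [waves_left, cell_left', show c.b - 2 - 2 * (k : ℤ) - 1 =
        (c.step p φ w₀ ξ).b - 2 - 2 * ((k + 1 : ℕ) : ℤ) by rw [hb]; push_cast; ring, cell_left, hr,
        hl]
      have : ξ ≤ p.c₁ := by linarith
      by_cases h1 : ξ ≤ -p.c₁ <;> simp [Material.contactWaves, leftFan, h1, this]
    · rw [waves_front, cell_front_left, show c.b - 1 = (c.step p φ w₀ ξ).b - 2 - 2 * ((0 : ℕ) : ℤ)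
        by rw [hb]; push_cast; ring, cell_left, hr, hl]
      have hξ' : ξ ≤ p.speed φ (c.r 0) (c.q 0) (c.s 0) := hξ
      by_cases h0 : 0 < p.gap (c.r 0) (c.q 0) <;>
        by_cases h1 : ξ ≤ -p.c₁ <;> simp [Material.frontWaves, leftFan, h1, hξ', h0, outLeft]
    · rw [waves_right, cell_right', show c.b + 2 + 2 * (k : ℤ) - 1 =
        (c.step p φ w₀ ξ).b + 2 * k by rw [hb]; ring, cell_right, hs, hq]
      by_cases h1 : ξ ≤ -p.c₃
      · have h2 : ξ ≤ p.c₃ := by linarith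
        simp [Material.contactWaves, leftFan, h1, h2]
      · by_cases h2 : ξ ≤ p.c₃ <;> simp [Material.contactWaves, leftFan, h1, h2]
  · have hb : (c.step p φ w₀ ξ).b = c.b - 1 := by simp [Config.step, hξ]
    have hr : (c.step p φ w₀ ξ).r = if ξ ≤ p.c₁ then tailSeq c.r else c.r := by simp [Config.step, hξ]
    have hl : (c.step p φ w₀ ξ).l = c.l := by simp [Config.step, hξ]
    have hq : (c.step p φ w₀ ξ).q = c.q := by simp [Config.step, hξ]
    have hs : (c.step p φ w₀ ξ).s = if ξ ≤ p.c₃ then consSeq (c.outRight p φ w₀) c.s else c.s := by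
      simp [Config.step, hξ]
    have g1 : ¬ ξ ≤ -p.c₁ := by linarith
    have g3 : ¬ ξ ≤ -p.c₃ := by linarith
    rcases grid_cases hj with ⟨k, rfl⟩ | rfl | ⟨k, rfl⟩
    -- The front has moved left and the distance index is `k` again; old right-hand values of `r`
    -- have become entry `k`, whence the tail.
    · rw [waves_left, cell_left', show c.b - 2 - 2 * (k : ℤ) - 1 =
        (c.step p φ w₀ ξ).b - 2 - 2 * k by rw [hb]; ring, cell_left, hr, hl]
      by_cases h1 : ξ ≤ p.c₁ <;> simp [Material.contactWaves, leftFan, g1, h1]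
    · rw [waves_front, cell_front_left, show c.b - 1 = (c.step p φ w₀ ξ).b + 2 * ((0 : ℕ) : ℤ)
        by rw [hb]; push_cast; ring, cell_right, hs, hq]
      have hξ' : ¬ ξ ≤ p.speed φ (c.r 0) (c.q 0) (c.s 0) := hξ
      by_cases h0 : 0 < p.gap (c.r 0) (c.q 0)
      · by_cases h1 : ξ ≤ p.c₃ <;> simp [Material.frontWaves, leftFan, g1, h1, hξ', h0, outRight]
      -- A supersonic front emits no `s`, and a sample behind it is indeed beyond `c₃`.
      · have h1 : ¬ ξ ≤ p.c₃ := by linarith [(hs2 (not_lt.1 h0)).1]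
        simp [Material.frontWaves, leftFan, g1, h1, hξ', h0]
    · rw [waves_right, cell_right', show c.b + 2 + 2 * (k : ℤ) - 1 =
        (c.step p φ w₀ ξ).b + 2 * ((k + 1 : ℕ) : ℤ) by rw [hb]; push_cast; ring, cell_right, hs, hq]
      by_cases h1 : ξ ≤ p.c₃ <;> simp [Material.contactWaves, leftFan, g3, h1]

lemma IsNear.fan_waves_of_ge {c : Config} (hc : c.IsNear r₀ l₀ q₀ s₀ D L A) {j : ℤ}
    (hj : Even (j - c.b)) {ξ : ℝ} (hξ : p.c₁ ≤ ξ) :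
    fan (c.cell p (j - 2)) (c.waves p φ w₀ j) ξ = c.cell p j := by
  have h3 := p.c₃_pos
  have h31 := p.c₃_lt_c₁
  have h1 : ¬ ξ < -p.c₁ := by linarith
  have h2 : ¬ ξ < -p.c₃ := by linarith
  have h4 : ¬ ξ < p.c₃ := by linarith
  rcases grid_cases hj with ⟨k, rfl⟩ | rfl | ⟨k, rfl⟩
  · simp [waves_left, Material.contactWaves, fan, h1, hξ.not_gt, cell_left]
  · have hV : ¬ ξ < p.speed φ (c.r 0) (c.q 0) (c.s 0) :=
      not_lt.2 ((hc.speed_mem S hA hD).2.le.trans hξ)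
    rw [waves_front, Material.frontWaves, cell_front_right]
    split_ifs <;> simp [fan, h1, h4, hV]
  · simp [waves_right, Material.contactWaves, fan, h2, h4, cell_right_succ]

lemma IsNear.riemann_iff {c : Config} (hc : c.IsNear r₀ l₀ q₀ s₀ D L A) {j : ℤ}
    (hj : Even (j - c.b)) (R : ℝ → State) :
    IsRiemannSolution p φ (c.cell p (j - 2)) (c.cell p j) R ↔
      R = fan (c.cell p (j - 2)) (c.waves p φ w₀ j) := by
  obtain ⟨n1, n2, n3, n4⟩ := hc.near S hA hD
  rcases grid_cases hj with ⟨k, rfl⟩ | rfl | ⟨k, rfl⟩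
  · rw [waves_left, cell_left', cell_left]
    exact S.riemann_left _ _ _ _ (n1 _) (n4 _) (n1 _) (n4 _) R
  · rw [waves_front, cell_front_left, cell_front_right]
    exact S.riemann_front _ _ _ _ (n1 _) (n4 _) (n2 _) (n3 _) R
  · rw [waves_right, cell_right', cell_right_succ]
    exact S.riemann_right _ _ _ _ (n2 _) (n3 _) (n2 _) (n3 _) R

end

/-- The configurations at the times `n τ`. -/
noncomputable def orbit (p : Material) (φ : ℝ → ℝ) (w₀ lam : ℝ) (a : ℕ → ℝ) (c : Config) :
    ℕ → Config
  | 0 => c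
  | n + 1 => (orbit p φ w₀ lam a c n).step p φ w₀ (a (n + 1) * lam)

lemma even_orbit (lam : ℝ) (a : ℕ → ℝ) (c : Config) (hc : c.b = 0) (n : ℕ) :
    Even ((n : ℤ) - (orbit p φ w₀ lam a c n).b) := by
  induction n with
  | zero => simp [orbit, hc]
  | succ n ih =>
    obtain ⟨k, hk⟩ := ih
    rw [orbit, step]
    by_cases h : a (n + 1) * lam ≤ speed p φ (orbit p φ w₀ lam a c n)
    · rw [if_pos h]
      exact ⟨k, by push_cast; linarith⟩
    · rw [if_neg h]
      exact ⟨k + 1, by push_cast; linarith⟩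

lemma even_sub_orbit (lam : ℝ) (a : ℕ → ℝ) (c : Config) (hc : c.b = 0) {n : ℕ} {m : ℤ}
    (h : Even (n + m)) : Even (m - (orbit p φ w₀ lam a c n).b) := by
  obtain ⟨i, hi⟩ := even_orbit (p := p) (φ := φ) (w₀ := w₀) lam a c hc n
  obtain ⟨k, hk⟩ := h
  exact ⟨k + i - n, by linarith⟩

/-- The function `u` is the solution by Glimm's scheme with configurations `C n`. -/
structure IsRealization (p : Material) (φ : ℝ → ℝ) (w₀ lam h : ℝ) (C : ℕ → Config)
    (u : ℝ → ℝ → State) : Prop where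
  cell : ∀ (n : ℕ) (m : ℤ), Even (n + m) → ∀ x ∈ Ico (m * h) ((m + 2) * h),
    u (n * (h / lam)) x = (C n).cell p m
  fan : ∀ (n : ℕ) (m : ℤ), Even (n + m) → ∀ t ∈ Ioo (n * (h / lam)) ((n + 1) * (h / lam)),
    ∀ x ∈ Ico ((m - 1) * h) ((m + 1) * h), u t x =
      fan ((C n).cell p (m - 2)) ((C n).waves p φ w₀ m) ((x - m * h) / (t - n * (h / lam)))

/-- The sampling point at distance `a h` from the source, after time `h / lam`, lies on the ray of
speed `a lam`. -/
lemma tendsto_sample (u₀ : State) (l : List (ℝ × State)) {lam h : ℝ} (hlam : 0 < lam) (hh : 0 < h)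
    (z a : ℝ) : Tendsto (fun y : ℝ => PhaseDyn.fan u₀ l ((y - z * h) / (h / lam)))
      (𝓝[<] ((z + a) * h)) (𝓝 (leftFan u₀ l (a * lam))) := by
  refine (tendsto_fan_left u₀ l (a * lam)).comp ?_
  have e : (((z + a) * h) - z * h) / (h / lam) = a * lam := by field_simp; ring
  refine tendsto_nhdsWithin_iff.2 ⟨?_, ?_⟩
  · have : Continuous fun y : ℝ => (y - z * h) / (h / lam) := by fun_prop
    have h2 := this.tendsto ((z + a) * h)
    rw [e] at h2
    exact h2.mono_left nhdsWithin_le_nhds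
  · filter_upwards [self_mem_nhdsWithin] with y hy
    rw [mem_Iio, ← e]
    exact div_lt_div_of_pos_right (sub_lt_sub_right hy _) (by positivity)

section

variable (S : p.IsLocalSolver φ w₀ r₀ l₀ q₀ s₀ δ L) (hA : A = outFactor p r₀ q₀ L)
  (hD : A * D ≤ δ)

include S hA hD

lemma IsNear.orbit {c : Config} (hc : c.IsNear r₀ l₀ q₀ s₀ D L A) (lam : ℝ) (a : ℕ → ℝ) (n : ℕ) :
    (orbit p φ w₀ lam a c n).IsNear r₀ l₀ q₀ s₀ D L A := by
  induction n with
  | zero => exact hc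
  | succ n ih => exact ih.step S hA hD _

lemma HasPotential.orbit {c : Config} (hc : c.IsNear r₀ l₀ q₀ s₀ D L A)
    (hP : c.HasPotential p φ w₀ L P) (hP1 : P ≤ 1) (lam : ℝ) (a : ℕ → ℝ) (n : ℕ) :
    (orbit p φ w₀ lam a c n).HasPotential p φ w₀ L P := by
  induction n with
  | zero => exact hP
  | succ n ih => exact ih.step S hA hD (hc.orbit S hA hD lam a n) hP1 _

/-- Induction on the time level: `riemann_iff` leaves one possible fan at each grid point, and
uniqueness of the sampled limit identifies the next cells with those of `Config.step`. No freedom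
remains in the approximation. -/
lemma IsNear.isRealization {c : Config} (hc : c.IsNear r₀ l₀ q₀ s₀ D L A) (hb : c.b = 0)
    {lam h : ℝ} (hlam : 0 < lam) (hh : 0 < h) {a : ℕ → ℝ} {u₀ : ℝ → State} {u : ℝ → ℝ → State}
    (hc₀ : ∀ m : ℤ, Even m →
      (1 / (2 * h)) • ∫ y in (m * h)..((m + 2) * h), u₀ y = c.cell p m)
    (H : IsGlimmApproximation p φ lam h a u₀ u) :
    IsRealization p φ w₀ lam h (Config.orbit p φ w₀ lam a c) u := by
  obtain ⟨R, h0, h1, h2⟩ := H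
  have hcell : ∀ (n : ℕ) (m : ℤ), Even (n + m) → ∀ x ∈ Ico (m * h) ((m + 2) * h),
      u (n * (h / lam)) x = (Config.orbit p φ w₀ lam a c n).cell p m := by
    intro n
    induction n with
    | zero =>
      intro m hm x hx
      have hm' : Even m := by simpa using hm
      simpa [Config.orbit] using (h0 m hm' x hx).trans (hc₀ m hm')
    | succ n ih =>
      intro m hm x hx
      have hm' : Even ((n : ℤ) + (m + 1)) := by
        obtain ⟨k, hk⟩ := hm
        exact ⟨k, by push_cast at hk; linarith⟩
      have hev := even_sub_orbit (p := p) (φ := φ) (w₀ := w₀) lam a c hb hm'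
      have hR := (h1 n (m + 1) hm').1
      have e1 : (((m + 1 : ℤ) : ℝ) - 1) * h = m * h := by push_cast; ring
      have n1 : Even ((n : ℤ) + (m - 1)) := by
        obtain ⟨k, hk⟩ := hm'
        exact ⟨k - 1, by linarith⟩
      rw [e1, ih (m - 1) n1 _ (by push_cast; constructor <;> nlinarith),
        ih (m + 1) hm' _ (by push_cast; constructor <;> nlinarith),
        show m - 1 = m + 1 - 2 by ring, (hc.orbit S hA hD lam a n).riemann_iff S hA hD hev] at hR
      have t1 := h2 n m (by push_cast at hm; exact hm) x hx
      rw [hR] at t1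
      have t2 := tendsto_sample ((Config.orbit p φ w₀ lam a c n).cell p (m + 1 - 2))
        ((Config.orbit p φ w₀ lam a c n).waves p φ w₀ (m + 1)) hlam hh (m + 1) (a (n + 1))
      have := tendsto_nhds_unique t1 t2
      push_cast
      rw [this, ← (hc.orbit S hA hD lam a n).cell_step S hA hD _ hev, Config.orbit,
        add_sub_cancel_right]
  refine ⟨hcell, fun n m hm t ht x hx => ?_⟩
  obtain ⟨hR, hu⟩ := h1 n m hm
  have hev := even_sub_orbit (p := p) (φ := φ) (w₀ := w₀) lam a c hb hm
  have n1 : Even ((n : ℤ) + (m - 2)) := by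
    obtain ⟨k, hk⟩ := hm
    exact ⟨k - 1, by linarith⟩
  rw [hcell n (m - 2) n1 _ (by push_cast; constructor <;> nlinarith),
    hcell n m hm _ (by constructor <;> nlinarith),
    (hc.orbit S hA hD lam a n).riemann_iff S hA hD hev] at hR
  rw [hu t ht x hx, hR]

lemma IsNear.exists_isGlimmApproximation {c : Config} (hc : c.IsNear r₀ l₀ q₀ s₀ D L A)
    (hb : c.b = 0) {lam h : ℝ} (hlam : 0 < lam) (hh : 0 < h) {a : ℕ → ℝ} {u₀ : ℝ → State}
    (hc₀ : ∀ m : ℤ, Even m →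
      (1 / (2 * h)) • ∫ y in (m * h)..((m + 2) * h), u₀ y = c.cell p m) :
    ∃ u, IsGlimmApproximation p φ lam h a u₀ u := by
  classical
  set C := Config.orbit p φ w₀ lam a c with hC
  have hτ : 0 < h / lam := by positivity
  -- the cell containing a point, and the grid point issuing the waves near a point
  let idx : ℕ → ℝ → ℤ := fun n x => 2 * ⌊(x / h - n) / 2⌋ + n
  have hidx : ∀ (n : ℕ) (m : ℤ), Even (n + m) → ∀ x ∈ Ico (m * h) ((m + 2) * h), idx n x = m := by
    intro n m hm x hx
    obtain ⟨k, hk⟩ := hm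
    have hm' : m = 2 * (k - n) + n := by linarith
    have : ⌊(x / h - n) / 2⌋ = k - n := by
      rw [Int.floor_eq_iff]
      have hmr : (m : ℝ) = 2 * (k - n) + n := by exact_mod_cast hm'
      have i1 : (m : ℝ) ≤ x / h := by rw [le_div_iff₀ hh]; exact hx.1
      have i2 : x / h < m + 2 := by rw [div_lt_iff₀ hh]; exact hx.2
      push_cast
      constructor <;> linarith
    simp only [idx, this]
    linarith
  let F : ℕ → ℤ → ℝ → State := fun n m => fan ((C n).cell p (m - 2)) ((C n).waves p φ w₀ m)
  -- Strictly inside strip `n`, the cell served by a grid point of level `n` is a cell of the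
  -- staggered grid of level `n + 1`; its midpoint is `idx (n + 1) x + 1`.
  let u : ℝ → ℝ → State := fun t x =>
    if t = ⌊t / (h / lam)⌋₊ * (h / lam) then
      (C ⌊t / (h / lam)⌋₊).cell p (idx ⌊t / (h / lam)⌋₊ x)
    else F ⌊t / (h / lam)⌋₊ (idx (⌊t / (h / lam)⌋₊ + 1) x + 1)
      ((x - (idx (⌊t / (h / lam)⌋₊ + 1) x + 1 : ℤ) * h) / (t - ⌊t / (h / lam)⌋₊ * (h / lam)))
  have hu : ∀ (n : ℕ) (m : ℤ), Even (n + m) → ∀ x ∈ Ico (m * h) ((m + 2) * h),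
      u (n * (h / lam)) x = (C n).cell p m := by
    intro n m hm x hx
    have : ⌊n * (h / lam) / (h / lam)⌋₊ = n := by
      rw [mul_div_assoc, div_self hτ.ne', mul_one, Nat.floor_natCast]
    simp only [u, this, if_true, hidx n m hm x hx]
  refine ⟨u, F, ?_, ?_, ?_⟩
  · intro m hm x hx
    have := hu 0 m (by simpa using hm) x hx
    rw [hc₀ m hm]
    simpa [hC, Config.orbit] using this
  · intro n m hm
    have hev := even_sub_orbit (p := p) (φ := φ) (w₀ := w₀) lam a c hb hm
    have n1 : Even ((n : ℤ) + (m - 2)) := by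
      obtain ⟨k, hk⟩ := hm
      exact ⟨k - 1, by linarith⟩
    constructor
    · rw [hu n (m - 2) n1 _ (by push_cast; constructor <;> nlinarith),
        hu n m hm _ (by constructor <;> nlinarith)]
      exact ((hc.orbit S hA hD lam a n).riemann_iff S hA hD hev _).2 rfl
    · intro t ht x hx
      have hfl : ⌊t / (h / lam)⌋₊ = n := by
        rw [Nat.floor_eq_iff (div_nonneg ((by positivity : (0 : ℝ) ≤ n * (h / lam)).trans ht.1.le)
          hτ.le)]
        constructor
        · rw [le_div_iff₀ hτ]; exact ht.1.le
        · rw [div_lt_iff₀ hτ]; exact ht.2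
      have hne : ¬ t = n * (h / lam) := ht.1.ne'
      have hm1 : Even (((n + 1 : ℕ) : ℤ) + (m - 1)) := by
        obtain ⟨k, hk⟩ := hm
        exact ⟨k, by push_cast; linarith⟩
      have hi := hidx (n + 1) (m - 1) hm1 x (by
        push_cast
        rw [show (m : ℝ) - 1 + 2 = m + 1 by ring]
        exact hx)
      simp only [u, hfl, if_neg hne, hi, sub_add_cancel]
  · intro n m hm x hx
    have hm' : Even ((n : ℤ) + (m + 1)) := by
      obtain ⟨k, hk⟩ := hm
      exact ⟨k, by linarith⟩
    have hev := even_sub_orbit (p := p) (φ := φ) (w₀ := w₀) lam a c hb hm'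
    have e := hu (n + 1) m (by push_cast; exact hm) x hx
    push_cast at e
    rw [e, hC, Config.orbit, ← add_sub_cancel_right m 1,
      (hc.orbit S hA hD lam a n).cell_step S hA hD _ hev, add_sub_cancel_right]
    exact tendsto_sample _ _ hlam hh (m + 1) (a (n + 1))

end

end Config


/-! ### Variation and `L¹` distance of functions given on a grid -/

lemma exists_mem_Ico_grid {d : ℝ} (hd : 0 < d) (x₀ x : ℝ) :
    ∃ k : ℤ, x ∈ Ico (x₀ + k * d) (x₀ + (k + 1) * d) := by
  refine ⟨⌊(x - x₀) / d⌋, ?_, ?_⟩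
  · have := Int.floor_le ((x - x₀) / d)
    rw [le_div_iff₀ hd] at this
    linarith
  · have := Int.lt_floor_add_one ((x - x₀) / d)
    rw [div_lt_iff₀ hd] at this
    linarith

lemma eVariationOn_Icc_grid (f : ℝ → State) {d : ℝ} (hd : 0 < d) (x₀ : ℝ) (N : ℕ) :
    eVariationOn f (Icc (x₀ - N * d) (x₀ + N * d)) ≤
      ∑ k ∈ Finset.Ico (-(N : ℤ)) N, eVariationOn f (Icc (x₀ + k * d) (x₀ + (k + 1) * d)) := by
  induction N with
  | zero => simp
  | succ N ih =>
    have hN : (0 : ℝ) ≤ N * d := by positivity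
    have i1 : x₀ - (N + 1 : ℕ) * d ≤ x₀ - N * d := by push_cast; linarith
    have i2 : x₀ - N * d ≤ x₀ + N * d := by linarith
    have i3 : x₀ + N * d ≤ x₀ + (N + 1 : ℕ) * d := by push_cast; linarith
    have e1 := eVariationOn.Icc_add_Icc f (s := univ) i1 i2 (mem_univ _)
    have e2 := eVariationOn.Icc_add_Icc f (s := univ) (i1.trans i2) i3 (mem_univ _)
    simp only [univ_inter] at e1 e2
    rw [← e2, ← e1]
    have hs : Finset.Ico (-((N + 1 : ℕ) : ℤ)) ((N + 1 : ℕ) : ℤ) =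
        insert (-((N : ℤ) + 1)) (insert (N : ℤ) (Finset.Ico (-(N : ℤ)) N)) := by
      ext k
      simp only [Finset.mem_Ico, Finset.mem_insert]
      omega
    rw [hs, Finset.sum_insert (by simp), Finset.sum_insert (by simp), add_assoc, add_comm
      (eVariationOn f (Icc (x₀ - N * d) (x₀ + N * d)))]
    refine add_le_add (le_of_eq ?_) (add_le_add (le_of_eq ?_) ih)
    · congr 2 <;> push_cast <;> ring
    · congr 2
      push_cast
      ring

/-- The variation of a function is at most the sum of its variations over the cells of a grid. -/
lemma eVariationOn_le_tsum_grid (f : ℝ → State) {d : ℝ} (hd : 0 < d) (x₀ : ℝ) :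
    eVariationOn f univ ≤
      ∑' k : ℤ, eVariationOn f (Icc (x₀ + k * d) (x₀ + (k + 1) * d)) := by
  refine iSup_le fun ⟨n, v, hv, _⟩ => ?_
  obtain ⟨N, hN⟩ := exists_nat_gt (max (x₀ - v 0) (v n - x₀) / d)
  rw [div_lt_iff₀ hd, max_lt_iff] at hN
  have h1 : ∑ i ∈ Finset.range n, edist (f (v (i + 1))) (f (v i)) ≤
      eVariationOn f (Icc (x₀ - N * d) (x₀ + N * d)) := by
    refine eVariationOn.sum_le_of_monotoneOn_Iic (hv.monotoneOn _) fun i hi => ⟨?_, ?_⟩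
    · linarith [hv (Nat.zero_le i)]
    · linarith [hv (mem_Iic.1 hi)]
  exact h1.trans ((eVariationOn_Icc_grid f hd x₀ N).trans (ENNReal.sum_le_tsum _))

/-- The length of the path of states of a fan. -/
noncomputable def pathLength : State → List (ℝ × State) → ℝ≥0∞
  | _, [] => 0
  | u₀, (_, u) :: l => edist u₀ u + pathLength u l

/-- The distance from `u₀` to the first sampled state is included so that the induction closes: when
all samples lie beyond the first wave, it is split at the state behind that wave. -/
lemma sum_edist_fan_le (u₀ : State) (l : List (ℝ × State)) (n : ℕ) (v : ℕ → ℝ) (hv : Monotone v) :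
    edist u₀ (fan u₀ l (v 0)) +
      ∑ i ∈ Finset.range n, edist (fan u₀ l (v (i + 1))) (fan u₀ l (v i)) ≤ pathLength u₀ l := by
  induction l generalizing u₀ n v with
  | nil => simp [fan, pathLength]
  | cons a l ih =>
    obtain ⟨s, u⟩ := a
    induction n generalizing v with
    | zero =>
      by_cases h : v 0 < s
      · simp [fan, h]
      · have := ih u 0 v hv
        simp only [Finset.range_zero, Finset.sum_empty, add_zero, fan, h, if_false] at this ⊢
        exact (edist_triangle _ u _).trans (add_le_add le_rfl this)
    | succ n ihn =>
      by_cases h : v 0 < s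
      · have := ihn (fun i => v (i + 1)) fun i j hij => hv (by omega)
        rw [Finset.sum_range_succ']
        have e : fan u₀ ((s, u) :: l) (v 0) = u₀ := by simp [fan, h]
        rw [e, edist_self, zero_add, add_comm, edist_comm _ u₀]
        exact this
      · have hs : ∀ i, fan u₀ ((s, u) :: l) (v i) = fan u l (v i) := by
          intro i
          have : ¬ v i < s := not_lt.2 ((not_lt.1 h).trans (hv (Nat.zero_le i)))
          simp [fan, this]
        have := ih u (n + 1) v hv
        simp only [hs, pathLength]
        exact (add_le_add (edist_triangle u₀ u _) le_rfl).trans (by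
          rw [add_assoc]; exact add_le_add le_rfl this)

lemma eVariationOn_fan_le (u₀ : State) (l : List (ℝ × State)) :
    eVariationOn (fan u₀ l) univ ≤ pathLength u₀ l :=
  iSup_le fun ⟨n, v, hv, _⟩ => le_add_self.trans (sum_edist_fan_le u₀ l n v hv)

lemma eVariationOn_le_of_eq_fan {f : ℝ → State} {s : Set ℝ} {u₀ : State} {l : List (ℝ × State)}
    {z σ : ℝ} (hσ : 0 < σ) (h : ∀ x ∈ s, f x = fan u₀ l ((x - z) / σ)) :
    eVariationOn f s ≤ pathLength u₀ l := by
  have e : eVariationOn f s = eVariationOn (fan u₀ l ∘ fun x => (x - z) / σ) s :=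
    eVariationOn.congr fun x hx => h x hx
  rw [e]
  refine (eVariationOn.comp_le_of_monotoneOn _ _ ?_ (mapsTo_univ _ _)).trans
    (eVariationOn_fan_le u₀ l)
  intro x _ y _ hxy
  exact div_le_div_of_nonneg_right (by linarith) hσ.le

lemma eVariationOn_sub_const (f : ℝ → State) (c : State) (s : Set ℝ) :
    eVariationOn (fun x => f x - c) s = eVariationOn f s := by
  simp [eVariationOn, edist_sub_right]

/-- A function of `t` and `x` whose oscillations on the cells of the time strips are summable is
Lipschitz continuous in `L¹`, up to the mesh size. -/
lemma eLpNorm_sub_le_of_strips {f : ℝ → ℝ → State} {τ h : ℝ} (hτ : 0 < τ) (hh : 0 < h)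
    (z : ℕ → ℝ) (ref : ℕ → ℤ → State) (osc : ℕ → ℤ → ℝ≥0∞) {M : ℝ≥0∞}
    (hM : ∀ n, ∑' k, osc n k ≤ M)
    (H : ∀ n : ℕ, ∀ t ∈ Icc (n * τ) ((n + 1) * τ), ∀ k : ℤ,
      ∀ x ∈ Ico (z n + k * (2 * h)) (z n + (k + 1) * (2 * h)), ‖f t x - ref n k‖ₑ ≤ osc n k)
    {t t' : ℝ} (ht : 0 ≤ t) (ht' : 0 ≤ t') :
    eLpNorm (fun x => f t x - f t' x) 1 volume ≤
      M * ENNReal.ofReal (4 * h * (|t - t'| / τ + 2)) := by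
  wlog htt : t ≤ t' generalizing t t'
  · have := this ht' ht (le_of_not_ge htt)
    rw [abs_sub_comm] at this
    refine le_trans (le_of_eq ?_) this
    rw [← eLpNorm_neg]
    congr 1
    ext x <;> simp
  -- The step function equal to `osc n k` on cell `k`; within strip `n`, two times differ pointwise
  -- by at most `2 * O n x`.
  set O : ℕ → ℝ → ℝ≥0∞ := fun n x =>
    ∑' k : ℤ, (Ico (z n + k * (2 * h)) (z n + (k + 1) * (2 * h))).indicator
      (fun _ => osc n k) x with hO
  have hOm : ∀ n, Measurable (O n) := fun n =>
    Measurable.tsum fun k => measurable_const.indicator measurableSet_Ico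
  have hOint : ∀ n, ∫⁻ x, O n x ≤ M * ENNReal.ofReal (2 * h) := by
    intro n
    rw [hO]
    simp only
    rw [lintegral_tsum fun k => (measurable_const.indicator measurableSet_Ico).aemeasurable]
    refine le_trans (le_of_eq ?_) (mul_le_mul_left (hM n) _)
    rw [← ENNReal.tsum_mul_right]
    congr 1
    ext k
    rw [lintegral_indicator_const measurableSet_Ico, Real.volume_Ico]
    congr 2
    ring
  have hstrip : ∀ n : ℕ, ∀ s ∈ Icc (n * τ) ((n + 1) * τ), ∀ s' ∈ Icc (n * τ) ((n + 1) * τ), ∀ x,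
      ‖f s x - f s' x‖ₑ ≤ 2 * O n x := by
    intro n s hs s' hs' x
    obtain ⟨k, hk⟩ := exists_mem_Ico_grid (show 0 < 2 * h by positivity) (z n) x
    have hle : osc n k ≤ O n x := by
      have := ENNReal.le_tsum (f := fun k : ℤ =>
        (Ico (z n + k * (2 * h)) (z n + (k + 1) * (2 * h))).indicator (fun _ => osc n k) x) k
      simp only [indicator_of_mem hk] at this
      exact this
    have e : f s x - f s' x = (f s x - ref n k) - (f s' x - ref n k) := by abel
    rw [e, two_mul]
    refine enorm_sub_le.trans (add_le_add ?_ ?_)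
    · exact (H n s hs k x hk).trans hle
    · exact (H n s' hs' k x hk).trans hle
  set n := ⌊t / τ⌋₊ with hn
  have hnt : t ∈ Icc (n * τ) ((n + 1) * τ) := by
    constructor
    · rw [← le_div_iff₀ hτ]; exact Nat.floor_le (by positivity)
    · rw [← div_le_iff₀ hτ]; exact (Nat.lt_floor_add_one _).le
  -- The path from `t` to `s` passes through the grid times between them. Strips are closed in time,
  -- so the sampling jumps at these times are included in the oscillations.
  have hchain : ∀ m : ℕ, ∀ s ∈ Icc ((n + m : ℕ) * τ) (((n + m : ℕ) + 1) * τ), ∀ x,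
      ‖f t x - f s x‖ₑ ≤ ∑ i ∈ Finset.range (m + 1), 2 * O (n + i) x := by
    intro m
    induction m with
    | zero =>
      intro s hs x
      simpa using hstrip n t hnt s (by simpa using hs) x
    | succ m ih =>
      intro s hs x
      have e : f t x - f s x = (f t x - f ((n + m + 1 : ℕ) * τ) x) +
        (f ((n + m + 1 : ℕ) * τ) x - f s x) := by abel
      rw [e, Finset.sum_range_succ]
      refine (enorm_add_le _ _).trans (add_le_add (ih _ ⟨?_, ?_⟩ x)
        (hstrip (n + (m + 1)) _ ⟨?_, ?_⟩ s hs x))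
      · push_cast; nlinarith
      · push_cast; linarith
      · push_cast; linarith
      · push_cast; nlinarith
  set n' := ⌊t' / τ⌋₊ with hn'
  have hnn : n ≤ n' := Nat.floor_le_floor (div_le_div_of_nonneg_right htt hτ.le)
  obtain ⟨m, hm⟩ := Nat.exists_eq_add_of_le hnn
  have hnt' : t' ∈ Icc ((n + m : ℕ) * τ) (((n + m : ℕ) + 1) * τ) := by
    rw [← hm]
    constructor
    · rw [← le_div_iff₀ hτ]; exact Nat.floor_le (by positivity)
    · rw [← div_le_iff₀ hτ]; exact (Nat.lt_floor_add_one _).le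
  rw [eLpNorm_one_eq_lintegral_enorm]
  refine (lintegral_mono fun x => hchain m t' hnt' x).trans ?_
  rw [lintegral_finsetSum _ fun i _ => (hOm _).const_mul 2]
  -- The number of strips met; the two extra ones for incomplete strips produce the term in the mesh
  -- size.
  have hcount : ((m : ℝ) + 1) ≤ |t - t'| / τ + 2 := by
    rw [abs_sub_comm, abs_of_nonneg (by linarith)]
    have h1 := hnt'.1
    have h2 := hnt.2
    push_cast at h1
    have : (m : ℝ) - 1 ≤ (t' - t) / τ := by
      rw [le_div_iff₀ hτ]; linarith
    linarith
  calc ∑ i ∈ Finset.range (m + 1), ∫⁻ x, 2 * O (n + i) x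
      ≤ ∑ i ∈ Finset.range (m + 1), 2 * (M * ENNReal.ofReal (2 * h)) := by
        refine Finset.sum_le_sum fun i _ => ?_
        rw [lintegral_const_mul _ (hOm _)]
        exact mul_le_mul_right (hOint _) _
    _ = M * ENNReal.ofReal (4 * h * ((m : ℝ) + 1)) := by
        rw [Finset.sum_const, Finset.card_range, nsmul_eq_mul,
          show 4 * h * ((m : ℝ) + 1) = ((m + 1 : ℕ) : ℝ) * (2 * (2 * h)) by push_cast; ring,
          ENNReal.ofReal_mul (p := ((m + 1 : ℕ) : ℝ)) (Nat.cast_nonneg _), ENNReal.ofReal_natCast,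
          ENNReal.ofReal_mul (p := 2) (q := 2 * h) (by norm_num)]
        simp only [ENNReal.ofReal_ofNat]
        ring
    _ ≤ _ := by gcongr


/-- Bounds for a sum over the cells of a grid, given separately on the two sides. -/
lemma tsum_int_le {f : ℤ → ℝ≥0∞} {a b c : ℝ≥0∞} (h0 : f 0 ≤ a)
    (hr : ∀ N, ∑ i ∈ Finset.range N, f ((i : ℤ) + 1) ≤ b)
    (hl : ∀ N, ∑ i ∈ Finset.range N, f (-((i : ℤ) + 1)) ≤ c) : ∑' k, f k ≤ a + b + c := by
  have h1 : HasSum (fun n : ℕ => f n) (∑' n : ℕ, f n) := ENNReal.summable.hasSum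
  have h2 : HasSum (fun n : ℕ => f (-((n : ℤ) + 1))) (∑' n : ℕ, f (-((n : ℤ) + 1))) :=
    ENNReal.summable.hasSum
  rw [(HasSum.of_nat_of_neg_add_one h1 h2).tsum_eq, tsum_eq_zero_add' ENNReal.summable]
  refine add_le_add (add_le_add (by simpa using h0) ?_) (ENNReal.tsum_le_of_sum_range_le hl)
  exact ENNReal.tsum_le_of_sum_range_le fun N => by simpa using hr N

/-! ### Location of the front and the values of the approximate solution. -/

/-- The position of the phase boundary. -/
noncomputable def frontPath (p : Material) (φ : ℝ → ℝ) (lam h : ℝ) (C : ℕ → Config) (t : ℝ) : ℝ :=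
  (C ⌊t / (h / lam)⌋₊).b * h +
    (C ⌊t / (h / lam)⌋₊).speed p φ * (t - ⌊t / (h / lam)⌋₊ * (h / lam))

/-- The bound of a state by its invariants. -/
noncomputable def Material.invNorm (p : Material) : ℝ := 1 / 2 + 1 / (2 * p.c₃)

lemma Material.invNorm_pos (p : Material) : 0 < p.invNorm := by
  have := p.c₃_pos
  unfold invNorm
  positivity

lemma Material.norm_sub_le_left (p : Material) (r l r' l' : ℝ) :
    ‖ofInvariants p.c₁ r l - ofInvariants p.c₁ r' l'‖ ≤ p.invNorm * (|r - r'| + |l - l'|) := by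
  refine (norm_ofInvariants_sub_le p.c₁_pos r l r' l').trans ?_
  have h3 := p.c₃_pos
  have h31 := p.c₃_lt_c₁
  unfold invNorm
  gcongr

lemma Material.norm_sub_le_right (p : Material) (s q s' q' : ℝ) :
    ‖ofInvariants p.c₃ s q - ofInvariants p.c₃ s' q'‖ ≤ p.invNorm * (|s - s'| + |q - q'|) :=
  norm_ofInvariants_sub_le p.c₃_pos s q s' q'

/-- The function `u` is a solution by Glimm's scheme whose configurations are all close to a phase
boundary and have bounded potential. -/
structure IsTrack (p : Material) (φ : ℝ → ℝ) (w₀ r₀ l₀ q₀ s₀ δ D L A P lam h : ℝ)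
    (C : ℕ → Config) (u : ℝ → ℝ → State) : Prop where
  solver : p.IsLocalSolver φ w₀ r₀ l₀ q₀ s₀ δ L
  factor : A = Config.outFactor p r₀ q₀ L
  small : A * D ≤ δ
  cfl : p.c₁ < lam
  mesh : 0 < h
  near : ∀ n, (C n).IsNear r₀ l₀ q₀ s₀ D L A
  potential : ∀ n, (C n).HasPotential p φ w₀ L P
  step : ∀ n, ∃ ξ, C (n + 1) = (C n).step p φ w₀ ξ
  even : ∀ n : ℕ, Even ((n : ℤ) - (C n).b)
  realization : Config.IsRealization p φ w₀ lam h C u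

namespace IsTrack

variable {p : Material} {φ : ℝ → ℝ} {w₀ r₀ l₀ q₀ s₀ δ D L A P lam h : ℝ} {C : ℕ → Config}
  {u : ℝ → ℝ → State} (T : IsTrack p φ w₀ r₀ l₀ q₀ s₀ δ D L A P lam h C u)

include T

lemma lam_pos : 0 < lam := p.c₁_pos.trans T.cfl

lemma tau_pos : 0 < h / lam := div_pos T.mesh T.lam_pos

lemma frontPath_eq {n : ℕ} {t : ℝ} (ht : t ∈ Ico (n * (h / lam)) ((n + 1) * (h / lam))) :
    frontPath p φ lam h C t = (C n).b * h + (C n).speed p φ * (t - n * (h / lam)) := by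
  have hτ := T.tau_pos
  have : ⌊t / (h / lam)⌋₊ = n := by
    rw [Nat.floor_eq_iff (div_nonneg ((by positivity : (0 : ℝ) ≤ n * (h / lam)).trans ht.1) hτ.le)]
    constructor
    · rw [le_div_iff₀ hτ]; exact ht.1
    · rw [div_lt_iff₀ hτ]; exact ht.2
  rw [frontPath, this]

lemma frontPath_grid (n : ℕ) : frontPath p φ lam h C (n * (h / lam)) = (C n).b * h := by
  have hτ := T.tau_pos
  rw [T.frontPath_eq (n := n) ⟨le_rfl, by nlinarith⟩]
  ring

lemma mem_strip {t : ℝ} (ht : 0 ≤ t) :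
    ∃ n : ℕ, t ∈ Ico (n * (h / lam)) ((n + 1) * (h / lam)) := by
  have hτ := T.tau_pos
  refine ⟨⌊t / (h / lam)⌋₊, ?_, ?_⟩
  · rw [← le_div_iff₀ hτ]; exact Nat.floor_le (by positivity)
  · rw [← div_lt_iff₀ hτ]; exact Nat.lt_floor_add_one _

/-- The front speed is below `lam` in modulus, so before the next sampling the front stays strictly
inside the cell around its source. -/
lemma abs_frontPath_sub_lt {n : ℕ} {t : ℝ} (ht : t ∈ Ico (n * (h / lam)) ((n + 1) * (h / lam))) :
    |frontPath p φ lam h C t - (C n).b * h| < h := by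
  rw [T.frontPath_eq ht, add_sub_cancel_left, abs_mul]
  have hV := (T.near n).speed_mem T.solver T.factor T.small
  have hV' : |(C n).speed p φ| < lam :=
    abs_lt.2 ⟨by linarith [hV.1, p.c₃_lt_c₁, T.cfl], hV.2.trans T.cfl⟩
  have h0 : |t - n * (h / lam)| ≤ h / lam := by
    rw [abs_of_nonneg (by linarith [ht.1])]; linarith [ht.2]
  have := T.lam_pos
  calc _ ≤ |(C n).speed p φ| * (h / lam) := by gcongr
    _ < lam * (h / lam) := by gcongr; exact T.tau_pos
    _ = h := by field_simp

/-- At the end of the strip the path jumps to the sampled grid point `b ± 1`, at distance exactly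
`h`. -/
lemma abs_frontPath_sub_le {n : ℕ} {t : ℝ} (ht : t ∈ Icc (n * (h / lam)) ((n + 1) * (h / lam))) :
    |frontPath p φ lam h C t - (C n).b * h| ≤ h := by
  rcases ht.2.lt_or_eq with h1 | rfl
  · exact (T.abs_frontPath_sub_lt ⟨ht.1, h1⟩).le
  · have := T.frontPath_grid (n + 1)
    push_cast at this
    rw [this]
    obtain ⟨ξ, hξ⟩ := T.step n
    rw [hξ, Config.step]
    have := T.mesh
    by_cases hc : ξ ≤ (C n).speed p φ
    · rw [if_pos hc]
      push_cast
      rw [add_mul, add_sub_cancel_left, one_mul, abs_of_pos this]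
    · rw [if_neg hc]
      push_cast
      rw [show ((C n).b - 1) * h - (C n).b * h = -h by ring, abs_neg, abs_of_pos this]

/-- The form of the solution near a grid point in a time strip. -/
lemma local_form {n : ℕ} {j : ℤ} (hj : Even (j - (C n).b)) {t x : ℝ}
    (ht : t ∈ Icc (n * (h / lam)) ((n + 1) * (h / lam))) (hx : x ∈ Ico ((j - 1) * h) ((j + 1) * h)) :
    (t = n * (h / lam) ∧ ((x < j * h ∧ u t x = (C n).cell p (j - 2)) ∨
        (j * h ≤ x ∧ u t x = (C n).cell p j))) ∨
      (t ∈ Ioo (n * (h / lam)) ((n + 1) * (h / lam)) ∧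
        u t x = fan ((C n).cell p (j - 2)) ((C n).waves p φ w₀ j)
          ((x - j * h) / (t - n * (h / lam)))) ∨
      (t = (n + 1 : ℕ) * (h / lam) ∧ ∃ ξ, C (n + 1) = (C n).step p φ w₀ ξ ∧
        u t x = leftFan ((C n).cell p (j - 2)) ((C n).waves p φ w₀ j) ξ) := by
  have hh := T.mesh
  have hR := T.realization
  have he : Even ((n : ℤ) + j) := by
    obtain ⟨i, hi⟩ := T.even n
    obtain ⟨k, hk⟩ := hj
    exact ⟨i + k + (C n).b, by linarith⟩
  rcases ht.1.eq_or_lt with rfl | h1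
  · left
    refine ⟨rfl, ?_⟩
    rcases lt_or_ge x (j * h) with hxj | hxj
    · refine Or.inl ⟨hxj, hR.cell n (j - 2) ?_ x ?_⟩
      · obtain ⟨k, hk⟩ := he
        exact ⟨k - 1, by linarith⟩
      · push_cast
        constructor <;> nlinarith [hx.1]
    · exact Or.inr ⟨hxj, hR.cell n j he x ⟨hxj, by nlinarith [hx.2]⟩⟩
  rcases ht.2.lt_or_eq with h2 | h2
  · exact Or.inr (Or.inl ⟨⟨h1, h2⟩, hR.fan n j he t ⟨h1, h2⟩ x hx⟩)
  · refine Or.inr (Or.inr ⟨by rw [h2]; push_cast; ring, ?_⟩)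
    obtain ⟨ξ, hξ⟩ := T.step n
    refine ⟨ξ, hξ, ?_⟩
    rw [← (T.near n).cell_step T.solver T.factor T.small ξ hj, ← hξ]
    have := hR.cell (n + 1) (j - 1) ?_ x ?_
    · rw [← this, h2]; push_cast; ring_nf
    · obtain ⟨k, hk⟩ := he
      exact ⟨k, by push_cast; linarith⟩
    · push_cast
      rw [show (j : ℝ) - 1 + 2 = j + 1 by ring]
      exact hx

lemma state_left {n : ℕ} (k : ℕ) {t x : ℝ} (ht : t ∈ Icc (n * (h / lam)) ((n + 1) * (h / lam)))
    (hx : x ∈ Ico ((((C n).b - 2 - 2 * k : ℤ) - 1) * h) ((((C n).b - 2 - 2 * k : ℤ) + 1) * h)) :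
    u t x = ofInvariants p.c₁ ((C n).r (k + 1)) ((C n).l (k + 1)) ∨
      u t x = ofInvariants p.c₁ ((C n).r (k + 1)) ((C n).l k) ∨
      u t x = ofInvariants p.c₁ ((C n).r k) ((C n).l k) := by
  rcases T.local_form (j := (C n).b - 2 - 2 * k) ⟨-1 - k, by ring⟩ ht hx with
    ⟨-, ⟨-, e⟩ | ⟨-, e⟩⟩ | ⟨-, e⟩ | ⟨-, ξ, -, e⟩
  · rw [e, Config.cell_left']; simp
  · rw [e, Config.cell_left]; simp
  · rw [e, Config.cell_left', Config.waves_left]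
    simp only [fan, Material.contactWaves]
    split_ifs <;> simp
  · rw [e, Config.cell_left', Config.waves_left]
    simp only [leftFan, Material.contactWaves]
    split_ifs <;> simp

lemma state_right {n : ℕ} (k : ℕ) {t x : ℝ} (ht : t ∈ Icc (n * (h / lam)) ((n + 1) * (h / lam)))
    (hx : x ∈ Ico ((((C n).b + 2 + 2 * k : ℤ) - 1) * h) ((((C n).b + 2 + 2 * k : ℤ) + 1) * h)) :
    u t x = ofInvariants p.c₃ ((C n).s k) ((C n).q k) ∨
      u t x = ofInvariants p.c₃ ((C n).s k) ((C n).q (k + 1)) ∨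
      u t x = ofInvariants p.c₃ ((C n).s (k + 1)) ((C n).q (k + 1)) := by
  rcases T.local_form (j := (C n).b + 2 + 2 * k) ⟨1 + k, by ring⟩ ht hx with
    ⟨-, ⟨-, e⟩ | ⟨-, e⟩⟩ | ⟨-, e⟩ | ⟨-, ξ, -, e⟩
  · rw [e, Config.cell_right']; simp
  · rw [e, Config.cell_right_succ]; simp
  · rw [e, Config.cell_right', Config.waves_right]
    simp only [fan, Material.contactWaves]
    split_ifs <;> simp
  · rw [e, Config.cell_right', Config.waves_right]
    simp only [leftFan, Material.contactWaves]
    split_ifs <;> simp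

lemma state_front {n : ℕ} {t x : ℝ} (ht : t ∈ Icc (n * (h / lam)) ((n + 1) * (h / lam)))
    (hx : x ∈ Ico (((C n).b - 1) * h) (((C n).b + 1) * h)) :
    (x < frontPath p φ lam h C t ∧ ∃ l, (l = (C n).l 0 ∨ l = (C n).outLeft p φ) ∧
        u t x = ofInvariants p.c₁ ((C n).r 0) l) ∨
      (frontPath p φ lam h C t ≤ x ∧ ∃ s, (s = (C n).s 0 ∨ s = (C n).outRight p φ w₀) ∧
        u t x = ofInvariants p.c₃ s ((C n).q 0)) := by
  have hV := (T.near n).speed_mem T.solver T.factor T.small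
  obtain ⟨hs1, hs2⟩ := (T.near n).speed T.solver T.factor T.small
  have h3 := p.c₃_pos
  have h31 := p.c₃_lt_c₁
  have hh := T.mesh
  rcases T.local_form (j := (C n).b) ⟨0, by ring⟩ ht hx with
    ⟨e, ⟨e', e''⟩ | ⟨e', e''⟩⟩ | ⟨e, e'⟩ | ⟨e, ξ, hξ, e'⟩
  · subst e
    rw [T.frontPath_grid]
    exact Or.inl ⟨e', _, Or.inl rfl, e''.trans (Config.cell_front_left _)⟩
  · subst e
    rw [T.frontPath_grid]
    exact Or.inr ⟨e', _, Or.inl rfl, e''.trans (Config.cell_front_right _)⟩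
  · rw [T.frontPath_eq ⟨e.1.le, e.2⟩, e', Config.waves_front, Config.cell_front_left]
    have ht0 : 0 < t - n * (h / lam) := by linarith [e.1]
    have hlt : x < (C n).b * h + (C n).speed p φ * (t - n * (h / lam)) ↔
        (x - (C n).b * h) / (t - n * (h / lam)) < (C n).speed p φ := by
      rw [div_lt_iff₀ ht0, sub_lt_iff_lt_add']
    by_cases hc : (x - (C n).b * h) / (t - n * (h / lam)) < (C n).speed p φ
    · refine Or.inl ⟨hlt.2 hc, ?_⟩
      have hc' : (x - (C n).b * h) / (t - n * (h / lam)) < p.speed φ ((C n).r 0) ((C n).q 0)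
        ((C n).s 0) := hc
      simp only [Material.frontWaves]
      split_ifs <;> simp only [fan, hc', if_true] <;> split_ifs
      exacts [⟨_, Or.inl rfl, rfl⟩, ⟨_, Or.inr rfl, rfl⟩, ⟨_, Or.inl rfl, rfl⟩,
        ⟨_, Or.inr rfl, rfl⟩]
    · refine Or.inr ⟨not_lt.1 (mt hlt.1 hc), ?_⟩
      have hc' : ¬ (x - (C n).b * h) / (t - n * (h / lam)) < p.speed φ ((C n).r 0) ((C n).q 0)
        ((C n).s 0) := hc
      have hc'' : ¬ (x - (C n).b * h) / (t - n * (h / lam)) < -p.c₁ := by linarith [hV.1]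
      simp only [Material.frontWaves]
      split_ifs <;> simp only [fan, hc', hc'', if_false]
      · split_ifs
        exacts [⟨_, Or.inr rfl, rfl⟩, ⟨_, Or.inl rfl, rfl⟩]
      · exact ⟨_, Or.inl rfl, rfl⟩
  · subst e
    rw [T.frontPath_grid, e', Config.waves_front, Config.cell_front_left, hξ, Config.step]
    by_cases hc : ξ ≤ (C n).speed p φ
    · have hc' : ξ ≤ p.speed φ ((C n).r 0) ((C n).q 0) ((C n).s 0) := hc
      rw [if_pos hc]
      push_cast
      -- At the end time the sampled front is the right edge of the cell, so the whole cell shows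
      -- the left phase.
      refine Or.inl ⟨hx.2, ?_⟩
      simp only [Material.frontWaves]
      split_ifs <;> simp only [leftFan, hc', if_true] <;> split_ifs
      exacts [⟨_, Or.inl rfl, rfl⟩, ⟨_, Or.inr rfl, rfl⟩, ⟨_, Or.inl rfl, rfl⟩,
        ⟨_, Or.inr rfl, rfl⟩]
    · have hc' : ¬ ξ ≤ p.speed φ ((C n).r 0) ((C n).q 0) ((C n).s 0) := hc
      have hc'' : ¬ ξ ≤ -p.c₁ := by linarith [hV.1]
      rw [if_neg hc]
      push_cast
      refine Or.inr ⟨hx.1, ?_⟩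
      simp only [Material.frontWaves]
      split_ifs <;> simp only [leftFan, hc', hc'', if_false]
      · split_ifs
        exacts [⟨_, Or.inr rfl, rfl⟩, ⟨_, Or.inl rfl, rfl⟩]
      · exact ⟨_, Or.inl rfl, rfl⟩

/-- The cells of a time strip. -/
lemma cell_cases (n : ℕ) (x : ℝ) :
    (∃ k : ℕ, x ∈ Ico ((((C n).b - 2 - 2 * k : ℤ) - 1) * h)
        ((((C n).b - 2 - 2 * k : ℤ) + 1) * h)) ∨
      x ∈ Ico (((C n).b - 1) * h) (((C n).b + 1) * h) ∨
      ∃ k : ℕ, x ∈ Ico ((((C n).b + 2 + 2 * k : ℤ) - 1) * h)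
        ((((C n).b + 2 + 2 * k : ℤ) + 1) * h) := by
  obtain ⟨k, hk⟩ := exists_mem_Ico_grid (show 0 < 2 * h by linarith [T.mesh]) (((C n).b - 1) * h) x
  rcases Config.grid_cases (b := (C n).b) (j := (C n).b + 2 * k) ⟨k, by ring⟩ with
    ⟨i, hi⟩ | hi | ⟨i, hi⟩
  · refine Or.inl ⟨i, ?_⟩
    rw [← hi]; push_cast
    convert hk using 2 <;> ring
  · refine Or.inr (Or.inl ?_)
    have : k = 0 := by linarith
    subst this
    convert hk using 2 <;> push_cast <;> ring
  · refine Or.inr (Or.inr ⟨i, ?_⟩)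
    rw [← hi]; push_cast
    convert hk using 2 <;> ring

lemma lt_front_of_mem_left {n : ℕ} {k : ℕ} {t x : ℝ}
    (ht : t ∈ Icc (n * (h / lam)) ((n + 1) * (h / lam)))
    (hx : x < (((C n).b - 2 - 2 * k : ℤ) + 1) * h) : x < frontPath p φ lam h C t := by
  have h1 := (abs_le.1 (T.abs_frontPath_sub_le ht)).1
  have h2 : (0 : ℝ) ≤ k * h := mul_nonneg (Nat.cast_nonneg _) T.mesh.le
  push_cast at hx
  nlinarith

lemma front_le_of_mem_right {n : ℕ} {k : ℕ} {t x : ℝ}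
    (ht : t ∈ Icc (n * (h / lam)) ((n + 1) * (h / lam)))
    (hx : (((C n).b + 2 + 2 * k : ℤ) - 1) * h ≤ x) : frontPath p φ lam h C t ≤ x := by
  have h1 := (abs_le.1 (T.abs_frontPath_sub_le ht)).2
  have h2 : (0 : ℝ) ≤ k * h := mul_nonneg (Nat.cast_nonneg _) T.mesh.le
  push_cast at hx
  nlinarith

/-- The state on the left of the phase boundary. -/
lemma state_of_lt {t x : ℝ} (ht : 0 ≤ t) (hx : x < frontPath p φ lam h C t) :
    ∃ r l, |r - r₀| ≤ D ∧ |l - l₀| ≤ A * D ∧ u t x = ofInvariants p.c₁ r l := by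
  obtain ⟨n, hn⟩ := T.mem_strip ht
  have hn' := Ico_subset_Icc_self hn
  have N := T.near n
  have O := N.out_near T.solver T.factor T.small
  rcases T.cell_cases n x with ⟨k, hk⟩ | hk | ⟨k, hk⟩
  · rcases T.state_left k hn' hk with e | e | e <;> exact ⟨_, _, N.r _, N.l _, e⟩
  · rcases T.state_front hn' hk with ⟨-, l, rfl | rfl, e⟩ | ⟨h1, -⟩
    · exact ⟨_, _, N.r _, N.l _, e⟩
    · exact ⟨_, _, N.r _, O.1, e⟩
    · linarith
  · linarith [T.front_le_of_mem_right hn' hk.1]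

/-- The state on the right of the phase boundary. -/
lemma state_of_ge {t x : ℝ} (ht : 0 ≤ t) (hx : frontPath p φ lam h C t ≤ x) :
    ∃ s q, |s - s₀| ≤ 2 * L * D ∧ |q - q₀| ≤ D ∧ u t x = ofInvariants p.c₃ s q := by
  obtain ⟨n, hn⟩ := T.mem_strip ht
  have hn' := Ico_subset_Icc_self hn
  have N := T.near n
  have O := N.out_near T.solver T.factor T.small
  rcases T.cell_cases n x with ⟨k, hk⟩ | hk | ⟨k, hk⟩
  · linarith [T.lt_front_of_mem_left hn' hk.2]
  · rcases T.state_front hn' hk with ⟨h1, -⟩ | ⟨-, s, rfl | rfl, e⟩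
    · linarith
    · exact ⟨_, _, N.s _, N.q _, e⟩
    · exact ⟨_, _, O.2, N.q _, e⟩
  · rcases T.state_right k hn' hk with e | e | e <;> exact ⟨_, _, N.s _, N.q _, e⟩

lemma isPhaseBoundary : IsPhaseBoundary p u (frontPath p φ lam h C) := by
  intro t ht
  have hle := (T.near 0).le T.solver T.factor T.small
  constructor
  · intro x hx
    obtain ⟨r, l, hr, hl, e⟩ := T.state_of_lt ht hx
    rw [e]
    exact T.solver.mem_left _ _ (hr.trans hle.2.1) (hl.trans T.small)
  · intro x hx
    obtain ⟨s, q, hs, hq, e⟩ := T.state_of_ge ht (le_of_lt hx)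
    rw [e]
    exact T.solver.mem_right _ _ (hq.trans hle.2.1) (hs.trans hle.2.2)

/-- The distance to the unperturbed front is uniformly small. -/
lemma norm_sub_front_le {t : ℝ} (ht : 0 ≤ t) (x : ℝ) :
    ‖u t x - front (ofInvariants p.c₁ r₀ l₀) (ofInvariants p.c₃ s₀ q₀) (frontPath p φ lam h C t) x‖
      ≤ p.invNorm * ((1 + A) * D) := by
  have hκ := p.invNorm_pos
  have h0 := ((T.near 0).le T.solver T.factor T.small).1
  have h2 := mul_le_mul_of_nonneg_right (Config.two_mul_le_outFactor T.factor) h0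
  unfold front
  split_ifs with hx
  · obtain ⟨r, l, hr, hl, e⟩ := T.state_of_lt ht hx
    rw [e]
    refine (p.norm_sub_le_left _ _ _ _).trans (mul_le_mul_of_nonneg_left ?_ hκ.le)
    linarith
  · obtain ⟨s, q, hs, hq, e⟩ := T.state_of_ge ht (not_lt.1 hx)
    rw [e]
    refine (p.norm_sub_le_right _ _ _ _).trans (mul_le_mul_of_nonneg_left ?_ hκ.le)
    linarith

end IsTrack


/-! ### Variation in space and continuity in time of the deviation from the front. -/

lemma edist_le_ofReal {a b : State} {c : ℝ} (h : ‖a - b‖ ≤ c) : edist a b ≤ ENNReal.ofReal c := by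
  rw [edist_dist, dist_eq_norm]
  exact ENNReal.ofReal_le_ofReal h

lemma enorm_le_ofReal {a : State} {c : ℝ} (h : ‖a‖ ≤ c) : ‖a‖ₑ ≤ ENNReal.ofReal c := by
  rw [← ofReal_norm]
  exact ENNReal.ofReal_le_ofReal h

lemma edist_le_of_norm_le {a b : State} {B : ℝ} (ha : ‖a‖ ≤ B) (hb : ‖b‖ ≤ B) :
    edist a b ≤ 2 * ENNReal.ofReal B := by
  rw [edist_eq_enorm_sub, two_mul]
  exact enorm_sub_le.trans (add_le_add (enorm_le_ofReal ha) (enorm_le_ofReal hb))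

namespace IsTrack

variable {p : Material} {φ : ℝ → ℝ} {w₀ r₀ l₀ q₀ s₀ δ D L A P lam h : ℝ} {C : ℕ → Config}
  {u : ℝ → ℝ → State} (T : IsTrack p φ w₀ r₀ l₀ q₀ s₀ δ D L A P lam h C u)

include T

/-- Away from the front cell, the contribution of a cell is controlled by one jump of each invariant
on that side. All these variations are part of the potential, in which `tr` and `tq` have weight at
least `1`. -/
lemma tsum_le (n : ℕ) {f : ℤ → ℝ≥0∞} {a : ℝ≥0∞} {K : ℝ} (hK : 0 ≤ K) (h0 : f 0 ≤ a)
    (hr : ∀ i : ℕ, f ((i : ℤ) + 1) ≤ ENNReal.ofReal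
      (K * (|(C n).s i - (C n).s (i + 1)| + |(C n).q i - (C n).q (i + 1)|)))
    (hl : ∀ i : ℕ, f (-((i : ℤ) + 1)) ≤ ENNReal.ofReal
      (K * (|(C n).r i - (C n).r (i + 1)| + |(C n).l i - (C n).l (i + 1)|))) :
    ∑' k, f k ≤ a + ENNReal.ofReal (K * P) := by
  obtain ⟨tr, tl, tq, ts, vr, vl, vq, vs, hpot⟩ := T.potential n
  have k1 := vr.nonneg
  have k2 := vl.nonneg
  have k3 := vq.nonneg
  have k4 := vs.nonneg
  have hL := T.solver.one_le
  have hc : 0 < p.c₁ + p.c₃ := add_pos p.c₁_pos p.c₃_pos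
  have e1 : 0 ≤ L / (p.c₁ + p.c₃) := by positivity
  have e2 : tr + tq ≤ (2 * L + L / (p.c₁ + p.c₃)) * (tr + tq) :=
    le_mul_of_one_le_left (by linarith) (by linarith)
  have e3 : 0 ≤ L * max (-(C n).gap p) 0 * ts := by positivity
  have e4 := abs_nonneg ((C n).outLeft p φ - (C n).l 0)
  have e5 := abs_nonneg ((C n).outRight p φ w₀ - (C n).s 0)
  have hsum : ∀ {g : ℕ → ℝ≥0∞} {x y : ℕ → ℝ} {tx ty : ℝ}, HasVariation x tx → HasVariation y ty →
      (∀ i, g i ≤ ENNReal.ofReal (K * (|x i - x (i + 1)| + |y i - y (i + 1)|))) →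
      ∀ N, ∑ i ∈ Finset.range N, g i ≤ ENNReal.ofReal (K * (tx + ty)) := by
    intro g x y tx ty hx hy hg N
    refine (Finset.sum_le_sum fun i _ => hg i).trans ?_
    rw [← ENNReal.ofReal_sum_of_nonneg fun i _ => by positivity, ← Finset.mul_sum,
      Finset.sum_add_distrib]
    exact ENNReal.ofReal_le_ofReal (mul_le_mul_of_nonneg_left (add_le_add (hx N) (hy N)) hK)
  refine (tsum_int_le h0 (hsum vs vq hr) (hsum vr vl hl)).trans ?_
  rw [add_assoc, ← ENNReal.ofReal_add (by positivity) (by positivity), ← mul_add]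
  refine add_le_add le_rfl (ENNReal.ofReal_le_ofReal (mul_le_mul_of_nonneg_left ?_ hK))
  linarith

/-- Lipschitz continuity in time of the solution, up to a front. -/
lemma eLpNorm_sub_le (a b : State) {B : ℝ}
    (hB : ∀ t, 0 ≤ t → ∀ x, ‖u t x - front a b (frontPath p φ lam h C t) x‖ ≤ B) {t t' : ℝ}
    (ht : 0 ≤ t) (ht' : 0 ≤ t') :
    eLpNorm (fun x => (u t x - front a b (frontPath p φ lam h C t) x) -
        (u t' x - front a b (frontPath p φ lam h C t') x)) 1 volume ≤
      ENNReal.ofReal ((B + p.invNorm * P) * (4 * lam + 8)) * ENNReal.ofReal (|t - t'| + h) := by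
  have hh := T.mesh
  have hτ := T.tau_pos
  have hlam := T.lam_pos
  have hκ := p.invNorm_pos.le
  have hB0 : 0 ≤ B := (norm_nonneg _).trans (hB 0 le_rfl 0)
  have hP0 : 0 ≤ p.invNorm * P := by
    obtain ⟨tr, tl, tq, ts, vr, vl, vq, vs, hpot⟩ := T.potential 0
    have k1 := vr.nonneg
    have k2 := vl.nonneg
    have k3 := vq.nonneg
    have k4 := vs.nonneg
    have hL := T.solver.one_le
    have hc : 0 < p.c₁ + p.c₃ := add_pos p.c₁_pos p.c₃_pos
    refine mul_nonneg hκ (le_trans ?_ hpot)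
    positivity
  -- The states `a, b` are arbitrary: the unperturbed states give the deviation, `a = b = 0` gives
  -- the solution itself.
  set f : ℝ → ℝ → State := fun t x => u t x - front a b (frontPath p φ lam h C t) x with hf
  set z : ℕ → ℝ := fun n => ((C n).b - 1) * h with hz
  -- In the front cell only the uniform bound `B` is available, so the reference is `0`; elsewhere
  -- it is the state on the left of the grid point, shifted by `a` or `b`.
  set ref : ℕ → ℤ → State := fun n k => if k = 0 then 0 else
    (C n).cell p ((C n).b + 2 * k - 2) - if k < 0 then a else b with href
  let osc : ℕ → ℤ → ℝ≥0∞ := fun n k => ⨆ t ∈ Icc (n * (h / lam)) ((n + 1) * (h / lam)),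
    ⨆ x ∈ Ico (z n + k * (2 * h)) (z n + (k + 1) * (2 * h)), ‖f t x - ref n k‖ₑ
  have hM : ∀ n : ℕ, ∑' k : ℤ, osc n k ≤
      ENNReal.ofReal B + ENNReal.ofReal (p.invNorm * P) := by
    intro n
    refine T.tsum_le n hκ ?_ ?_ ?_
    · refine iSup₂_le fun t ht => iSup₂_le fun x _ => ?_
      have ht0 : 0 ≤ t := (by positivity : 0 ≤ n * (h / lam)).trans ht.1
      simp only [href, if_true, sub_zero]
      exact enorm_le_ofReal (hB t ht0 x)
    · refine fun i => iSup₂_le fun t ht => iSup₂_le fun x hx => enorm_le_ofReal ?_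
      have hx' : x ∈ Ico ((((C n).b + 2 + 2 * i : ℤ) - 1) * h)
          ((((C n).b + 2 + 2 * i : ℤ) + 1) * h) := by
        convert hx using 2 <;> simp only [hz] <;> push_cast <;> ring
      have e : ref n ((i : ℤ) + 1) = ofInvariants p.c₃ ((C n).s i) ((C n).q i) - b := by
        simp only [href]
        rw [if_neg (by omega), if_neg (by omega), ← Config.cell_right']
        congr 2; ring
      have e' : f t x = u t x - b := by
        simp only [hf, front]
        rw [if_neg (T.front_le_of_mem_right ht hx'.1).not_gt]
      rw [e, e', sub_sub_sub_cancel_right]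
      rcases T.state_right i ht hx' with e | e | e <;> rw [e] <;>
        refine (p.norm_sub_le_right _ _ _ _).trans (mul_le_mul_of_nonneg_left ?_ hκ)
      · simp only [sub_self, abs_zero, add_zero]; positivity
      · rw [sub_self, abs_zero, abs_sub_comm ((C n).q _)]
        exact add_le_add (abs_nonneg _) le_rfl
      · rw [abs_sub_comm, abs_sub_comm ((C n).q _)]
    · refine fun i => iSup₂_le fun t ht => iSup₂_le fun x hx => enorm_le_ofReal ?_
      have hx' : x ∈ Ico ((((C n).b - 2 - 2 * i : ℤ) - 1) * h)
          ((((C n).b - 2 - 2 * i : ℤ) + 1) * h) := by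
        convert hx using 2 <;> simp only [hz] <;> push_cast <;> ring
      have e : ref n (-((i : ℤ) + 1)) =
          ofInvariants p.c₁ ((C n).r (i + 1)) ((C n).l (i + 1)) - a := by
        simp only [href]
        rw [if_neg (by omega), if_pos (by omega), ← Config.cell_left']
        congr 2; ring
      have e' : f t x = u t x - a := by
        simp only [hf, front]
        rw [if_pos (T.lt_front_of_mem_left ht hx'.2)]
      rw [e, e', sub_sub_sub_cancel_right]
      rcases T.state_left i ht hx' with e | e | e <;> rw [e] <;>
        refine (p.norm_sub_le_left _ _ _ _).trans (mul_le_mul_of_nonneg_left ?_ hκ)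
      · simp only [sub_self, abs_zero, add_zero]; positivity
      · rw [sub_self, abs_zero]
        exact add_le_add (abs_nonneg _) le_rfl
      · exact le_rfl
  have H : ∀ n : ℕ, ∀ t ∈ Icc (n * (h / lam)) ((n + 1) * (h / lam)), ∀ k : ℤ,
      ∀ x ∈ Ico (z n + k * (2 * h)) (z n + (k + 1) * (2 * h)), ‖f t x - ref n k‖ₑ ≤ osc n k := by
    intro n t ht k x hx
    have h1 := le_iSup₂ (f := fun x (_ : x ∈ Ico (z n + k * (2 * h)) (z n + (k + 1) * (2 * h))) =>
      ‖f t x - ref n k‖ₑ) x hx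
    have h2 := le_iSup₂ (f := fun t (_ : t ∈ Icc (n * (h / lam)) ((n + 1) * (h / lam))) =>
      ⨆ x ∈ Ico (z n + k * (2 * h)) (z n + (k + 1) * (2 * h)), ‖f t x - ref n k‖ₑ) t ht
    exact h1.trans h2
  have key := eLpNorm_sub_le_of_strips (f := f) hτ hh z ref osc hM H ht ht'
  refine key.trans ?_
  have h0 : 0 ≤ B + p.invNorm * P := add_nonneg hB0 hP0
  have e : 4 * h * (|t - t'| / (h / lam) + 2) = 4 * lam * |t - t'| + 8 * h := by
    field_simp
    ring
  have h1 := mul_nonneg hlam.le hh.le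
  have h2 := abs_nonneg (t - t')
  have h3 : 4 * lam * |t - t'| + 8 * h ≤ (4 * lam + 8) * (|t - t'| + h) := by nlinarith
  have h4 : 0 ≤ 4 * lam + 8 := by linarith
  rw [← ENNReal.ofReal_add hB0 hP0, e, ENNReal.ofReal_mul h0,
    mul_assoc (ENNReal.ofReal _), ← ENNReal.ofReal_mul h4]
  exact mul_le_mul_right (ENNReal.ofReal_le_ofReal h3) _

/-- On a cell of a time strip, the solution is a fan. -/
lemma local_fan {n : ℕ} {j : ℤ} (hj : Even (j - (C n).b)) {t : ℝ}
    (ht : t ∈ Ico (n * (h / lam)) ((n + 1) * (h / lam))) : ∃ σ l, 0 < σ ∧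
      (t = n * (h / lam) ∧ l = [(0, (C n).cell p j)] ∨
        σ = t - n * (h / lam) ∧ l = (C n).waves p φ w₀ j) ∧
      ∀ x ∈ Icc ((j - 1) * h) ((j + 1) * h),
        u t x = fan ((C n).cell p (j - 2)) l ((x - j * h) / σ) := by
  have hh := T.mesh
  have hlam := T.lam_pos
  have hV := (T.near n).speed_mem T.solver T.factor T.small
  have h3 := p.c₃_pos
  have h31 := p.c₃_lt_c₁
  have hcfl := T.cfl
  have hj' : Even (j + 2 - (C n).b) := by
    obtain ⟨k, hk⟩ := hj
    exact ⟨k + 1, by linarith⟩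
  have hIcc : ∀ x ∈ Icc (((j : ℝ) - 1) * h) ((j + 1) * h),
      x ∈ Ico (((j : ℝ) - 1) * h) ((j + 1) * h) ∨ x = (j + 1) * h := fun x hx =>
    hx.2.lt_or_eq.imp (fun h => ⟨hx.1, h⟩) id
  have hmem : ∀ x, x = ((j : ℝ) + 1) * h →
      x ∈ Ico ((((j + 2 : ℤ) : ℝ) - 1) * h) (((j + 2 : ℤ) + 1) * h) := by
    rintro x rfl
    push_cast
    constructor <;> nlinarith
  have hlt : t < (n + 1 : ℕ) * (h / lam) := by push_cast; exact ht.2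
  rcases ht.1.eq_or_lt with h0 | h0
  -- At a grid time the fan degenerates to one jump at speed `0`, with an arbitrary positive scale.
  · refine ⟨1, _, one_pos, Or.inl ⟨h0.symm, rfl⟩, fun x hx => ?_⟩
    simp only [fan, div_one, sub_neg]
    rcases hIcc x hx with h1 | h1
    · rcases T.local_form hj (Ico_subset_Icc_self ht) h1 with ⟨-, ⟨e, e'⟩ | ⟨e, e'⟩⟩ | ⟨e, -⟩ | ⟨e, -⟩
      · rw [if_pos e, e']
      · rw [if_neg e.not_gt, e']
      · exact absurd h0 e.1.ne
      · exact absurd e hlt.ne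
    · rcases T.local_form hj' (Ico_subset_Icc_self ht) (hmem x h1) with
        ⟨-, ⟨e, e'⟩ | ⟨e, e'⟩⟩ | ⟨e, -⟩ | ⟨e, -⟩
      · rw [if_neg (by rw [h1]; nlinarith), e', add_sub_cancel_right]
      · push_cast at e
        rw [h1] at e
        nlinarith
      · exact absurd h0 e.1.ne
      · exact absurd e hlt.ne
  · have hσ : 0 < t - n * (h / lam) := sub_pos.2 h0
    have hσ' : t - n * (h / lam) < h / lam := by linarith [ht.2]
    -- By the CFL condition the cell edge lies outside the waves. The right edge belongs to the next
    -- cell, whose fan has the same value there.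
    have hξ : p.c₁ < h / (t - n * (h / lam)) := by
      rw [lt_div_iff₀ hσ]
      calc p.c₁ * (t - n * (h / lam)) < lam * (h / lam) :=
            mul_lt_mul hcfl hσ'.le hσ hlam.le
        _ = h := by field_simp
    refine ⟨_, _, hσ, Or.inr ⟨rfl, rfl⟩, fun x hx => ?_⟩
    rcases hIcc x hx with h1 | h1
    · rcases T.local_form hj (Ico_subset_Icc_self ht) h1 with ⟨e, -⟩ | ⟨-, e⟩ | ⟨e, -⟩
      · exact absurd e h0.ne'
      · exact e
      · exact absurd e hlt.ne
    · have e2 := (C n).fan_waves_of_lt (p := p) (φ := φ) (w₀ := w₀) hj'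
        (ξ := -(h / (t - n * (h / lam)))) (by linarith)
      have e3 := (T.near n).fan_waves_of_ge T.solver T.factor T.small hj hξ.le
      rcases T.local_form hj' (Ico_subset_Icc_self ht) (hmem x h1) with ⟨e, -⟩ | ⟨-, e⟩ | ⟨e, -⟩
      · exact absurd e h0.ne'
      · rw [e, show (x - (j + 2 : ℤ) * h) = -h by rw [h1]; push_cast; ring, neg_div, e2,
          show x - j * h = h by rw [h1]; ring, e3, add_sub_cancel_right]
      · exact absurd e hlt.ne

/-- The variation of the deviation from the unperturbed front. -/
lemma eVariationOn_sub_front_le {t : ℝ} (ht : 0 ≤ t) :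
    eVariationOn (fun x => u t x - front (ofInvariants p.c₁ r₀ l₀) (ofInvariants p.c₃ s₀ q₀)
      (frontPath p φ lam h C t) x) univ ≤
      6 * ENNReal.ofReal (p.invNorm * ((1 + A) * D)) + ENNReal.ofReal (p.invNorm * P) := by
  set a := ofInvariants p.c₁ r₀ l₀ with ha
  set b := ofInvariants p.c₃ s₀ q₀ with hb
  have hh := T.mesh
  have hκ := p.invNorm_pos.le
  obtain ⟨n, hn⟩ := T.mem_strip ht
  refine (eVariationOn_le_tsum_grid _ (show 0 < 2 * h by positivity) (((C n).b - 1) * h)).trans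
    (T.tsum_le n hκ ?_ ?_ ?_)
  · have hI : Icc (((C n).b - 1) * h + ((0 : ℤ) : ℝ) * (2 * h))
        (((C n).b - 1) * h + (((0 : ℤ) : ℝ) + 1) * (2 * h)) =
        Icc ((((C n).b : ℝ) - 1) * h) (((C n).b + 1) * h) := by
      congr 1 <;> push_cast <;> ring
    rw [hI]
    obtain ⟨σ, l, hσ, hl, e⟩ := T.local_fan (j := (C n).b) ⟨0, by ring⟩ hn
    have N := T.near n
    have O := N.out_near T.solver T.factor T.small
    have h0 := (N.le T.solver T.factor T.small).1
    have h2 := mul_le_mul_of_nonneg_right (Config.two_mul_le_outFactor T.factor) h0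
    obtain ⟨V1, V2⟩ := N.speed_mem T.solver T.factor T.small
    have hs := (N.speed T.solver T.factor T.small).1
    have h31 := p.c₃_lt_c₁
    have bl : ∀ l', |l' - l₀| ≤ A * D →
        ‖ofInvariants p.c₁ ((C n).r 0) l' - a‖ ≤ p.invNorm * ((1 + A) * D) := fun l' hl' =>
      (p.norm_sub_le_left _ _ _ _).trans
        (mul_le_mul_of_nonneg_left (by linarith [N.r 0]) hκ)
    have br : ∀ s', |s' - s₀| ≤ 2 * L * D →
        ‖ofInvariants p.c₃ s' ((C n).q 0) - b‖ ≤ p.invNorm * ((1 + A) * D) := fun s' hs' =>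
      (p.norm_sub_le_right _ _ _ _).trans
        (mul_le_mul_of_nonneg_left (by linarith [N.q 0]) hκ)
    -- Removing the front from the fan leaves a fan with the same waves, its states shifted by `a`
    -- before the phase boundary and by `b` after it. At most three jumps between states of norm at
    -- most the uniform bound give the factor `6`; the large jump across the front is gone.
    have key : ∀ {l' : List (ℝ × State)}, (∀ x, u t x - front a b (frontPath p φ lam h C t) x =
        fan (ofInvariants p.c₁ ((C n).r 0) ((C n).l 0) - a) l' ((x - (C n).b * h) / σ) ∨
        x ∉ Icc ((((C n).b : ℝ) - 1) * h) (((C n).b + 1) * h)) →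
        pathLength (ofInvariants p.c₁ ((C n).r 0) ((C n).l 0) - a) l' ≤
          6 * ENNReal.ofReal (p.invNorm * ((1 + A) * D)) →
        eVariationOn (fun x => u t x - front a b (frontPath p φ lam h C t) x)
          (Icc ((((C n).b : ℝ) - 1) * h) (((C n).b + 1) * h)) ≤
          6 * ENNReal.ofReal (p.invNorm * ((1 + A) * D)) := fun h1 h3 =>
      (eVariationOn_le_of_eq_fan hσ fun x hx => (h1 x).resolve_right (not_not_intro hx)).trans h3
    rw [Config.cell_front_left] at e
    have b1 := bl _ (N.l 0)
    have b2 := bl _ O.1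
    have b3 := br _ (N.s 0)
    have b4 := br _ O.2
    rcases hl with ⟨rfl, rfl⟩ | ⟨rfl, rfl⟩
    · refine key (l' := [(0, ofInvariants p.c₃ ((C n).s 0) ((C n).q 0) - b)]) (fun x => ?_) ?_
      · refine or_iff_not_imp_right.2 fun hx => ?_
        rw [e x (not_not.1 hx), T.frontPath_grid, Config.cell_front_right]
        have : (x - (C n).b * h) / σ < 0 ↔ x < (C n).b * h := by
          rw [div_lt_iff₀ hσ, zero_mul, sub_neg]
        by_cases hc : x < (C n).b * h <;> simp [fan, front, this, hc]
      · simp only [pathLength, add_zero]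
        refine (edist_le_of_norm_le b1 b3).trans ?_
        gcongr
        norm_num
    · rw [T.frontPath_eq hn] at key ⊢
      have hlt : ∀ x, x < (C n).b * h + (C n).speed p φ * (t - n * (h / lam)) ↔
          (x - (C n).b * h) / (t - n * (h / lam)) < (C n).speed p φ := fun x => by
        rw [div_lt_iff₀ hσ, sub_lt_iff_lt_add']
      rw [Config.waves_front, Material.frontWaves] at e
      by_cases hg : 0 < p.gap ((C n).r 0) ((C n).q 0)
      · have hs' := (hs hg).2
        rw [if_pos hg] at e
        refine key (l' := [(-p.c₁, ofInvariants p.c₁ ((C n).r 0) ((C n).outLeft p φ) - a),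
          ((C n).speed p φ, ofInvariants p.c₃ ((C n).outRight p φ w₀) ((C n).q 0) - b),
          (p.c₃, ofInvariants p.c₃ ((C n).s 0) ((C n).q 0) - b)]) (fun x => ?_) ?_
        · refine or_iff_not_imp_right.2 fun hx => ?_
          rw [e x (not_not.1 hx)]
          simp only [front, hlt]
          set ξ := (x - (C n).b * h) / (t - n * (h / lam))
          change fan _ [(_, ofInvariants _ _ ((C n).outLeft p φ)), ((C n).speed p φ,
            ofInvariants _ ((C n).outRight p φ w₀) _), _] ξ - _ = _
          by_cases c1 : ξ < (C n).speed p φ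
          · by_cases c2 : ξ < -p.c₁ <;> simp [fan, c1, c2]
          · have c2 : ¬ ξ < -p.c₁ := by linarith
            by_cases c3 : ξ < p.c₃ <;> simp [fan, c1, c2, c3]
        · simp only [pathLength, add_zero]
          refine (add_le_add (edist_le_of_norm_le b1 b2) (add_le_add (edist_le_of_norm_le b2 b4)
            (edist_le_of_norm_le b4 b3))).trans (le_of_eq ?_)
          ring
      · rw [if_neg hg] at e
        refine key (l' := [(-p.c₁, ofInvariants p.c₁ ((C n).r 0) ((C n).outLeft p φ) - a),
          ((C n).speed p φ, ofInvariants p.c₃ ((C n).s 0) ((C n).q 0) - b)]) (fun x => ?_) ?_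
        · refine or_iff_not_imp_right.2 fun hx => ?_
          rw [e x (not_not.1 hx)]
          simp only [front, hlt]
          set ξ := (x - (C n).b * h) / (t - n * (h / lam))
          change fan _ [(_, ofInvariants _ _ ((C n).outLeft p φ)), ((C n).speed p φ, _)] ξ - _ = _
          by_cases c1 : ξ < (C n).speed p φ
          · by_cases c2 : ξ < -p.c₁ <;> simp [fan, c1, c2]
          · have c2 : ¬ ξ < -p.c₁ := by linarith
            simp [fan, c1, c2]
        · simp only [pathLength, add_zero]
          refine (add_le_add (edist_le_of_norm_le b1 b2) (edist_le_of_norm_le b2 b3)).trans ?_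
          rw [← add_mul]
          gcongr
          norm_num
  · intro i
    have hI : Icc (((C n).b - 1) * h + (((i : ℤ) + 1 : ℤ) : ℝ) * (2 * h))
        (((C n).b - 1) * h + ((((i : ℤ) + 1 : ℤ) : ℝ) + 1) * (2 * h)) =
        Icc ((((C n).b + 2 + 2 * i : ℤ) - 1) * h) ((((C n).b + 2 + 2 * i : ℤ) + 1) * h) := by
      congr 1 <;> push_cast <;> ring
    rw [hI]
    obtain ⟨σ, l, hσ, hl, e⟩ := T.local_fan (j := (C n).b + 2 + 2 * i) ⟨1 + i, by ring⟩ hn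
    have h1 : eVariationOn (fun x => u t x - front a b (frontPath p φ lam h C t) x)
        (Icc ((((C n).b + 2 + 2 * i : ℤ) - 1) * h) ((((C n).b + 2 + 2 * i : ℤ) + 1) * h)) =
        eVariationOn (fun x => u t x - b)
        (Icc ((((C n).b + 2 + 2 * i : ℤ) - 1) * h) ((((C n).b + 2 + 2 * i : ℤ) + 1) * h)) := by
      refine eVariationOn.congr fun x hx => ?_
      simp only [front]
      rw [if_neg (T.front_le_of_mem_right (Ico_subset_Icc_self hn) hx.1).not_gt]
    rw [h1, eVariationOn_sub_const]
    refine (eVariationOn_le_of_eq_fan hσ e).trans ?_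
    rw [Config.cell_right']
    rcases hl with ⟨-, rfl⟩ | ⟨-, rfl⟩
    · rw [Config.cell_right_succ]
      simp only [pathLength, add_zero]
      exact edist_le_ofReal (p.norm_sub_le_right _ _ _ _)
    · rw [Config.waves_right]
      simp only [pathLength, Material.contactWaves, add_zero]
      rw [mul_add, ENNReal.ofReal_add (by positivity) (by positivity), add_comm]
      refine add_le_add (edist_le_ofReal ?_) (edist_le_ofReal ?_) <;>
        refine (p.norm_sub_le_right _ _ _ _).trans ?_ <;> simp
  · intro i
    have hI : Icc (((C n).b - 1) * h + ((-((i : ℤ) + 1) : ℤ) : ℝ) * (2 * h))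
        (((C n).b - 1) * h + (((-((i : ℤ) + 1) : ℤ) : ℝ) + 1) * (2 * h)) =
        Icc ((((C n).b - 2 - 2 * i : ℤ) - 1) * h) ((((C n).b - 2 - 2 * i : ℤ) + 1) * h) := by
      congr 1 <;> push_cast <;> ring
    rw [hI]
    obtain ⟨σ, l, hσ, hl, e⟩ := T.local_fan (j := (C n).b - 2 - 2 * i) ⟨-1 - i, by ring⟩ hn
    have h1 : eVariationOn (fun x => u t x - front a b (frontPath p φ lam h C t) x)
        (Icc ((((C n).b - 2 - 2 * i : ℤ) - 1) * h) ((((C n).b - 2 - 2 * i : ℤ) + 1) * h)) =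
        eVariationOn (fun x => u t x - a)
        (Icc ((((C n).b - 2 - 2 * i : ℤ) - 1) * h) ((((C n).b - 2 - 2 * i : ℤ) + 1) * h)) := by
      refine eVariationOn.congr fun x hx => ?_
      have h2 := (abs_lt.1 (T.abs_frontPath_sub_lt hn)).1
      have h3 : (0 : ℝ) ≤ i * h := mul_nonneg (Nat.cast_nonneg _) hh.le
      have h4 := hx.2
      push_cast at h4
      simp only [front]
      rw [if_pos (by nlinarith)]
    rw [h1, eVariationOn_sub_const]
    refine (eVariationOn_le_of_eq_fan hσ e).trans ?_
    rw [Config.cell_left']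
    rcases hl with ⟨-, rfl⟩ | ⟨-, rfl⟩
    · rw [Config.cell_left]
      simp only [pathLength, add_zero]
      refine edist_le_ofReal ((p.norm_sub_le_left _ _ _ _).trans_eq ?_)
      rw [abs_sub_comm, abs_sub_comm ((C n).l _)]
    · rw [Config.waves_left]
      simp only [pathLength, Material.contactWaves, add_zero]
      rw [mul_add, ENNReal.ofReal_add (by positivity) (by positivity), add_comm]
      refine add_le_add (edist_le_ofReal ?_) (edist_le_ofReal ?_) <;>
        refine (p.norm_sub_le_left _ _ _ _).trans ?_ <;> rw [abs_sub_comm] <;> simp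
      rw [abs_sub_comm]

end IsTrack


/-! ### Averages of functions of bounded variation -/

lemma aestronglyMeasurable_of_boundedVariationOn {G : ℝ → State} {s : Set ℝ}
    (hs : MeasurableSet s) (hG : BoundedVariationOn G s) :
    AEStronglyMeasurable G (volume.restrict s) := by
  have key : ∀ {f : ℝ → ℝ}, LocallyBoundedVariationOn f s → AEMeasurable f (volume.restrict s) := by
    intro f hf
    obtain ⟨a, b, ha, hb, e⟩ := hf.exists_monotoneOn_sub_monotoneOn
    rw [e]
    exact (aemeasurable_restrict_of_monotoneOn hs ha).sub
      (aemeasurable_restrict_of_monotoneOn hs hb)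
  have hl := hG.locallyBoundedVariationOn
  exact ((key (LipschitzWith.prod_fst.comp_locallyBoundedVariationOn hl)).prodMk
    (key (LipschitzWith.prod_snd.comp_locallyBoundedVariationOn hl))).aestronglyMeasurable

section

variable {G : ℝ → State} (hG : BoundedVariationOn G (Ioi 0))

include hG

lemma intervalIntegrable_of_boundedVariationOn (k : ℕ) :
    IntervalIntegrable G volume k (k + 1) := by
  rw [intervalIntegrable_iff_integrableOn_Ioc_of_le (by linarith)]
  have hsub : Ioc (k : ℝ) (k + 1) ⊆ Ioi 0 := fun x hx => (Nat.cast_nonneg k).trans_lt hx.1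
  refine Integrable.of_bound
    ((aestronglyMeasurable_of_boundedVariationOn measurableSet_Ioi hG).mono_measure
      (Measure.restrict_mono hsub le_rfl)) (‖G 1‖ + (eVariationOn G (Ioi 0)).toReal) ?_
  refine (ae_restrict_iff' measurableSet_Ioc).2 (ae_of_all _ fun x hx => ?_)
  have h1 := hG.dist_le (hsub hx) (mem_Ioi.2 (one_pos (α := ℝ)))
  rw [dist_eq_norm] at h1
  linarith [norm_sub_norm_le (G x) (G 1)]

/-- Consecutive averages differ by the mean over `x ∈ (0, 1]` of `G (x + k) - G (x + (k + 1))`. For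
each `x`, the sum over `k` is a variation sum along `x, x + 1, …`. -/
lemma sum_enorm_average_sub_le (N : ℕ) :
    ∑ k ∈ Finset.range N, ‖(∫ x in (k : ℝ)..(k + 1), G x) -
      ∫ x in ((k + 1 : ℕ) : ℝ)..((k + 1 : ℕ) + 1), G x‖ₑ ≤ eVariationOn G (Ioi 0) := by
  have hshift : ∀ k : ℕ, ∫ x in (k : ℝ)..(k + 1), G x = ∫ x in Ioc (0 : ℝ) 1, G (x + k) := by
    intro k
    rw [← intervalIntegral.integral_of_le zero_le_one,
      intervalIntegral.integral_comp_add_right (fun x => G x), zero_add, add_comm (1 : ℝ)]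
  have hint : ∀ k : ℕ, IntegrableOn (fun x => G (x + k)) (Ioc (0 : ℝ) 1) := by
    intro k
    have := (intervalIntegrable_of_boundedVariationOn hG k).comp_add_right (k : ℝ)
    simp only [sub_self, add_sub_cancel_left] at this
    rwa [intervalIntegrable_iff_integrableOn_Ioc_of_le zero_le_one] at this
  calc _ ≤ ∑ k ∈ Finset.range N, ∫⁻ x in Ioc (0 : ℝ) 1, ‖G (x + k) - G (x + (k + 1 : ℕ))‖ₑ := by
        refine Finset.sum_le_sum fun k _ => ?_
        rw [hshift k, hshift (k + 1), ← integral_sub (hint k) (hint (k + 1))]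
        exact enorm_integral_le_lintegral_enorm _
    _ = ∫⁻ x in Ioc (0 : ℝ) 1, ∑ k ∈ Finset.range N, ‖G (x + k) - G (x + (k + 1 : ℕ))‖ₑ := by
        exact (lintegral_finsetSum' _ fun k _ =>
          ((hint k).aestronglyMeasurable.sub (hint (k + 1)).aestronglyMeasurable).enorm).symm
    _ ≤ ∫⁻ _ in Ioc (0 : ℝ) 1, eVariationOn G (Ioi 0) := by
        refine setLIntegral_mono measurable_const fun x hx => ?_
        have := eVariationOn.sum_le (f := G) (s := Ioi 0) (n := N) (u := fun k => x + k)
          (fun i j hij => by simpa using hij)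
          (fun i => add_pos_of_pos_of_nonneg hx.1 (Nat.cast_nonneg i))
        refine le_trans (le_of_eq (Finset.sum_congr rfl fun k _ => ?_)) this
        rw [edist_comm, edist_eq_enorm_sub]
    _ = _ := by simp

lemma enorm_average_sub_le {c : State} {E : ℝ≥0∞} (hE : E ≠ ∞) (hc : ∀ x > 0, ‖G x - c‖ₑ ≤ E)
    (k : ℕ) : ‖(∫ x in (k : ℝ)..(k + 1), G x) - c‖ₑ ≤ E := by
  have e : (∫ x in (k : ℝ)..(k + 1), G x) - c = ∫ x in (k : ℝ)..(k + 1), (G x - c) := by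
    rw [intervalIntegral.integral_sub (intervalIntegrable_of_boundedVariationOn hG k)
      intervalIntegrable_const]
    simp
  rw [e, ← ENNReal.ofReal_toReal hE]
  refine enorm_le_ofReal ?_
  have := intervalIntegral.norm_integral_le_of_norm_le_const (a := (k : ℝ)) (b := k + 1)
    (f := fun x => G x - c) (C := E.toReal) ?_
  · simpa using this
  · intro x hx
    rw [uIoc_of_le (by linarith)] at hx
    have h1 := hc x ((Nat.cast_nonneg k).trans_lt hx.1)
    rw [← toReal_enorm]
    exact ENNReal.toReal_mono hE h1

end

/-- A function of bounded variation which is integrable up to a constant on a set of infinite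
measure is uniformly close to this constant. -/
lemma enorm_sub_le_eVariationOn {g : ℝ → State} {s : Set ℝ} {c : State}
    (hs : volume s = ∞) (hsm : MeasurableSet s)
    (hint : ∫⁻ x in s, ‖g x - c‖ₑ ≠ ∞) {x : ℝ} (hx : x ∈ s) :
    ‖g x - c‖ₑ ≤ eVariationOn g s := by
  by_contra! hlt
  obtain ⟨η, hη, hη'⟩ := ENNReal.lt_iff_exists_add_pos_lt.1 hlt
  refine hint (top_unique ?_)
  -- If one point deviates from `c` by more than the variation plus `η`, every point deviates by at
  -- least `η`, and the integral over a set of infinite measure diverges.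
  have h1 : ∫⁻ _ in s, (η : ℝ≥0∞) ≤ ∫⁻ y in s, ‖g y - c‖ₑ := by
    refine setLIntegral_mono' hsm fun y hy => ?_
    have h2 : ‖g x - c‖ₑ ≤ eVariationOn g s + ‖g y - c‖ₑ := by
      have h3 := eVariationOn.edist_le g hx hy
      rw [edist_eq_enorm_sub] at h3
      calc ‖g x - c‖ₑ = ‖(g x - g y) + (g y - c)‖ₑ := by congr 1; abel
        _ ≤ _ := (enorm_add_le _ _).trans (add_le_add h3 le_rfl)
    have hfin : eVariationOn g s ≠ ∞ := (hlt.trans_le le_top).ne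
    exact (ENNReal.add_le_add_iff_left hfin).1 (hη'.le.trans h2)
  refine le_trans (le_of_eq ?_) h1
  rw [setLIntegral_const, hs, ENNReal.mul_top (by exact_mod_cast hη.ne')]

/-- The average of `f` over the interval between `e * k` and `e * (k + 1)`. -/
noncomputable def cellAverage (f : ℝ → State) (e : ℝ) (k : ℕ) : State :=
  e⁻¹ • ∫ y in (e * k)..(e * (k + 1)), f y

lemma cellAverage_eq {e : ℝ} (he : e ≠ 0) (f : ℝ → State) (k : ℕ) :
    cellAverage f e k = ∫ x in (k : ℝ)..(k + 1), f (e * x) := by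
  rw [intervalIntegral.integral_comp_mul_left _ he, cellAverage]

/-- The scaling `x ↦ e x` reduces to unit cells on `(0, ∞)`; a negative `e` serves the left
half-line and numbers its cells away from the origin. The bounds are proved for every representative
of finite variation, then the infimum is taken. -/
lemma cellAverage_bounds {u₀ : ℝ → State} {e : ℝ} (he : e ≠ 0) {s : Set ℝ}
    (hs : volume s = ∞) (hsm : MeasurableSet s) (hes : ∀ x > 0, e * x ∈ s) {c : State}
    (hint : eLpNorm (fun x => u₀ x - c) 1 (volume.restrict s) ≠ ∞) :
    (∀ N, ∑ k ∈ Finset.range N, ‖cellAverage u₀ e k - cellAverage u₀ e (k + 1)‖ₑ ≤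
      totalVariation u₀ s) ∧ ∀ k, ‖cellAverage u₀ e k - c‖ₑ ≤ totalVariation u₀ s := by
  have key : ∀ g : ℝ → State, u₀ =ᵐ[volume.restrict s] g → eVariationOn g s ≠ ∞ →
      (∀ N, ∑ k ∈ Finset.range N, ‖cellAverage u₀ e k - cellAverage u₀ e (k + 1)‖ₑ ≤
      eVariationOn g s) ∧ ∀ k, ‖cellAverage u₀ e k - c‖ₑ ≤ eVariationOn g s := by
    intro g hg hfin
    have hle : eVariationOn (fun x => g (e * x)) (Ioi 0) ≤ eVariationOn g s := by
      rcases he.lt_or_gt with h | h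
      · exact eVariationOn.comp_le_of_antitoneOn g (fun x => e * x)
          (fun x _ y _ hxy => mul_le_mul_of_nonpos_left hxy h.le) fun x hx => hes x hx
      · exact eVariationOn.comp_le_of_monotoneOn g (fun x => e * x)
          (fun x _ y _ hxy => mul_le_mul_of_nonneg_left hxy h.le) fun x hx => hes x hx
    have hG : BoundedVariationOn (fun x => g (e * x)) (Ioi 0) := (hle.trans_lt hfin.lt_top).ne
    have hg' : ∀ᵐ x : ℝ, x ∈ s → u₀ x = g x := (ae_restrict_iff' hsm).1 hg
    have h0 : ∀ᵐ x : ℝ, x ≠ 0 := by simp [ae_iff]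
    have havg : ∀ k, cellAverage u₀ e k = ∫ x in (k : ℝ)..(k + 1), g (e * x) := by
      intro k
      rw [← cellAverage_eq he, cellAverage, cellAverage]
      congr 1
      refine intervalIntegral.integral_congr_ae ?_
      filter_upwards [hg', h0] with x hx hx0 hxk
      refine hx ?_
      have hk : (0 : ℝ) ≤ k := Nat.cast_nonneg k
      have hpos : 0 < x / e := by
        rcases he.lt_or_gt with h | h
        · refine div_pos_of_neg_of_neg (lt_of_le_of_ne ?_ hx0) h
          rcases mem_uIoc.1 hxk with h1 | h1
          · nlinarith [h1.1, h1.2]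
          · nlinarith [h1.1, h1.2]
        · refine div_pos (lt_of_le_of_ne ?_ hx0.symm) h
          rcases mem_uIoc.1 hxk with h1 | h1
          · nlinarith [h1.1, h1.2]
          · nlinarith [h1.1, h1.2]
      have := hes _ hpos
      rwa [mul_div_cancel₀ _ he] at this
    constructor
    · intro N
      simp only [havg]
      exact (sum_enorm_average_sub_le hG N).trans hle
    · intro k
      rw [havg]
      refine enorm_average_sub_le hG hfin (fun x hx => ?_) k
      refine enorm_sub_le_eVariationOn hs hsm ?_ (hes x hx)
      have : ∫⁻ x in s, ‖g x - c‖ₑ = ∫⁻ x in s, ‖u₀ x - c‖ₑ := by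
        refine lintegral_congr_ae ?_
        filter_upwards [hg] with x hx
        rw [hx]
      rwa [this, ← eLpNorm_one_eq_lintegral_enorm]
  constructor
  · intro N
    refine le_iInf₂ fun g hg => ?_
    by_cases h : eVariationOn g s = ∞
    · rw [h]; exact le_top
    · exact (key g hg h).1 N
  · intro k
    refine le_iInf₂ fun g hg => ?_
    by_cases h : eVariationOn g s = ∞
    · rw [h]; exact le_top
    · exact (key g hg h).2 k


lemma totalVariation_le_eVariationOn (f : ℝ → State) (s : Set ℝ) :
    totalVariation f s ≤ eVariationOn f s :=
  iInf₂_le f EventuallyEq.rfl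

lemma totalVariation_le_sub_const (f : ℝ → State) (c : State) (s : Set ℝ) :
    totalVariation f s ≤ totalVariation (fun x => f x - c) s := by
  refine le_iInf₂ fun g hg => ?_
  refine (iInf₂_le (fun x => g x - -c) ?_).trans (eVariationOn_sub_const g (-c) s).le
  filter_upwards [hg] with x hx
  rw [← hx]
  abel

/-! ### The initial configuration and its potential. -/

/-- The configuration of the cell averages of the initial data. -/
noncomputable def initialConfig (p : Material) (u₀ : ℝ → State) (h : ℝ) : Config where
  b := 0
  r k := (cellAverage u₀ (-(2 * h)) k).1 - p.c₁ * (cellAverage u₀ (-(2 * h)) k).2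
  l k := (cellAverage u₀ (-(2 * h)) k).1 + p.c₁ * (cellAverage u₀ (-(2 * h)) k).2
  q k := (cellAverage u₀ (2 * h) k).1 + p.c₃ * (cellAverage u₀ (2 * h) k).2
  s k := (cellAverage u₀ (2 * h) k).1 - p.c₃ * (cellAverage u₀ (2 * h) k).2

lemma initialConfig_cell (p : Material) (u₀ : ℝ → State) (h : ℝ) (m : ℤ) (hm : Even m) :
    (1 / (2 * h)) • ∫ y in (m * h)..((m + 2) * h), u₀ y = (initialConfig p u₀ h).cell p m := by
  obtain ⟨i, rfl⟩ := hm
  have h1 := p.c₁_pos.ne'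
  have h3 := p.c₃_pos.ne'
  obtain ⟨k, rfl | hk⟩ : ∃ k : ℕ, i = k ∨ i = -1 - k := by
    rcases le_or_gt 0 i with hi | hi
    · exact ⟨i.toNat, Or.inl (by omega)⟩
    · exact ⟨(-1 - i).toNat, Or.inr (by omega)⟩
  · have := (initialConfig p u₀ h).cell_right (p := p) k
    rw [show (initialConfig p u₀ h).b + 2 * (k : ℤ) = k + k by
      simp only [initialConfig]; ring] at this
    rw [this]
    simp only [initialConfig]
    rw [ofInvariants_eq h3, cellAverage, one_div]
    congr 2 <;> push_cast <;> ring
  · subst hk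
    have := (initialConfig p u₀ h).cell_left (p := p) k
    rw [show (initialConfig p u₀ h).b - 2 - 2 * (k : ℤ) = -1 - k + (-1 - k) by
      simp only [initialConfig]; ring] at this
    rw [this]
    simp only [initialConfig]
    rw [ofInvariants_eq h1, cellAverage, intervalIntegral.integral_symm, inv_neg, smul_neg,
      neg_smul, one_div]
    congr 3 <;> push_cast <;> ring

lemma abs_sub_mul_le (c : ℝ) (hc : 0 ≤ c) (u : State) :
    |u.1 - c * u.2| ≤ (1 + c) * ‖u‖ ∧ |u.1 + c * u.2| ≤ (1 + c) * ‖u‖ := by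
  have h1 : |u.1| ≤ ‖u‖ := norm_fst_le u
  have h2 : |u.2| ≤ ‖u‖ := norm_snd_le u
  have h3 := mul_le_mul_of_nonneg_left h2 hc
  have h4 : |c * u.2| = c * |u.2| := by rw [abs_mul, abs_of_nonneg hc]
  constructor
  · have := abs_sub u.1 (c * u.2)
    linarith
  · have := abs_add_le u.1 (c * u.2)
    linarith

/-- Bounds of the averages of the data by their variation. -/
lemma initialConfig_bounds (p : Material) {u₀ : ℝ → State} {h : ℝ} (hh : 0 < h) {uL uR : State}
    {V : ℝ} (hV : totalVariation u₀ (Iio 0) + totalVariation u₀ (Ioi 0) ≤ ENNReal.ofReal V)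
    (hV0 : 0 ≤ V)
    (hL : eLpNorm (fun x => u₀ x - uL) 1 (volume.restrict (Iio 0)) ≠ ∞)
    (hR : eLpNorm (fun x => u₀ x - uR) 1 (volume.restrict (Ioi 0)) ≠ ∞) :
    ((∀ k, |(initialConfig p u₀ h).r k - (uL.1 - p.c₁ * uL.2)| ≤ (1 + p.c₁) * V) ∧
      (∀ k, |(initialConfig p u₀ h).l k - (uL.1 + p.c₁ * uL.2)| ≤ (1 + p.c₁) * V) ∧
      (∀ k, |(initialConfig p u₀ h).q k - (uR.1 + p.c₃ * uR.2)| ≤ (1 + p.c₁) * V) ∧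
      (∀ k, |(initialConfig p u₀ h).s k - (uR.1 - p.c₃ * uR.2)| ≤ (1 + p.c₁) * V)) ∧
    HasVariation (initialConfig p u₀ h).r ((1 + p.c₁) * V) ∧
      HasVariation (initialConfig p u₀ h).l ((1 + p.c₁) * V) ∧
      HasVariation (initialConfig p u₀ h).q ((1 + p.c₁) * V) ∧
      HasVariation (initialConfig p u₀ h).s ((1 + p.c₁) * V) := by
  have h1 := p.c₁_pos
  have h3 := p.c₃_pos
  have h31 := p.c₃_lt_c₁
  obtain ⟨L1, L2⟩ := cellAverage_bounds (u₀ := u₀) (e := -(2 * h)) (by linarith) (s := Iio 0)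
    (by simp) measurableSet_Iio (fun x hx => by simp only [mem_Iio]; nlinarith) hL
  obtain ⟨R1, R2⟩ := cellAverage_bounds (u₀ := u₀) (e := 2 * h) (by linarith) (s := Ioi 0)
    (by simp) measurableSet_Ioi (fun x hx => by simp only [mem_Ioi]; nlinarith) hR
  have near : ∀ {a : ℕ → State} {c : State}, (∀ k, ‖a k - c‖ₑ ≤ ENNReal.ofReal V) →
      ∀ k, ‖a k - c‖ ≤ V := by
    intro a c ha k
    have := ha k
    rwa [← ofReal_norm, ENNReal.ofReal_le_ofReal_iff hV0] at this
  have var : ∀ {a : ℕ → State},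
      (∀ N, ∑ k ∈ Finset.range N, ‖a k - a (k + 1)‖ₑ ≤ ENNReal.ofReal V) →
      ∀ N, ∑ k ∈ Finset.range N, ‖a k - a (k + 1)‖ ≤ V := by
    intro a ha N
    have := ha N
    simp only [← ofReal_norm] at this
    rwa [← ENNReal.ofReal_sum_of_nonneg fun i _ => norm_nonneg _,
      ENNReal.ofReal_le_ofReal_iff hV0] at this
  have L1' := var fun N => (L1 N).trans (le_self_add.trans hV)
  have L2' := near fun N => (L2 N).trans (le_self_add.trans hV)
  have R1' := var fun N => (R1 N).trans (le_add_self.trans hV)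
  have R2' := near fun N => (R2 N).trans (le_add_self.trans hV)
  have lift : ∀ {c : ℝ}, 0 < c → c ≤ p.c₁ → ∀ u v : State,
      |(u.1 - c * u.2) - (v.1 - c * v.2)| ≤ (1 + p.c₁) * ‖u - v‖ ∧
      |(u.1 + c * u.2) - (v.1 + c * v.2)| ≤ (1 + p.c₁) * ‖u - v‖ := by
    intro c hc hc1 u v
    obtain ⟨i1, i2⟩ := abs_sub_mul_le c hc.le (u - v)
    have i3 : (1 + c) * ‖u - v‖ ≤ (1 + p.c₁) * ‖u - v‖ := by gcongr
    constructor
    · refine le_trans (le_of_eq ?_) (i1.trans i3)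
      congr 1
      simp only [Prod.fst_sub, Prod.snd_sub]
      ring
    · refine le_trans (le_of_eq ?_) (i2.trans i3)
      congr 1
      simp only [Prod.fst_sub, Prod.snd_sub]
      ring
  have up : ∀ {x : ℝ}, x ≤ V → (1 + p.c₁) * x ≤ (1 + p.c₁) * V := fun hx => by gcongr
  have sums : ∀ {a : ℕ → State} {f : ℕ → ℝ},
      (∀ N, ∑ k ∈ Finset.range N, ‖a k - a (k + 1)‖ ≤ V) →
      (∀ k, |f k - f (k + 1)| ≤ (1 + p.c₁) * ‖a k - a (k + 1)‖) →
      HasVariation f ((1 + p.c₁) * V) := by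
    intro a f ha hf N
    refine (Finset.sum_le_sum fun k _ => hf k).trans ?_
    rw [← Finset.mul_sum]
    exact up (ha N)
  refine ⟨⟨fun k => ((lift h1 le_rfl _ _).1).trans (up (L2' k)),
    fun k => ((lift h1 le_rfl _ _).2).trans (up (L2' k)),
    fun k => ((lift h3 h31.le _ _).2).trans (up (R2' k)),
    fun k => ((lift h3 h31.le _ _).1).trans (up (R2' k))⟩,
    sums L1' fun k => (lift h1 le_rfl _ _).1, sums L1' fun k => (lift h1 le_rfl _ _).2,
    sums R1' fun k => (lift h3 h31.le _ _).2, sums R1' fun k => (lift h3 h31.le _ _).1⟩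

namespace Config

variable {p : Material} {φ : ℝ → ℝ} {w₀ r₀ l₀ q₀ s₀ δ L D A : ℝ}

/-- The ratio of the initial potential and the variation of the data. -/
noncomputable def potentialFactor (p : Material) (r₀ q₀ δ L A : ℝ) : ℝ :=
  2 + 2 * A + 2 * (2 * L + L / (p.c₁ + p.c₃)) + 4 * L +
    L * (|p.gap r₀ q₀| + 2 * δ / (p.c₁ + p.c₃))

lemma IsNear.hasPotential (S : p.IsLocalSolver φ w₀ r₀ l₀ q₀ s₀ δ L)
    (hA : A = outFactor p r₀ q₀ L) (hD : A * D ≤ δ) {c : Config}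
    (hc : c.IsNear r₀ l₀ q₀ s₀ D L A) (vr : HasVariation c.r D) (vl : HasVariation c.l D)
    (vq : HasVariation c.q D) (vs : HasVariation c.s D) :
    c.HasPotential p φ w₀ L (potentialFactor p r₀ q₀ δ L A * D) := by
  refine ⟨D, D, D, D, vr, vl, vq, vs, ?_⟩
  obtain ⟨h0, h1, -⟩ := hc.le S hA hD
  obtain ⟨o1, o2⟩ := hc.out_near S hA hD
  have hL : 0 ≤ L := by linarith [S.one_le]
  have hc13 : 0 < p.c₁ + p.c₃ := add_pos p.c₁_pos p.c₃_pos
  have i1 := abs_sub_le (c.outLeft p φ) l₀ (c.l 0)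
  have i2 := abs_sub_le (c.outRight p φ w₀) s₀ (c.s 0)
  rw [abs_sub_comm l₀] at i1
  rw [abs_sub_comm s₀] at i2
  have i3 : max (-c.gap p) 0 ≤ |p.gap r₀ q₀| + 2 * δ / (p.c₁ + p.c₃) := by
    have e : c.gap p = p.gap r₀ q₀ + ((c.q 0 - q₀) - (c.r 0 - r₀)) / (p.c₁ + p.c₃) := by
      simp only [gap, Material.gap]; ring
    have e2 : |((c.q 0 - q₀) - (c.r 0 - r₀)) / (p.c₁ + p.c₃)| ≤ 2 * δ / (p.c₁ + p.c₃) := by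
      rw [abs_div, abs_of_pos hc13]
      gcongr
      linarith [abs_sub (c.q 0 - q₀) (c.r 0 - r₀), hc.q 0, hc.r 0]
    refine max_le ?_ ((abs_nonneg _).trans (le_add_of_nonneg_right ((abs_nonneg _).trans e2)))
    rw [e]
    linarith [neg_abs_le (p.gap r₀ q₀),
      neg_abs_le (((c.q 0 - q₀) - (c.r 0 - r₀)) / (p.c₁ + p.c₃))]
  have i4 := mul_le_mul_of_nonneg_right (mul_le_mul_of_nonneg_left i3 hL) h0
  have i5 := hc.l 0
  have i6 := hc.s 0
  unfold potentialFactor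
  linarith

end Config

/-- Glimm's scheme is defined for data close to a phase boundary, and follows it. -/
lemma exists_isTrack {p : Material} {φ : ℝ → ℝ} {uL uR : State} {δ L A : ℝ}
    (S : p.IsLocalSolver φ uR.2 (uL.1 - p.c₁ * uL.2) (uL.1 + p.c₁ * uL.2) (uR.1 + p.c₃ * uR.2)
      (uR.1 - p.c₃ * uR.2) δ L)
    (hA : A = Config.outFactor p (uL.1 - p.c₁ * uL.2) (uR.1 + p.c₃ * uR.2) L)
    {lam h V K : ℝ} (hlam : p.c₁ < lam) (hh : 0 < h) {a : ℕ → ℝ} {u₀ : ℝ → State} (hV0 : 0 ≤ V)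
    (hK : K = Config.potentialFactor p (uL.1 - p.c₁ * uL.2) (uR.1 + p.c₃ * uR.2) δ L A)
    (hV : totalVariation u₀ (Iio 0) + totalVariation u₀ (Ioi 0) ≤ ENNReal.ofReal V)
    (hL : eLpNorm (fun x => u₀ x - uL) 1 (volume.restrict (Iio 0)) ≠ ∞)
    (hR : eLpNorm (fun x => u₀ x - uR) 1 (volume.restrict (Ioi 0)) ≠ ∞)
    (hVδ : A * ((1 + p.c₁) * V) ≤ δ) (hV1 : K * ((1 + p.c₁) * V) ≤ 1) :
    (∃ u, IsGlimmApproximation p φ lam h a u₀ u) ∧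
      ∀ u, IsGlimmApproximation p φ lam h a u₀ u →
        ∃ C, IsTrack p φ uR.2 (uL.1 - p.c₁ * uL.2) (uL.1 + p.c₁ * uL.2) (uR.1 + p.c₃ * uR.2)
          (uR.1 - p.c₃ * uR.2) δ ((1 + p.c₁) * V) L A (K * ((1 + p.c₁) * V)) lam h C u := by
  have h1 := p.c₁_pos
  have hlam0 := h1.trans hlam
  have hL1 := S.one_le
  have hD0 : 0 ≤ (1 + p.c₁) * V := by positivity
  obtain ⟨⟨br, bl, bq, bs⟩, vr, vl, vq, vs⟩ := initialConfig_bounds p hh hV hV0 hL hR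
  have hA2 := Config.two_mul_le_outFactor hA
  have N : (initialConfig p u₀ h).IsNear (uL.1 - p.c₁ * uL.2) (uL.1 + p.c₁ * uL.2)
      (uR.1 + p.c₃ * uR.2) (uR.1 - p.c₃ * uR.2) ((1 + p.c₁) * V) L A :=
    ⟨br, bq, fun k => (bs k).trans (le_mul_of_one_le_left hD0 (by linarith)),
      fun k => (bl k).trans (le_mul_of_one_le_left hD0 (by linarith))⟩
  have Pot := N.hasPotential S hA hVδ vr vl vq vs
  rw [← hK] at Pot
  have hcell := initialConfig_cell p u₀ h
  refine ⟨N.exists_isGlimmApproximation S hA hVδ rfl hlam0 hh hcell, fun u hu => ?_⟩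
  exact ⟨_, S, hA, hVδ, hlam, hh, N.orbit S hA hVδ lam a, Pot.orbit S hA hVδ N hV1 lam a,
    fun n => ⟨_, rfl⟩, Config.even_orbit lam a _ rfl,
    N.isRealization S hA hVδ rfl hlam0 hh hcell hu⟩

end PhaseDyn

/-! ### Choice of the constants and the final estimates. -/

theorem theorem3p1
    (p : PhaseDyn.Material) (φ : ℝ → ℝ) (hφ : p.IsDissipationFunction φ)
    -- the unperturbed states, joined by a single phase boundary of speed `Vs`
    (uLs uRs : PhaseDyn.State) (Vs : ℝ)
    (hL : uLs ∈ p.H₁) (hR : uRs ∈ p.H₃)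
    (hL' : uLs.2 < p.wM) (hR' : p.wm < uRs.2)
    (hstar : PhaseDyn.IsRiemannSolution p φ uLs uRs (PhaseDyn.fan uLs [(Vs, uRs)]))
    (hchar : Vs = p.c₃ → uLs.2 = 0 ∧ uRs.2 = Real.sqrt (p.slopeAtSound φ / p.c₃))
    -- the mesh ratio `lam = h / τ` (CFL condition)
    (lam : ℝ) (hlam : p.c₁ < lam) :
    ∃ ε : ℝ, 0 < ε ∧ ∃ C : ℝ≥0,
      ∀ (h : ℝ), 0 < h → ∀ a : ℕ → ℝ, (∀ n, a n ∈ Ioo (-1 : ℝ) 1) →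
      ∀ u₀ : ℝ → PhaseDyn.State, (∀ᵐ x, u₀ x ∈ p.H₁ ∪ p.H₃) →
        PhaseDyn.bvNorm (fun x => u₀ x - uLs) (Iio 0) +
            PhaseDyn.bvNorm (fun x => u₀ x - uRs) (Ioi 0) < ENNReal.ofReal ε →
        -- the scheme is well defined for all times, and
        (∃ u, PhaseDyn.IsGlimmApproximation p φ lam h a u₀ u) ∧
        ∀ u, PhaseDyn.IsGlimmApproximation p φ lam h a u₀ u →
          ∃ χ : ℝ → ℝ, PhaseDyn.IsPhaseBoundary p u χ ∧
            (∀ t, 0 ≤ t →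
              PhaseDyn.totalVariation
                  (fun x => u t x - PhaseDyn.front uLs uRs (χ t) x) univ ≤
                C * PhaseDyn.dataVariation p Vs uLs uRs u₀) ∧
            (∀ t, 0 ≤ t →
              eLpNorm (fun x => u t x - PhaseDyn.front uLs uRs (χ t) x) ∞ volume ≤
                C * (PhaseDyn.dataVariation p Vs uLs uRs u₀ +
                  PhaseDyn.dataSup uLs uRs u₀)) ∧
            (∀ t t', 0 ≤ t → 0 ≤ t' →
              eLpNorm (fun x => (u t x - PhaseDyn.front uLs uRs (χ t) x) -
                  (u t' x - PhaseDyn.front uLs uRs (χ t') x)) 1 volume ≤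
                C * PhaseDyn.dataVariation p Vs uLs uRs u₀ *
                  ENNReal.ofReal (|t - t'| + h)) ∧
            (∀ t t', 0 ≤ t → 0 ≤ t' →
              eLpNorm (fun x => u t x - u t' x) 1 volume ≤
                C * ENNReal.ofReal (|t - t'| + h)) := by
  have h1 := p.c₁_pos
  have h1' := p.c₁_pos.ne'
  have h3' := p.c₃_pos.ne'
  obtain ⟨δ, L, S⟩ := p.exists_isLocalSolver hφ hL hR hL' hR' hstar hchar
  obtain ⟨A, hA⟩ : ∃ A, A = PhaseDyn.Config.outFactor p (uLs.1 - p.c₁ * uLs.2)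
    (uRs.1 + p.c₃ * uRs.2) L := ⟨_, rfl⟩
  obtain ⟨K, hK⟩ : ∃ K, K = PhaseDyn.Config.potentialFactor p (uLs.1 - p.c₁ * uLs.2)
    (uRs.1 + p.c₃ * uRs.2) δ L A := ⟨_, rfl⟩
  have hδ := S.pos
  have hL1 := S.one_le
  have hA2 := PhaseDyn.Config.two_mul_le_outFactor hA
  have hA0 : 0 < A := by linarith
  have hK0 : 0 < K := by
    have hc13 : 0 < p.c₁ + p.c₃ := add_pos p.c₁_pos p.c₃_pos
    rw [hK, PhaseDyn.Config.potentialFactor]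
    positivity
  have hκ := p.invNorm_pos
  have hlam0 := h1.trans hlam
  set κ := p.invNorm with hκdef
  -- The first bound keeps all invariants in the domain of the local solver, the second keeps the
  -- potential at most `1`.
  obtain ⟨ε, hε⟩ : ∃ ε, ε = min (δ / (A * (1 + p.c₁))) (1 / (K * (1 + p.c₁))) := ⟨_, rfl⟩
  have hε0 : 0 < ε := by rw [hε]; positivity
  -- The coefficient of the variation bound, with `D = (1 + c₁) V` and potential `K D`; it also
  -- dominates the uniform bound.
  obtain ⟨X, hX⟩ : ∃ X, X = (6 * (κ * (1 + A)) + κ * K) * (1 + p.c₁) := ⟨_, rfl⟩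
  have hX0 : 0 ≤ X := by rw [hX]; positivity
  obtain ⟨Y, hY⟩ : ∃ Y, Y = ‖uLs‖ + ‖uRs‖ := ⟨_, rfl⟩
  have hY0 : 0 ≤ Y := by rw [hY]; positivity
  obtain ⟨Z, hZ⟩ : ∃ Z, Z = (X + X * ε + Y) * (4 * lam + 8) := ⟨_, rfl⟩
  have hZ1 : X * (4 * lam + 8) ≤ Z := by
    rw [hZ]
    refine mul_le_mul_of_nonneg_right ?_ (by linarith)
    have := mul_nonneg hX0 hε0.le
    linarith
  have hZ2 : (X * ε + Y) * (4 * lam + 8) ≤ Z := by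
    rw [hZ]
    refine mul_le_mul_of_nonneg_right ?_ (by linarith)
    linarith
  have hXZ : X ≤ Z := le_trans (le_mul_of_one_le_right hX0 (by linarith)) hZ1
  refine ⟨ε, hε0, Z.toNNReal, fun h hh a _ u₀ _ hsmall => ?_⟩
  rw [show ((Z.toNNReal : ℝ≥0) : ℝ≥0∞) = ENNReal.ofReal Z from rfl]
  -- the size of the data
  have hTsum : PhaseDyn.totalVariation u₀ (Iio 0) + PhaseDyn.totalVariation u₀ (Ioi 0) ≤
      PhaseDyn.bvNorm (fun x => u₀ x - uLs) (Iio 0) +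
        PhaseDyn.bvNorm (fun x => u₀ x - uRs) (Ioi 0) :=
    add_le_add ((PhaseDyn.totalVariation_le_sub_const u₀ uLs _).trans le_add_self)
      ((PhaseDyn.totalVariation_le_sub_const u₀ uRs _).trans le_add_self)
  have hTlt := hTsum.trans_lt hsmall
  -- The variation of the data controls everything, including the distance of the cell averages to
  -- the unperturbed states; it is the part of `N₁` present in both cases.
  obtain ⟨V, hV⟩ : ∃ V, V = (PhaseDyn.totalVariation u₀ (Iio 0) +
    PhaseDyn.totalVariation u₀ (Ioi 0)).toReal := ⟨_, rfl⟩
  have hV0 : 0 ≤ V := by rw [hV]; exact ENNReal.toReal_nonneg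
  have hVeq : ENNReal.ofReal V = PhaseDyn.totalVariation u₀ (Iio 0) +
      PhaseDyn.totalVariation u₀ (Ioi 0) := by
    rw [hV, ENNReal.ofReal_toReal (hTlt.trans_le le_top).ne]
  have hVε : V ≤ ε := by
    rw [← hVeq, ENNReal.ofReal_lt_ofReal_iff hε0] at hTlt
    exact hTlt.le
  have hdata : ENNReal.ofReal V ≤ PhaseDyn.dataVariation p Vs uLs uRs u₀ := by
    rw [hVeq]
    exact le_self_add
  have hfin := (hsmall.trans_le le_top).ne
  have hVδ : A * ((1 + p.c₁) * V) ≤ δ := by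
    have : V ≤ δ / (A * (1 + p.c₁)) := hVε.trans (hε ▸ min_le_left _ _)
    rw [le_div_iff₀ (by positivity)] at this
    linarith
  have hV1 : K * ((1 + p.c₁) * V) ≤ 1 := by
    have : V ≤ 1 / (K * (1 + p.c₁)) := hVε.trans (hε ▸ min_le_right _ _)
    rw [le_div_iff₀ (by positivity)] at this
    linarith
  obtain ⟨hex, htrack⟩ := PhaseDyn.exists_isTrack (a := a) S hA hlam hh hV0 hK hVeq.ge
    (fun e => hfin (by simp [PhaseDyn.bvNorm, e])) (fun e => hfin (by simp [PhaseDyn.bvNorm, e]))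
    hVδ hV1
  refine ⟨hex, fun u hu => ?_⟩
  obtain ⟨C, T⟩ := htrack u hu
  have eL := PhaseDyn.ofInvariants_eq h1' uLs
  have eR := PhaseDyn.ofInvariants_eq h3' uRs
  have hsup := fun t ht x => T.norm_sub_front_le (t := t) ht x
  have hvar := fun t ht => T.eVariationOn_sub_front_le (t := t) ht
  rw [eL, eR] at hsup hvar
  have hXV : κ * ((1 + A) * ((1 + p.c₁) * V)) ≤ X * V := by
    have i1 : 0 ≤ (5 * (κ * (1 + A)) + κ * K) * (1 + p.c₁) * V := by positivity
    rw [hX]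
    linarith
  have hXV' : κ * ((1 + A) * ((1 + p.c₁) * V)) + κ * (K * ((1 + p.c₁) * V)) ≤ X * V := by
    have i1 : 0 ≤ 5 * (κ * (1 + A)) * (1 + p.c₁) * V := by positivity
    rw [hX]
    linarith
  have hscale : ∀ {x : ℝ}, x ≤ Z * V →
      ENNReal.ofReal x ≤ ENNReal.ofReal Z * PhaseDyn.dataVariation p Vs uLs uRs u₀ := by
    intro x hx
    have hZ0 : 0 ≤ Z := hX0.trans hXZ
    refine (ENNReal.ofReal_le_ofReal hx).trans ?_
    rw [ENNReal.ofReal_mul hZ0]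
    exact mul_le_mul_right hdata _
  have hXZV : X * V ≤ Z * V := mul_le_mul_of_nonneg_right hXZ hV0
  refine ⟨PhaseDyn.frontPath p φ lam h C, T.isPhaseBoundary, ?_, ?_, ?_, ?_⟩
  · intro t ht
    refine (PhaseDyn.totalVariation_le_eVariationOn _ _).trans ((hvar t ht).trans ?_)
    have i1 : 0 ≤ κ * ((1 + A) * ((1 + p.c₁) * V)) := by positivity
    have i2 : 0 ≤ κ * (K * ((1 + p.c₁) * V)) := by positivity
    rw [← ENNReal.ofReal_ofNat 6, ← ENNReal.ofReal_mul (by norm_num),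
      ← ENNReal.ofReal_add (by positivity) i2]
    refine hscale (le_trans (le_of_eq ?_) hXZV)
    rw [hX]
    ring
  · intro t ht
    refine (eLpNorm_le_of_ae_bound (C := X * V) (ae_of_all _ fun x => (hsup t ht x).trans hXV)).trans
      ?_
    simp only [ENNReal.toReal_top, inv_zero, ENNReal.rpow_zero, one_mul]
    exact (hscale hXZV).trans (mul_le_mul_right le_self_add _)
  · intro t t' ht ht'
    refine (T.eLpNorm_sub_le uLs uRs hsup ht ht').trans (mul_le_mul_left (hscale ?_) _)
    have i1 := mul_le_mul_of_nonneg_right hXV' (show 0 ≤ 4 * lam + 8 by linarith)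
    have i2 := mul_le_mul_of_nonneg_right hZ1 hV0
    linarith
  · intro t t' ht ht'
    -- For the solution itself the front cell contributes a term of order one, since the moving jump
    -- is not removed; hence no factor `N₁` in the last estimate.
    have hB : ∀ t, 0 ≤ t → ∀ x,
        ‖u t x - PhaseDyn.front 0 0 (PhaseDyn.frontPath p φ lam h C t) x‖ ≤
          κ * ((1 + A) * ((1 + p.c₁) * V)) + Y := by
      intro t ht x
      have i1 : PhaseDyn.front 0 0 (PhaseDyn.frontPath p φ lam h C t) x = 0 := by
        simp [PhaseDyn.front]
      have i2 : ‖PhaseDyn.front uLs uRs (PhaseDyn.frontPath p φ lam h C t) x‖ ≤ Y := by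
        have j1 := norm_nonneg uLs
        have j2 := norm_nonneg uRs
        rw [PhaseDyn.front, hY]
        split_ifs <;> linarith
      have i3 := norm_sub_norm_le (u t x)
        (PhaseDyn.front uLs uRs (PhaseDyn.frontPath p φ lam h C t) x)
      rw [i1, sub_zero]
      linarith [hsup t ht x]
    have key := T.eLpNorm_sub_le 0 0 hB ht ht'
    simp only [PhaseDyn.front, ite_self, sub_zero] at key
    refine key.trans (mul_le_mul_left (ENNReal.ofReal_le_ofReal (le_trans ?_ hZ2)) _)
    refine mul_le_mul_of_nonneg_right ?_ (by linarith)
    have := mul_le_mul_of_nonneg_left hVε hX0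
    linarith
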